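/- Let $H=L^2(0,1)$, with norm $\|\cdot\|$ and inner product $\langle\cdot,\cdot\rangle$, let $\mu$ be the law on $H$ of a Brownian bridge from $0$ to $0$ over $[0,1]$, and let $e_k(x)=\sqrt2\sin(k\pi x)$, $\lambda_k=k^2\pi^2$ for $k\ge1$. Let $$g_t(x,x')=\sum_{k\ge1}e^{-\lambda_kt/2}e_k(x)e_k(x'),\quad z(t,x)=\int_0^1g_t(x,x')z(x')\,dx',\quad q_t(x)=\int_0^tg_{2\tau}(x,x)\,d\tau\qquad(t>0,\ z\in H).$$ For $z\in H$ let $v_t(z)=v(t,\cdot)$ be the solution $v(t,x)=z(t,x)+\int_0^t\int_0^1g_{t-s}(x,x')\,\xi(ds,dx')$ of the stochastic heat equation $\partial_tv=\frac12\partial_x^2v+\xi$ on $[0,1]$ with homogeneous Dirichlet boundary conditions, initial condition $z$ and space-time white noise $\xi$, and let $\mathbf Q_tF(z)=\mathbb E[F(v_t(z))]$. Let $D(\Lambda)=W^{1,2}(\mu)$ be the domain of the closure of the gradient $\nabla$, viewed as an operator from $L^2(\mu)$ to $L^2(\mu;H)$ and defined on the functionals $z\mapsto\psi(\langle l_1,z\rangle,\dots,\langle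 l_m,z\rangle)$ with $l_i\in\mathrm{Span}\{e_k:k\ge1\}$ and $\psi\in C_b^\infty(\mathbb R^m)$. Let $\Lambda(F,G)=\frac12\int_H\langle\nabla F,\nabla G\rangle\,d\mu$ for $F,G\in D(\Lambda)$, and equip $D(\Lambda)$ with the inner product $\Lambda_1(F,G)=\Lambda(F,G)+\int_HFG\,d\mu$. Let $h\in C^2_c(0,1)$, let $\rho\ge0$ be an even smooth function on $\mathbb R$ supported in $[-1,1]$ with $\int_{-1}^1\rho=1$, and for $\epsilon>0$ let $\rho_\epsilon(y)=\frac1\epsilon\rho(\frac y\epsilon)$ and $$G_\epsilon(z)=\frac12\int_0^1h_r\,\rho_\epsilon''(z_r)\,dr,\qquad U_\epsilon(z)=\int_0^\infty e^{-t}\,\mathbf Q_tG_\epsilon(z)\,dt,\qquad z\in H.$$ For $t>0$ and $z\in H$ let $$G^{(t)}(z)=\int_0^1\frac{h_r}{2\sqrt{2\pi q_t(r)}}\left[\left(\frac{z(t,r)}{q_t(r)}\right)^2-\frac1{q_t(r)}\right]\exp\left(-\frac{z(t,r)^2}{2q_t(r)}\right)dr.$$ Then for every $z\in H$ the integrals that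 define $G^{(t)}(z)$ $(t>0)$, $$U(z)=\int_0^\infty e^{-t}\,G^{(t)}(z)\,dt$$ and $U_\epsilon(z)$ $(\epsilon>0)$ converge absolutely (in $r$ for $G^{(t)}$, in $t$ for $U$ and $U_\epsilon$); the functional $U:H\to\mathbb R$ belongs to $D(\Lambda)$, so does $U_\epsilon$ for every $\epsilon>0$, and $U_\epsilon\to U$ in $D(\Lambda)$ as $\epsilon\downarrow0$, that is, $\Lambda_1(U_\epsilon-U,U_\epsilon-U)\to0$. -/

import Mathlib

open MeasureTheory ProbabilityTheory Set Filter Topology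
open scoped InnerProductSpace

noncomputable section

namespace StochHeat

/-! ### The Hilbert space `H = L²(0,1)` -/

/-- Lebesgue measure on `(0,1)`. -/
abbrev vol01 : Measure ℝ := volume.restrict (Ioo (0 : ℝ) 1)

/-- The Hilbert space `H = L²(0,1)`. -/
abbrev H : Type := Lp ℝ 2 vol01

instance instMeasurableSpaceH : MeasurableSpace H := borel H

instance instBorelSpaceH : BorelSpace H := ⟨rfl⟩

open Classical in
/-- The class in `H` of a function that is square integrable on `(0,1)`; it is `0` for all other
functions. -/
def toH (f : ℝ → ℝ) : H := if hf : MemLp f 2 vol01 then hf.toLp f else 0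

/-! ### The Dirichlet heat kernel on `[0,1]` -/

/-- `e_k(x) = √2 sin(kπx)`, of which the members with `k ≥ 1` form an orthonormal basis of `H`. -/
def e (k : ℕ) (x : ℝ) : ℝ := √2 * Real.sin (k * Real.pi * x)

/-- `λ_k = k²π²`. -/
def eigval (k : ℕ) : ℝ := (k : ℝ) ^ 2 * Real.pi ^ 2

/-- The fundamental solution of `∂_t g = ½ ∂_x² g` on `[0,1]` with homogeneous Dirichlet boundary
conditions, `g_t(x,x') = ∑_{k ≥ 1} exp(-λ_k t / 2) e_k(x) e_k(x')`, for `t > 0`. -/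
def heatKernel (t x x' : ℝ) : ℝ :=
  ∑' k : ℕ, Real.exp (-(eigval (k + 1) / 2) * t) * e (k + 1) x * e (k + 1) x'

/-- The solution `z(t,x) = ∫₀¹ g_t(x,x') z(x') dx'` of the heat equation started from `z`,
for `t > 0`. -/
def heatFlow (z : H) (t x : ℝ) : ℝ := ∫ x' in Ioo (0 : ℝ) 1, heatKernel t x x' * z x'

/-- `q_t(x) = q_t(x,x) = ∫₀ᵗ g_{2τ}(x,x) dτ`. -/
def qVar (t x : ℝ) : ℝ := ∫ τ in Ioo (0 : ℝ) t, heatKernel (2 * τ) x x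

/-! ### White noise and the stochastic heat equation -/

/-- Lebesgue measure on space-time `(0,∞) × (0,1)`. -/
abbrev volST : Measure (ℝ × ℝ) := volume.restrict (Ioi (0 : ℝ) ×ˢ Ioo (0 : ℝ) 1)

/-- `ξ` is a space-time white noise on `(0,∞) × (0,1)`: an isometry of `L²((0,∞) × (0,1))` into
`L²(P)` with values in the centered Gaussian variables. -/
def IsWhiteNoise {Ω : Type*} [MeasurableSpace Ω] (P : Measure Ω)
    (ξ : Lp ℝ 2 volST →ₗᵢ[ℝ] Lp ℝ 2 P) : Prop :=
  ∀ f : Lp ℝ 2 volST, HasLaw (fun ω => ξ f ω) (gaussianReal 0 (‖f‖₊ ^ 2)) P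

open Classical in
/-- The Wiener integral `∫ f dξ` of a square integrable function `f` on space-time. -/
def wienerIntegral {Ω : Type*} [MeasurableSpace Ω] {P : Measure Ω}
    (ξ : Lp ℝ 2 volST →ₗᵢ[ℝ] Lp ℝ 2 P) (f : ℝ × ℝ → ℝ) : Ω → ℝ :=
  if hf : MemLp f 2 volST then fun ω => ξ (hf.toLp f) ω else 0

/-- The random field `v`, with value `v t x ω` at time `t` and point `x`, is the (mild) solution of
`∂_t v = ½ ∂_x² v + ξ` on `[0,1]` with initial condition `z` and homogeneous Dirichlet boundary
conditions:
`v(t,x) = ∫₀¹ g_t(x,x') z(x') dx' + ∫₀ᵗ ∫₀¹ g_{t-s}(x,x') ξ(ds,dx')` almost surely, where at each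
time the field is jointly measurable in `(x,ω)`. -/
structure IsSHESolution {Ω : Type*} [MeasurableSpace Ω] {P : Measure Ω}
    (ξ : Lp ℝ 2 volST →ₗᵢ[ℝ] Lp ℝ 2 P) (z : H) (v : ℝ → ℝ → Ω → ℝ) : Prop where
  aemeasurable : ∀ t : ℝ, 0 ≤ t →
    AEMeasurable (fun p : ℝ × Ω => v t p.1 p.2) (vol01.prod P)
  init : ∀ᵐ ω ∂P, ∀ᵐ x ∂vol01, v 0 x ω = z x
  mild : ∀ t : ℝ, 0 < t → ∀ x ∈ Icc (0 : ℝ) 1, ∀ᵐ ω ∂P,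
    v t x ω = heatFlow z t x +
      wienerIntegral ξ (fun p => if p.1 < t then heatKernel (t - p.1) x p.2 else 0) ω

/-- The semigroup `Q_t F (z) = 𝔼[F(v_t(z))]`, where `v z` is the solution of the stochastic heat
equation started from `z`. -/
def semigroup {Ω : Type*} [MeasurableSpace Ω] (P : Measure Ω) (v : H → ℝ → ℝ → Ω → ℝ)
    (t : ℝ) (F : H → ℝ) (z : H) : ℝ :=
  ∫ ω, F (toH fun x => v z t x ω) ∂P

/-! ### The law of the Brownian bridge -/

/-- `β` is a Brownian bridge from `0` to `0` over `[0,1]`: a centered Gaussian process with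
continuous paths and covariance `s ∧ t - s t`. -/
structure IsBrownianBridge {Ω : Type*} [MeasurableSpace Ω] (P : Measure Ω)
    (β : ℝ → Ω → ℝ) : Prop where
  gaussian : IsGaussianProcess (fun t : Icc (0 : ℝ) 1 => β t) P
  mean : ∀ t ∈ Icc (0 : ℝ) 1, ∫ ω, β t ω ∂P = 0
  cov : ∀ s ∈ Icc (0 : ℝ) 1, ∀ t ∈ Icc (0 : ℝ) 1, covariance (β s) (β t) P = min s t - s * t
  continuous : ∀ᵐ ω ∂P, ContinuousOn (fun t => β t ω) (Icc 0 1)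

/-- The law on `H` of a process indexed by `[0,1]`. -/
def lawOnH {Ω : Type*} [MeasurableSpace Ω] (P : Measure Ω) (β : ℝ → Ω → ℝ) : Measure H :=
  P.map fun ω => toH fun x => β x ω

/-! ### The Dirichlet form `(Λ, D(Λ))` with `D(Λ) = W^{1,2}(μ)` -/

/-- The space `FC_b^∞(H)` of functionals `z ↦ ψ(⟨l_1,z⟩, …, ⟨l_m,z⟩)`, where `ψ` is smooth and
bounded with all its derivatives and the `l_i` are in the span of the `e_k`, `k ≥ 1`. -/
def IsCylindrical (F : H → ℝ) : Prop :=
  ∃ (m : ℕ) (ψ : (Fin m → ℝ) → ℝ) (l : Fin m → H),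
    ContDiff ℝ (⊤ : ℕ∞) ψ ∧
    (∀ n : ℕ, ∃ C : ℝ, ∀ y, ‖iteratedFDeriv ℝ n ψ y‖ ≤ C) ∧
    (∀ i, l i ∈ Submodule.span ℝ (range fun k : ℕ => toH (e (k + 1)))) ∧
    ∀ z, F z = ψ fun i => ⟪l i, z⟫_ℝ

/-- `g` is the gradient in `L²(μ; H)` of `F` in `W^{1,2}(μ)`: the pair `(F, g)` is in the closure
of the graph of the gradient on `FC_b^∞(H)`. -/
structure HasSobolevGradient (μ : Measure H) (F : H → ℝ) (g : H → H) : Prop where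
  memLp : MemLp F 2 μ
  memLp_grad : MemLp g 2 μ
  approx : ∃ φ : ℕ → H → ℝ, (∀ n, IsCylindrical (φ n)) ∧
    Tendsto (fun n => eLpNorm (fun z => φ n z - F z) 2 μ) atTop (𝓝 0) ∧
    Tendsto (fun n => eLpNorm (fun z => gradient (φ n) z - g z) 2 μ) atTop (𝓝 0)

/-- The domain `D(Λ) = W^{1,2}(μ)`. -/
def domainΛ (μ : Measure H) : Set (H → ℝ) := {F | ∃ g, HasSobolevGradient μ F g}

open Classical in
/-- The gradient `∇F` of `F ∈ D(Λ)`. -/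
def sobolevGradient (μ : Measure H) (F : H → ℝ) : H → H :=
  if hF : ∃ g, HasSobolevGradient μ F g then hF.choose else 0

/-- `Λ(F,G) = ½ ∫ ⟨∇F, ∇G⟩ dμ`, for `F, G ∈ D(Λ)`. -/
def formΛ (μ : Measure H) (F G : H → ℝ) : ℝ :=
  (1 / 2) * ∫ z, ⟪sobolevGradient μ F z, sobolevGradient μ G z⟫_ℝ ∂μ

/-- The inner product `Λ₁ = Λ + (·,·)_{L²(μ)}` of the Hilbert space `D(Λ)`. -/
def formΛ₁ (μ : Measure H) (F G : H → ℝ) : ℝ := formΛ μ F G + ∫ z, F z * G z ∂μ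

/-! ### The one-potentials -/

/-- `ρ_ε(y) = ε⁻¹ ρ(y/ε)`. -/
def mollifier (ρ : ℝ → ℝ) (ε y : ℝ) : ℝ := (1 / ε) * ρ (y / ε)

/-- `G_ε(z) = ½ ∫₀¹ h_r ρ_ε''(z_r) dr`. -/
def Geps (h ρ : ℝ → ℝ) (ε : ℝ) (z : H) : ℝ :=
  (1 / 2) * ∫ r in Ioo (0 : ℝ) 1, h r * iteratedDeriv 2 (mollifier ρ ε) (z r)

/-- The one-potential `U_ε(z) = ∫₀^∞ e^{-t} Q_t G_ε(z) dt`. -/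
def Ueps {Ω : Type*} [MeasurableSpace Ω] (P : Measure Ω) (v : H → ℝ → ℝ → Ω → ℝ)
    (h ρ : ℝ → ℝ) (ε : ℝ) (z : H) : ℝ :=
  ∫ t in Ioi (0 : ℝ), Real.exp (-t) * semigroup P v t (Geps h ρ ε) z

/-- The integrand of `G^{(t)}(z)`. -/
def GtIntegrand (h : ℝ → ℝ) (t : ℝ) (z : H) (r : ℝ) : ℝ :=
  h r / (2 * √(2 * Real.pi * qVar t r)) *
    ((heatFlow z t r / qVar t r) ^ 2 - 1 / qVar t r) *
    Real.exp (-(heatFlow z t r ^ 2 / (2 * qVar t r)))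

/-- `G^{(t)}(z) = ∫₀¹ h_r / (2 √(2π q_t(r))) [(z(t,r)/q_t(r))² - 1/q_t(r)]
exp(- z(t,r)² / (2 q_t(r))) dr`. -/
def Gt (h : ℝ → ℝ) (t : ℝ) (z : H) : ℝ := ∫ r in Ioo (0 : ℝ) 1, GtIntegrand h t z r

/-- `U(z) = ∫₀^∞ e^{-t} G^{(t)}(z) dt`. -/
def Ulim (h : ℝ → ℝ) (z : H) : ℝ := ∫ t in Ioi (0 : ℝ), Real.exp (-t) * Gt h t z

end StochHeat

end

noncomputable section

namespace StochHeat

/-! Let p_q be the centered Gaussian density of variance q. For t > 0 the value v(t,r) is Gaussian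
with mean z(t,r) and variance q_t(r). Two integrations by parts therefore turn Q_t G_ε(z) into ½ ∫
h(r) (p_q'' * ρ_ε)(z(t,r)) dr with q = q_t(r), and G^{(t)}(z) is the same expression at ε = 0
(`IsSHESolution.integral_Geps`, `GtIntegrand_eq`). So U_ε and U are potentials `pot h f` of kernels
f that are `IsAdmissible` with one constant for all ε (`isAdmissible_convKer`).

On the support of h, q_t(r) is at least of order √(t ∧ 1) (`varSeries_ge`). Since |f| ≤ C q^(-3/2),
the time integrand is of order t^(-3/4) near 0, which gives absolute convergence and bounds uniform
in z and ε. For the gradient the sup bound |f'| ≤ C q^(-2) only yields t^(-1), which just fails to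
be integrable. Averaging over μ gains the missing power: for t ≤ 1 the law of z(t,r) under μ has a
bounded density, so the second moment of f' is at most of order sup|f'| · ∫|f'|, that is t^(-7/4)
(`IsAdmissible.secondMoment_le`). The heat semigroup contracts H, so the gradient has an integrand
of order t^(-7/8) in L²(μ;H), which is integrable (`enorm_potGrad_sq_le`,
`IsAdmissible.lintegral_potGrad_le`).

The potential restricted to times t > a is of class C¹ with bounded gradient, hence in W^{1,2}(μ)
(`hasSobolevGradient_of_contDiff`). The energy bound makes these gradients Cauchy as a → 0, and the
graph of the gradient is closed (`IsAdmissible.exists_hasSobolevGradient`). Convergence of U_ε is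
dominated convergence in the energy bound for the difference of kernels (`tendsto_formΛ₁_pot_zero`).

Since Λ is computed from a chosen gradient, uniqueness of the gradient is also needed
(`HasSobolevGradient.unique`). It follows from integration by parts in each sine coordinate, which
under μ is Gaussian of variance 1/λ_k and independent of the rest, as the characteristic function of
the bridge shows. -/

lemma tendsto_eLpNorm_of_bounded {α E ι : Type*} [MeasurableSpace α] [NormedAddCommGroup E]
    {μ : Measure α} [IsFiniteMeasure μ] {l : Filter ι} [l.IsCountablyGenerated]
    {F : ι → α → E} {G : α → E} (C : ℝ)
    (hF : ∀ᶠ n in l, AEStronglyMeasurable (F n) μ) (hG : AEStronglyMeasurable G μ)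
    (hb : ∀ᶠ n in l, ∀ᵐ x ∂μ, ‖F n x - G x‖ ≤ C)
    (hlim : ∀ᵐ x ∂μ, Tendsto (fun n => F n x) l (𝓝 (G x))) :
    Tendsto (fun n => eLpNorm (fun x => F n x - G x) 2 μ) l (𝓝 0) := by
  have key : Tendsto (fun n => ∫⁻ x, ‖F n x - G x‖ₑ ^ (2 : ℝ) ∂μ) l (𝓝 (∫⁻ _, 0 ∂μ)) := by
    refine tendsto_lintegral_filter_of_dominated_convergence' (fun _ => ENNReal.ofReal C ^ (2 : ℝ))
      ?_ ?_ ?_ ?_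
    · filter_upwards [hF] with n hn using (hn.sub hG).enorm.pow_const _
    · filter_upwards [hb] with n hn
      filter_upwards [hn] with x hx
      gcongr
      rw [← ofReal_norm]
      exact ENNReal.ofReal_le_ofReal hx
    · rw [lintegral_const]
      exact ENNReal.mul_ne_top (by simp) (measure_ne_top _ _)
    · filter_upwards [hlim] with x hx
      have h1 : Tendsto (fun n => F n x - G x) l (𝓝 0) := by
        simpa using hx.sub_const (G x)
      have h2 := (h1.enorm).ennrpow_const (2 : ℝ)
      simpa using h2
  have h3 := key.ennrpow_const (1 / (2 : ℝ))
  simp only [lintegral_zero] at h3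
  rw [ENNReal.zero_rpow_of_pos (by norm_num)] at h3
  refine h3.congr fun n => ?_
  rw [eLpNorm_eq_lintegral_rpow_enorm_toReal (by norm_num) (by norm_num)]
  simp

/-- A measurable function with values bounded by a constant is square integrable on `(0,1)`. -/
lemma memLp_of_bounded {f : ℝ → ℝ} (hf : AEStronglyMeasurable f vol01) (C : ℝ)
    (hb : ∀ᵐ x ∂vol01, ‖f x‖ ≤ C) : MemLp f 2 vol01 :=
  MemLp.of_bound hf C hb

lemma toH_of_memLp {f : ℝ → ℝ} (hf : MemLp f 2 vol01) : toH f = hf.toLp f := by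
  simp [toH, hf]

lemma coeFn_toH {f : ℝ → ℝ} (hf : MemLp f 2 vol01) : toH f =ᵐ[vol01] f := by
  rw [toH_of_memLp hf]; exact hf.coeFn_toLp

lemma inner_toH_left {f : ℝ → ℝ} (hf : MemLp f 2 vol01) (z : H) :
    ⟪toH f, z⟫_ℝ = ∫ x in Ioo (0 : ℝ) 1, f x * z x := by
  rw [L2.inner_def]
  refine integral_congr_ae ?_
  filter_upwards [coeFn_toH hf] with x hx
  simp [hx, mul_comm]

lemma inner_toH_toH {f g : ℝ → ℝ} (hf : MemLp f 2 vol01) (hg : MemLp g 2 vol01) :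
    ⟪toH f, toH g⟫_ℝ = ∫ x in Ioo (0 : ℝ) 1, f x * g x := by
  rw [inner_toH_left hf]
  refine integral_congr_ae ?_
  filter_upwards [coeFn_toH hg] with x hx
  rw [hx]

/-! ### The sine functions in H. -/

lemma abs_e_le (k : ℕ) (x : ℝ) : |e k x| ≤ √2 := by
  rw [e, abs_mul, abs_of_nonneg (Real.sqrt_nonneg 2)]
  exact mul_le_of_le_one_right (Real.sqrt_nonneg 2) (Real.abs_sin_le_one _)

@[fun_prop]
lemma continuous_e (k : ℕ) : Continuous (e k) := by unfold e; fun_prop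

lemma memLp_e (k : ℕ) : MemLp (e k) 2 vol01 :=
  memLp_of_bounded (continuous_e k).aestronglyMeasurable (√2)
    (ae_of_all _ fun x => by simpa using abs_e_le k x)

/-- The `k`-th sine function as an element of `H`. -/
def eH (k : ℕ) : H := toH (e (k + 1))

lemma eigval_pos (k : ℕ) : 0 < eigval (k + 1) := by unfold eigval; positivity

lemma integral_cos_int_mul_pi (n : ℤ) (hn : n ≠ 0) :
    ∫ x in (0 : ℝ)..1, Real.cos (n * Real.pi * x) = 0 := by
  have hc : (n : ℝ) * Real.pi ≠ 0 := mul_ne_zero (by exact_mod_cast hn) Real.pi_ne_zero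
  rw [intervalIntegral.integral_comp_mul_left (fun x => Real.cos x) hc, integral_cos]
  simp [Real.sin_int_mul_pi]

lemma orthonormal_eH : Orthonormal ℝ eH := by
  rw [orthonormal_iff_ite]
  intro i j
  unfold eH
  rw [inner_toH_toH (memLp_e _) (memLp_e _), ← integral_Ioc_eq_integral_Ioo,
    ← intervalIntegral.integral_of_le zero_le_one]
  -- Product-to-sum formula. Because of the index shift the second frequency i + j + 2 is never
  -- zero, so only the first cosine can contribute.
  have h1 : ∀ x, e (i + 1) x * e (j + 1) x =
      Real.cos ((((i : ℤ) - j : ℤ) : ℝ) * Real.pi * x)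
        - Real.cos ((((i : ℤ) + j + 2 : ℤ) : ℝ) * Real.pi * x) := by
    intro x
    unfold e
    push_cast
    have h2 : √2 * √2 = (2 : ℝ) := Real.mul_self_sqrt (by norm_num)
    rw [show ((i : ℝ) - j) * Real.pi * x = ((i : ℝ) + 1) * Real.pi * x - ((j : ℝ) + 1) * Real.pi * x by ring,
      show ((i : ℝ) + j + 2) * Real.pi * x = ((i : ℝ) + 1) * Real.pi * x + ((j : ℝ) + 1) * Real.pi * x by ring,
      Real.cos_sub, Real.cos_add]
    linear_combination (Real.sin (((i : ℝ) + 1) * Real.pi * x) * Real.sin (((j : ℝ) + 1) * Real.pi * x)) * h2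
  simp_rw [h1]
  rw [intervalIntegral.integral_sub (Continuous.intervalIntegrable (by fun_prop) _ _)
    (Continuous.intervalIntegrable (by fun_prop) _ _),
    integral_cos_int_mul_pi ((i : ℤ) + j + 2) (by positivity)]
  split_ifs with h
  · subst h; simp
  · rw [integral_cos_int_mul_pi _ (by omega)]; simp

lemma inner_eH (k : ℕ) (z : H) : ⟪eH k, z⟫_ℝ = ∫ x in Ioo (0 : ℝ) 1, e (k + 1) x * z x :=
  inner_toH_left (memLp_e _) z

@[simp] lemma norm_eH (k : ℕ) : ‖eH k‖ = 1 := orthonormal_eH.1 k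

lemma inner_eH_eH (i j : ℕ) : ⟪eH i, eH j⟫_ℝ = if i = j then 1 else 0 :=
  (orthonormal_iff_ite.1 orthonormal_eH) i j

/-- Separability of H underlies measurability on products with H and the fact that a characteristic
function determines a finite measure on H. -/
instance instSecondCountableTopologyH : SecondCountableTopology H :=
  haveI : Fact ((2 : ENNReal) ≠ ⊤) := ⟨by simp⟩
  Lp.SecondCountableTopology

lemma coeFn_memLp (z : H) : MemLp z 2 vol01 := Lp.memLp z

lemma coeFn_integrable (z : H) : Integrable z vol01 := (coeFn_memLp z).integrable (by norm_num)

/-! ### The heat kernel as an element of H. -/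

/-- The coefficients of `g_t(r, ·)` in the sine basis. -/
def heatCoeff (t r : ℝ) (k : ℕ) : ℝ := Real.exp (-(eigval (k + 1) / 2) * t) * e (k + 1) r

/-- `g_t(r, ·)` as an element of `H`, for `t > 0`. -/
def heatVec (t r : ℝ) : H := ∑' k, heatCoeff t r k • eH k

/-- Giving up the quadratic growth for a linear one dominates the heat series by a geometric series,
uniformly in t ≥ a > 0. -/
lemma le_half_eigval (k : ℕ) : (k : ℝ) ≤ eigval (k + 1) / 2 := by
  unfold eigval
  have h1 : (9 : ℝ) ≤ Real.pi ^ 2 := by nlinarith [Real.pi_gt_three]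
  have h2 : (0 : ℝ) ≤ k := Nat.cast_nonneg k
  push_cast
  nlinarith [mul_nonneg h2 h2]

lemma abs_heatCoeff_le {a t : ℝ} (ha : 0 ≤ a) (hat : a ≤ t) (r : ℝ) (k : ℕ) :
    |heatCoeff t r k| ≤ √2 * Real.exp (-a) ^ k := by
  rw [heatCoeff, abs_mul, Real.abs_exp, mul_comm]
  refine mul_le_mul (abs_e_le _ _) ?_ (Real.exp_nonneg _) (Real.sqrt_nonneg _)
  rw [← Real.exp_nat_mul]
  apply Real.exp_le_exp.2
  have := le_half_eigval k
  have h2 : (0 : ℝ) ≤ k := Nat.cast_nonneg k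
  nlinarith [mul_le_mul this hat ha (h2.trans this)]

lemma summable_heatBound {a : ℝ} (ha : 0 < a) : Summable fun k : ℕ => √2 * Real.exp (-a) ^ k :=
  (summable_geometric_of_lt_one (Real.exp_nonneg _) (by simpa using ha)).mul_left _

lemma summable_heatVec {t : ℝ} (ht : 0 < t) (r : ℝ) :
    Summable fun k => heatCoeff t r k • eH k := by
  refine Summable.of_norm_bounded (summable_heatBound ht) fun k => ?_
  rw [norm_smul, norm_eH, mul_one]
  exact abs_heatCoeff_le ht.le le_rfl r k

lemma hasSum_heatVec {t : ℝ} (ht : 0 < t) (r : ℝ) :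
    HasSum (fun k => heatCoeff t r k • eH k) (heatVec t r) := (summable_heatVec ht r).hasSum

lemma hasSum_inner_heatVec {t : ℝ} (ht : 0 < t) (r : ℝ) (z : H) :
    HasSum (fun k => heatCoeff t r k * ⟪eH k, z⟫_ℝ) ⟪heatVec t r, z⟫_ℝ := by
  have h := (hasSum_heatVec ht r).mapL (innerSL ℝ z)
  simpa [inner_smul_right, real_inner_comm z] using h

lemma inner_eH_heatVec {t : ℝ} (ht : 0 < t) (r : ℝ) (k : ℕ) :
    ⟪eH k, heatVec t r⟫_ℝ = heatCoeff t r k := by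
  rw [real_inner_comm]
  have h := hasSum_inner_heatVec ht r (eH k)
  have h2 := hasSum_single (f := fun j => heatCoeff t r j * ⟪eH j, eH k⟫_ℝ) k
    (fun j hj => by simp [inner_eH_eH, hj])
  rw [h.unique h2]
  simp

lemma heatKernel_eq (t r x : ℝ) : heatKernel t r x = ∑' k, heatCoeff t r k * e (k + 1) x := rfl

/-- Geometric domination allows sum and integral to be exchanged. From here on z(t,r) is treated as
a continuous linear functional of z, whose gradient is `heatVec t r`. -/
lemma heatFlow_eq_inner {t : ℝ} (ht : 0 < t) (r : ℝ) (z : H) :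
    heatFlow z t r = ⟪heatVec t r, z⟫_ℝ := by
  have hz := coeFn_integrable z
  have hint : ∀ k, Integrable (fun x => heatCoeff t r k * (e (k + 1) x * z x)) vol01 := by
    intro k
    refine Integrable.const_mul ?_ _
    exact hz.bdd_mul (continuous_e _).aestronglyMeasurable
      (ae_of_all _ fun x => by simpa using abs_e_le (k + 1) x)
  have hs := hasSum_integral_of_summable_integral_norm (μ := vol01)
    (F := fun (k : ℕ) x => heatCoeff t r k * (e (k + 1) x * z x)) hint (by
      refine Summable.of_nonneg_of_le (fun k => integral_nonneg fun x => norm_nonneg _) (fun k => ?_)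
        ((summable_heatBound ht).mul_right (√2 * ∫ x, ‖z x‖ ∂vol01))
      rw [← mul_assoc, mul_assoc, ← integral_const_mul, ← integral_const_mul]
      refine integral_mono (hint k).norm ((hz.norm.const_mul _).const_mul _) fun x => ?_
      simp only [norm_mul, Real.norm_eq_abs]
      refine mul_le_mul (abs_heatCoeff_le ht.le le_rfl r k) ?_ (by positivity) (by positivity)
      exact mul_le_mul_of_nonneg_right (abs_e_le _ _) (abs_nonneg _))
  have h2 := hasSum_inner_heatVec ht r z
  simp only [inner_eH, ← integral_const_mul] at h2
  rw [← hs.unique h2, heatFlow]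
  congr 1 with x
  rw [heatKernel_eq, ← tsum_mul_right]
  simp only [mul_assoc]

lemma continuousOn_heatKernel :
    ContinuousOn (fun p : ℝ × ℝ × ℝ => heatKernel p.1 p.2.1 p.2.2) (Ioi 0 ×ˢ univ) := by
  have key : ∀ a : ℝ, 0 < a →
      ContinuousOn (fun p : ℝ × ℝ × ℝ => heatKernel p.1 p.2.1 p.2.2) (Ioi a ×ˢ univ) := by
    intro a ha
    refine continuousOn_tsum (u := fun k => √2 * Real.exp (-a) ^ k * √2) (fun k => ?_)
      ((summable_heatBound ha).mul_right _) ?_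
    · exact Continuous.continuousOn (by fun_prop)
    · rintro k ⟨t, r, x⟩ ⟨ht, -⟩
      rw [norm_mul]
      exact mul_le_mul (abs_heatCoeff_le ha.le (le_of_lt ht) r k) (abs_e_le _ _) (abs_nonneg _)
        (by positivity)
  intro p hp
  have h2 : (Ioi (p.1 / 2) ×ˢ (univ : Set (ℝ × ℝ))) ∈ 𝓝 p :=
    (isOpen_Ioi.prod isOpen_univ).mem_nhds ⟨half_lt_self (a := p.1) hp.1, trivial⟩
  exact ((key (p.1 / 2) (half_pos hp.1)).continuousAt h2).continuousWithinAt

lemma continuousOn_heatVec :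
    ContinuousOn (fun p : ℝ × ℝ => heatVec p.1 p.2) (Ioi 0 ×ˢ univ) := by
  have key : ∀ a : ℝ, 0 < a →
      ContinuousOn (fun p : ℝ × ℝ => heatVec p.1 p.2) (Ioi a ×ˢ univ) := by
    intro a ha
    refine continuousOn_tsum (u := fun k => √2 * Real.exp (-a) ^ k) (fun k => ?_)
      (summable_heatBound ha) ?_
    · unfold heatCoeff
      exact Continuous.continuousOn (by fun_prop)
    · rintro k ⟨t, r⟩ ⟨ht, -⟩
      rw [norm_smul, norm_eH, mul_one]
      exact abs_heatCoeff_le ha.le (le_of_lt ht) r k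
  intro p hp
  have h2 : (Ioi (p.1 / 2) ×ˢ (univ : Set ℝ)) ∈ 𝓝 p :=
    (isOpen_Ioi.prod isOpen_univ).mem_nhds ⟨half_lt_self (a := p.1) hp.1, trivial⟩
  exact ((key (p.1 / 2) (half_pos hp.1)).continuousAt h2).continuousWithinAt

/-- A bound for `g_t(r, ·)` that is uniform in `r` and in `t ≥ a`. -/
def heatBound (a : ℝ) : ℝ := ∑' k : ℕ, √2 * Real.exp (-a) ^ k

lemma norm_heatVec_le {a t : ℝ} (ha : 0 < a) (hat : a ≤ t) (r : ℝ) :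
    ‖heatVec t r‖ ≤ heatBound a := by
  unfold heatVec heatBound
  refine tsum_of_norm_bounded (summable_heatBound ha).hasSum fun k => ?_
  rw [norm_smul, norm_eH, mul_one]
  exact abs_heatCoeff_le ha.le hat r k

lemma abs_heatKernel_le {a t : ℝ} (ha : 0 < a) (hat : a ≤ t) (r x : ℝ) :
    |heatKernel t r x| ≤ heatBound a * √2 := by
  rw [← Real.norm_eq_abs, heatKernel_eq, heatBound]
  refine tsum_of_norm_bounded (((summable_heatBound ha).hasSum).mul_right (√2)) fun k => ?_
  rw [norm_mul]
  exact mul_le_mul (abs_heatCoeff_le ha.le hat r k) (abs_e_le _ _) (abs_nonneg _) (by positivity)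

lemma continuous_heatKernel {t : ℝ} (ht : 0 < t) (r : ℝ) : Continuous (heatKernel t r) := by
  have h := continuousOn_heatKernel
  have h2 : Continuous fun x : ℝ => ((t, r, x) : ℝ × ℝ × ℝ) := by fun_prop
  exact h.comp_continuous h2 fun x => ⟨ht, trivial⟩

lemma memLp_heatKernel {t : ℝ} (ht : 0 < t) (r : ℝ) : MemLp (heatKernel t r) 2 vol01 :=
  memLp_of_bounded (continuous_heatKernel ht r).aestronglyMeasurable (heatBound t * √2)
    (ae_of_all _ fun x => abs_heatKernel_le ht le_rfl r x)

lemma toH_heatKernel {t : ℝ} (ht : 0 < t) (r : ℝ) : toH (heatKernel t r) = heatVec t r := by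
  refine ext_inner_right ℝ fun z => ?_
  rw [inner_toH_left (memLp_heatKernel ht r), ← heatFlow_eq_inner ht r z, heatFlow]

lemma hasSum_heatCoeff_sq {t : ℝ} (ht : 0 < t) (r : ℝ) :
    HasSum (fun k => heatCoeff t r k ^ 2) (‖heatVec t r‖ ^ 2) := by
  rw [← real_inner_self_eq_norm_sq]
  have h := hasSum_inner_heatVec ht r (heatVec t r)
  simpa only [inner_eH_heatVec ht, ← sq] using h

lemma heatCoeff_sq (t r : ℝ) (k : ℕ) :
    heatCoeff t r k ^ 2 = Real.exp (-(eigval (k + 1)) * t) * e (k + 1) r ^ 2 := by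
  rw [heatCoeff, mul_pow, ← Real.exp_nat_mul]
  congr 2
  push_cast; ring

/-- This is the semigroup property on the diagonal; it accounts for the time 2τ in the definition of
q_t. -/
lemma norm_heatVec_sq {t : ℝ} (ht : 0 < t) (r : ℝ) :
    ‖heatVec t r‖ ^ 2 = heatKernel (2 * t) r r := by
  rw [← (hasSum_heatCoeff_sq ht r).tsum_eq, heatKernel_eq]
  congr 1 with k
  rw [heatCoeff_sq, heatCoeff]
  ring_nf

/-! The variance `q_t(r)` as a series. -/

/-- The terms of the series of `q_t(r)`. -/
def varTerm (t r : ℝ) (k : ℕ) : ℝ :=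
  (1 - Real.exp (-(eigval (k + 1)) * |t|)) / eigval (k + 1) * e (k + 1) r ^ 2

/-- The variance `q_t(r)` as a series. -/
def varSeries (t r : ℝ) : ℝ := ∑' k, varTerm t r k

lemma varTerm_nonneg (t r : ℝ) (k : ℕ) : 0 ≤ varTerm t r k := by
  have h := eigval_pos k
  refine mul_nonneg (div_nonneg ?_ h.le) (sq_nonneg _)
  rw [sub_nonneg, Real.exp_le_one_iff]
  nlinarith [abs_nonneg t]

lemma e_sq_le (k : ℕ) (x : ℝ) : e k x ^ 2 ≤ 2 := by
  have h := pow_le_pow_left₀ (abs_nonneg _) (abs_e_le k x) 2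
  rwa [sq_abs, Real.sq_sqrt (by norm_num)] at h

lemma varTerm_le (t r : ℝ) (k : ℕ) : varTerm t r k ≤ 1 / eigval (k + 1) * 2 := by
  have h := eigval_pos k
  refine mul_le_mul (div_le_div_of_nonneg_right ?_ h.le) (e_sq_le _ _) (sq_nonneg _) (by positivity)
  linarith [Real.exp_pos (-(eigval (k + 1)) * |t|)]

lemma summable_inv_eigval : Summable fun k : ℕ => 1 / eigval (k + 1) * 2 := by
  refine Summable.mul_right _ ?_
  have h := (summable_nat_add_iff 1).2 (Real.summable_one_div_nat_pow.2 (one_lt_two))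
  refine (h.mul_right (1 / Real.pi ^ 2)).congr fun k => ?_
  unfold eigval
  rw [div_mul_div_comm, one_mul]

lemma summable_varTerm (t r : ℝ) : Summable (varTerm t r) :=
  Summable.of_nonneg_of_le (varTerm_nonneg t r) (varTerm_le t r) summable_inv_eigval

-- The absolute value in `varTerm` keeps every term between 0 and 2/λ for negative times too, so the
-- Weierstrass test gives continuity on the whole plane.
@[fun_prop]
lemma continuous_varSeries : Continuous fun p : ℝ × ℝ => varSeries p.1 p.2 := by
  refine continuous_tsum (fun k => ?_) summable_inv_eigval fun k p => ?_
  · unfold varTerm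
    fun_prop
  · rw [Real.norm_of_nonneg (varTerm_nonneg _ _ _)]
    exact varTerm_le _ _ _

lemma varSeries_nonneg (t r : ℝ) : 0 ≤ varSeries t r := tsum_nonneg (varTerm_nonneg t r)

lemma varSeries_le (t r : ℝ) : varSeries t r ≤ ∑' k : ℕ, 1 / eigval (k + 1) * 2 :=
  (summable_varTerm t r).tsum_le_tsum (varTerm_le t r) summable_inv_eigval

lemma varSeries_mono {s t : ℝ} (hs : 0 ≤ s) (hst : s ≤ t) (r : ℝ) :
    varSeries s r ≤ varSeries t r := by
  refine (summable_varTerm s r).tsum_le_tsum (fun k => ?_) (summable_varTerm t r)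
  have h := eigval_pos k
  unfold varTerm
  rw [abs_of_nonneg hs, abs_of_nonneg (hs.trans hst)]
  gcongr ?_ / _ * _
  rw [sub_le_sub_iff_left]
  apply Real.exp_le_exp.2
  nlinarith

lemma integral_exp_neg_mul {c t : ℝ} (hc : 0 < c) (ht : 0 ≤ t) :
    ∫ τ in Ioo 0 t, Real.exp (-c * τ) = (1 - Real.exp (-c * t)) / c := by
  rw [← integral_Ioc_eq_integral_Ioo, ← intervalIntegral.integral_of_le ht,
    intervalIntegral.integral_comp_mul_left (fun x => Real.exp x) (by linarith), integral_exp]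
  simp only [mul_zero, Real.exp_zero, smul_eq_mul]
  field_simp
  ring

lemma integral_varTerm {t : ℝ} (ht : 0 < t) (r : ℝ) (k : ℕ) :
    ∫ τ in Ioo 0 t, heatCoeff (2 * τ) r k * e (k + 1) r = varTerm t r k := by
  have h : ∀ τ, heatCoeff (2 * τ) r k * e (k + 1) r
      = Real.exp (-(eigval (k + 1)) * τ) * e (k + 1) r ^ 2 := by
    intro τ
    rw [heatCoeff]; ring_nf
  simp_rw [h]
  rw [integral_mul_const, integral_exp_neg_mul (eigval_pos k) ht.le, varTerm, abs_of_pos ht]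

lemma heatCoeff_mul_nonneg (t r : ℝ) (k : ℕ) : 0 ≤ heatCoeff t r k * e (k + 1) r := by
  rw [heatCoeff, mul_assoc, ← sq]; positivity

/-- All terms of the diagonal series are nonnegative, so it may be integrated term by term.
Integrability is recorded as well, because the variance of the stochastic convolution is computed as
a lower Lebesgue integral. -/
lemma integrableOn_heatKernel_diag_and_qVar {t : ℝ} (ht : 0 < t) (r : ℝ) :
    IntegrableOn (fun τ => heatKernel (2 * τ) r r) (Ioo 0 t) ∧ qVar t r = varSeries t r := by
  have hint : ∀ k, IntegrableOn (fun τ => heatCoeff (2 * τ) r k * e (k + 1) r) (Ioo 0 t) := by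
    intro k
    refine (Continuous.integrableOn_Icc (a := 0) (b := t) ?_).mono_set Ioo_subset_Icc_self
    unfold heatCoeff
    fun_prop
  have hn : ∀ k, ∫ τ in Ioo 0 t, ‖heatCoeff (2 * τ) r k * e (k + 1) r‖ = varTerm t r k := by
    intro k
    rw [← integral_varTerm ht]
    congr 1 with τ
    exact Real.norm_of_nonneg (heatCoeff_mul_nonneg _ _ _)
  have hs : Summable fun k => ∫ τ in Ioo 0 t, ‖heatCoeff (2 * τ) r k * e (k + 1) r‖ := by
    simp_rw [hn]; exact summable_varTerm t r
  have h := hasSum_integral_of_summable_integral_norm hint hs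
  have hq : qVar t r = varSeries t r := by
    simp_rw [integral_varTerm ht] at h
    exact h.tsum_eq.symm
  refine ⟨?_, hq⟩
  have hmeas : AEStronglyMeasurable (fun τ => heatKernel (2 * τ) r r) (volume.restrict (Ioo 0 t)) := by
    refine ContinuousOn.aestronglyMeasurable ?_ measurableSet_Ioo
    have h2 : Continuous fun τ : ℝ => ((2 * τ, r, r) : ℝ × ℝ × ℝ) := by fun_prop
    exact continuousOn_heatKernel.comp h2.continuousOn fun τ hτ => ⟨by simpa using hτ.1, trivial⟩
  refine ⟨hmeas, ?_⟩
  rw [hasFiniteIntegral_iff_enorm]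
  have : ∀ τ ∈ Ioo 0 t, ‖heatKernel (2 * τ) r r‖ₑ
      = ∑' k, ENNReal.ofReal (heatCoeff (2 * τ) r k * e (k + 1) r) := by
    intro τ hτ
    have hsum : Summable fun k => heatCoeff (2 * τ) r k * e (k + 1) r := by
      refine Summable.of_norm_bounded ((summable_heatBound (a := 2 * τ) (by linarith [hτ.1])).mul_right (√2)) fun k => ?_
      rw [norm_mul]
      exact mul_le_mul (abs_heatCoeff_le (by linarith [hτ.1]) le_rfl r k) (abs_e_le _ _) (abs_nonneg _) (by positivity)
    rw [← ENNReal.ofReal_tsum_of_nonneg (fun k => heatCoeff_mul_nonneg _ _ _) hsum,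
      ← ofReal_norm, heatKernel_eq, Real.norm_of_nonneg (tsum_nonneg fun k => heatCoeff_mul_nonneg _ _ _)]
  rw [setLIntegral_congr_fun measurableSet_Ioo this, lintegral_tsum]
  · have h3 : ∀ k, ∫⁻ τ in Ioo 0 t, ENNReal.ofReal (heatCoeff (2 * τ) r k * e (k + 1) r)
        = ENNReal.ofReal (varTerm t r k) := by
      intro k
      rw [← ofReal_integral_eq_lintegral_ofReal (hint k)
        (ae_of_all _ fun τ => heatCoeff_mul_nonneg _ _ _), integral_varTerm ht]
    simp_rw [h3]
    rw [← ENNReal.ofReal_tsum_of_nonneg (varTerm_nonneg t r) (summable_varTerm t r)]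
    exact ENNReal.ofReal_lt_top
  · intro k
    exact ((hint k).aestronglyMeasurable.aemeasurable).ennreal_ofReal

lemma qVar_eq {t : ℝ} (ht : 0 < t) (r : ℝ) : qVar t r = varSeries t r :=
  (integrableOn_heatKernel_diag_and_qVar ht r).2

/-! ### A lower bound of order √t for the variance. -/

/-- Two consecutive modes cannot both be small at r: their phases differ by πr, and sin²(a - b) ≤ 2
(sin² a + sin² b). -/
lemma sin_sq_add_sin_sq_ge (k : ℕ) (r : ℝ) :
    Real.sin (Real.pi * r) ^ 2 / 2 ≤
      Real.sin (k * Real.pi * r) ^ 2 + Real.sin ((k + 1 : ℕ) * Real.pi * r) ^ 2 := by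
  have h1 : Real.pi * r = (k + 1 : ℕ) * Real.pi * r - k * Real.pi * r := by push_cast; ring
  rw [h1]
  generalize ((k + 1 : ℕ) : ℝ) * Real.pi * r = a
  generalize (k : ℝ) * Real.pi * r = b
  rw [Real.sin_sub]
  have ha := Real.sin_sq_add_cos_sq a
  have hb := Real.sin_sq_add_cos_sq b
  have h2 : Real.sin a ^ 2 * Real.cos b ^ 2 ≤ Real.sin a ^ 2 := by
    nlinarith [sq_nonneg (Real.sin a), sq_nonneg (Real.sin b), mul_nonneg (sq_nonneg (Real.sin a)) (sq_nonneg (Real.sin b))]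
  have h3 : Real.cos a ^ 2 * Real.sin b ^ 2 ≤ Real.sin b ^ 2 := by
    nlinarith [mul_nonneg (sq_nonneg (Real.sin a)) (sq_nonneg (Real.sin b))]
  nlinarith [sq_nonneg (Real.sin a * Real.cos b + Real.cos a * Real.sin b)]

lemma sum_sin_sq_ge (N : ℕ) (r : ℝ) :
    N * (Real.sin (Real.pi * r) ^ 2 / 4) ≤
      ∑ k ∈ Finset.range N, Real.sin ((k + 1 : ℕ) * Real.pi * r) ^ 2 := by
  -- The shifted sum drops the zeroth term, which vanishes, and gains a nonnegative one.
  have h1 : ∑ k ∈ Finset.range N, Real.sin (k * Real.pi * r) ^ 2 ≤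
      ∑ k ∈ Finset.range N, Real.sin ((k + 1 : ℕ) * Real.pi * r) ^ 2 := by
    have h := Finset.sum_range_succ (fun k : ℕ => Real.sin (k * Real.pi * r) ^ 2) N
    have h' := Finset.sum_range_succ' (fun k : ℕ => Real.sin (k * Real.pi * r) ^ 2) N
    rw [h'] at h
    simp only [CharP.cast_eq_zero, zero_mul, Real.sin_zero] at h
    nlinarith [sq_nonneg (Real.sin (N * Real.pi * r))]
  have h2 : ∑ k ∈ Finset.range N, (Real.sin (Real.pi * r) ^ 2 / 2) ≤
      ∑ k ∈ Finset.range N, (Real.sin (k * Real.pi * r) ^ 2 + Real.sin ((k + 1 : ℕ) * Real.pi * r) ^ 2) :=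
    Finset.sum_le_sum fun k _ => sin_sq_add_sin_sq_ge k r
  rw [Finset.sum_add_distrib, Finset.sum_const, Finset.card_range, nsmul_eq_mul] at h2
  linarith

lemma half_le_one_sub_exp_neg {x : ℝ} (h0 : 0 ≤ x) (h1 : x ≤ 1) : x / 2 ≤ 1 - Real.exp (-x) := by
  have h2 : Real.exp (-x) ≤ 1 / (1 + x) := by
    rw [Real.exp_neg, ← one_div]
    exact one_div_le_one_div_of_le (by linarith) (by linarith [Real.add_one_le_exp x])
  have h3 : 1 / (1 + x) ≤ 1 - x / 2 := by
    rw [div_le_iff₀ (by linarith)]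
    nlinarith
  linarith

/-- About 1/(π√t) modes satisfy λ_k t ≤ 1. Each of them contributes at least t sin²(kπr), and these
squares are bounded below on average, so the total is of order √t. -/
lemma varSeries_ge_of_le {t : ℝ} (ht : 0 < t) (ht1 : t ≤ 1 / Real.pi ^ 2) (r : ℝ) :
    Real.sin (Real.pi * r) ^ 2 / (8 * Real.pi) * √t ≤ varSeries t r := by
  have hpi := Real.pi_pos
  have hst : 0 < √t := Real.sqrt_pos.2 ht
  have hsq : √t ^ 2 = t := Real.sq_sqrt ht.le
  set x := 1 / (Real.pi * √t) with hx
  have hx1 : 1 ≤ x := by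
    rw [hx, le_div_iff₀ (by positivity), one_mul]
    have h2 : (Real.pi * √t) ^ 2 ≤ 1 := by
      rw [mul_pow, hsq]
      rw [le_div_iff₀ (by positivity)] at ht1
      linarith
    exact (sq_le_one_iff₀ (by positivity)).1 h2
  set N := ⌊x⌋₊ with hN
  have hN1 : (N : ℝ) ≤ x := Nat.floor_le (by linarith)
  -- The restriction on t gives x ≥ 1, so that taking the integer part loses at most a factor 2.
  have hN2 : x / 2 ≤ N := by
    have h3 : (1 : ℝ) ≤ N := by exact_mod_cast Nat.le_floor (by simpa using hx1)
    have h4 := Nat.lt_floor_add_one x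
    rw [← hN] at h4
    linarith
  have hterm : ∀ k ∈ Finset.range N, t * Real.sin ((k + 1 : ℕ) * Real.pi * r) ^ 2 ≤ varTerm t r k := by
    intro k hk
    have hkN : ((k + 1 : ℕ) : ℝ) ≤ x := by
      refine le_trans ?_ hN1
      exact_mod_cast Finset.mem_range.1 hk
    have hl := eigval_pos k
    have hle : eigval (k + 1) * t ≤ 1 := by
      have h5 : ((k + 1 : ℕ) : ℝ) * Real.pi * √t ≤ 1 := by
        rw [hx, le_div_iff₀ (by positivity)] at hkN
        linarith
      have h6 : (((k + 1 : ℕ) : ℝ) * Real.pi * √t) ^ 2 ≤ 1 := pow_le_one₀ (by positivity) h5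
      rw [mul_pow, mul_pow, hsq] at h6
      exact h6
    have h7 := half_le_one_sub_exp_neg (by positivity) hle
    have h8 : e (k + 1) r ^ 2 = 2 * Real.sin ((k + 1 : ℕ) * Real.pi * r) ^ 2 := by
      rw [e, mul_pow, Real.sq_sqrt (by norm_num)]
    rw [varTerm, abs_of_pos ht, h8, ← neg_mul_eq_neg_mul] at *
    have h9 : t / 2 ≤ (1 - Real.exp (-(eigval (k + 1) * t))) / eigval (k + 1) := by
      rw [le_div_iff₀ hl]; linarith
    nlinarith [sq_nonneg (Real.sin ((k + 1 : ℕ) * Real.pi * r))]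
  have h10 : ∑ k ∈ Finset.range N, varTerm t r k ≤ varSeries t r :=
    (summable_varTerm t r).sum_le_tsum _ fun k _ => varTerm_nonneg t r k
  have h11 := Finset.sum_le_sum hterm
  rw [← Finset.mul_sum] at h11
  have h12 := mul_le_mul_of_nonneg_left (sum_sin_sq_ge N r) ht.le
  have h13 : t * (x / 2 * (Real.sin (Real.pi * r) ^ 2 / 4)) ≤
      t * (N * (Real.sin (Real.pi * r) ^ 2 / 4)) := by gcongr
  have h14 : t * (x / 2 * (Real.sin (Real.pi * r) ^ 2 / 4)) =
      Real.sin (Real.pi * r) ^ 2 / (8 * Real.pi) * √t := by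
    rw [hx]
    nth_rewrite 1 [← hsq]
    field_simp
    ring
  linarith

/-- Monotonicity in time extends the bound at t = 1/π² to all later times; the extra factor π in the
constant pays for this. -/
lemma varSeries_ge {t : ℝ} (ht : 0 < t) (r : ℝ) :
    Real.sin (Real.pi * r) ^ 2 / (8 * Real.pi ^ 2) * √(min t 1) ≤ varSeries t r := by
  have hpi := Real.pi_gt_three
  have hs : √(min t 1) ≤ 1 := by
    rw [Real.sqrt_le_one]; exact min_le_right _ _
  by_cases h : t ≤ 1 / Real.pi ^ 2
  · refine le_trans ?_ (varSeries_ge_of_le ht h r)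
    gcongr
    · nlinarith
    · exact min_le_left _ _
  · have h1 := varSeries_ge_of_le (t := 1 / Real.pi ^ 2) (by positivity) le_rfl r
    refine le_trans ?_ (h1.trans (varSeries_mono (by positivity) (not_le.1 h).le r))
    rw [Real.sqrt_div zero_le_one, Real.sqrt_one, Real.sqrt_sq (by positivity)]
    calc _ ≤ Real.sin (Real.pi * r) ^ 2 / (8 * Real.pi ^ 2) * 1 := by gcongr
      _ = _ := by field_simp

lemma varSeries_pos {t : ℝ} (ht : 0 < t) {r : ℝ} (hr : r ∈ Ioo (0 : ℝ) 1) : 0 < varSeries t r := by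
  refine lt_of_lt_of_le ?_ (varSeries_ge ht r)
  have : 0 < Real.sin (Real.pi * r) := Real.sin_pos_of_pos_of_lt_pi
    (mul_pos Real.pi_pos hr.1) (by nlinarith [Real.pi_pos, hr.2])
  have h2 : 0 < min t 1 := lt_min ht one_pos
  positivity

/-- The heat semigroup is a contraction of `H`. -/
lemma lintegral_inner_heatVec_sq_le {t : ℝ} (ht : 0 < t) (z : H) :
    ∫⁻ r in Ioo (0 : ℝ) 1, ENNReal.ofReal (⟪heatVec t r, z⟫_ℝ ^ 2) ≤ ENNReal.ofReal (‖z‖ ^ 2) := by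
  set c : ℕ → ℝ := fun k => Real.exp (-(eigval (k + 1) / 2) * t) * ⟪eH k, z⟫_ℝ with hc
  have hlim : ∀ r, Tendsto (fun n => ENNReal.ofReal ((∑ k ∈ Finset.range n, c k * e (k + 1) r) ^ 2))
      atTop (𝓝 (ENNReal.ofReal (⟪heatVec t r, z⟫_ℝ ^ 2))) := by
    intro r
    refine (ENNReal.continuous_ofReal.tendsto _).comp (Tendsto.pow ?_ 2)
    refine ((hasSum_inner_heatVec ht r z).tendsto_sum_nat).congr fun n => ?_
    refine Finset.sum_congr rfl fun k _ => ?_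
    simp only [hc, heatCoeff]; ring
  have hpart : ∀ n, ∫⁻ r in Ioo (0 : ℝ) 1,
      ENNReal.ofReal ((∑ k ∈ Finset.range n, c k * e (k + 1) r) ^ 2) ≤ ENNReal.ofReal (‖z‖ ^ 2) := by
    intro n
    set f : ℝ → ℝ := fun r => ∑ k ∈ Finset.range n, c k * e (k + 1) r with hf
    have hfc : Continuous f := by fun_prop
    have hsum : (∑ k ∈ Finset.range n, c k • eH k : H) =ᵐ[vol01] f := by
      have h1 : ∀ k : ℕ, (eH k : H) =ᵐ[vol01] e (k + 1) := fun k => coeFn_toH (memLp_e _)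
      have h2 : ∀ m : ℕ, ((∑ k ∈ Finset.range m, c k • eH k : H) : ℝ → ℝ) =ᵐ[vol01]
          fun r => ∑ k ∈ Finset.range m, c k * e (k + 1) r := by
        intro m
        induction m with
        | zero =>
          simp only [Finset.range_zero, Finset.sum_empty]
          exact Lp.coeFn_zero ℝ 2 vol01
        | succ m ih =>
          rw [Finset.sum_range_succ]
          filter_upwards [Lp.coeFn_add (∑ k ∈ Finset.range m, c k • eH k) (c m • eH m), ih,
            Lp.coeFn_smul (c m) (eH m), h1 m] with r hr1 hr2 hr3 hr4
          rw [hr1, Pi.add_apply, hr2, hr3, Pi.smul_apply, hr4, Finset.sum_range_succ, smul_eq_mul]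
      exact h2 n
    have hint : IntegrableOn (fun r => f r ^ 2) (Ioo (0 : ℝ) 1) :=
      ((hfc.pow 2).integrableOn_Icc (a := 0) (b := 1)).mono_set Ioo_subset_Icc_self
    rw [← ofReal_integral_eq_lintegral_ofReal hint (ae_of_all _ fun r => sq_nonneg _)]
    apply ENNReal.ofReal_le_ofReal
    have h3 : ∫ r in Ioo (0 : ℝ) 1, f r ^ 2 = ‖(∑ k ∈ Finset.range n, c k • eH k : H)‖ ^ 2 := by
      rw [← real_inner_self_eq_norm_sq, L2.inner_def]
      refine integral_congr_ae ?_
      filter_upwards [hsum] with r hr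
      rw [hr]; simp [sq]
    rw [h3, ← real_inner_self_eq_norm_sq, orthonormal_eH.inner_sum]
    refine le_trans (Finset.sum_le_sum fun k _ => ?_)
      (orthonormal_eH.sum_inner_products_le z (s := Finset.range n))
    simp only [hc, conj_trivial, Real.norm_eq_abs, sq_abs]
    have h4 : Real.exp (-(eigval (k + 1) / 2) * t) ≤ 1 := by
      rw [Real.exp_le_one_iff]; nlinarith [eigval_pos k]
    have h5 : Real.exp (-(eigval (k + 1) / 2) * t) ^ 2 ≤ 1 := pow_le_one₀ (Real.exp_nonneg _) h4
    nlinarith [mul_le_mul_of_nonneg_right h5 (sq_nonneg ⟪eH k, z⟫_ℝ)]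
  have h6 : ∀ r, ENNReal.ofReal (⟪heatVec t r, z⟫_ℝ ^ 2) = liminf (fun n =>
      ENNReal.ofReal ((∑ k ∈ Finset.range n, c k * e (k + 1) r) ^ 2)) atTop :=
    fun r => (hlim r).liminf_eq.symm
  simp_rw [h6]
  -- Fatou along the partial sums, each of which is controlled by Bessel's inequality; completeness
  -- of the sine system plays no role.
  refine le_trans (lintegral_liminf_le fun n => ?_) ?_
  · exact Measurable.ennreal_ofReal (Continuous.measurable (by fun_prop))
  · exact le_trans (liminf_le_liminf (Eventually.of_forall hpart)) (by simp)

/-! ### The stochastic convolution. -/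

section

lemma eLpNorm_two_sq {α E : Type*} [MeasurableSpace α] [NormedAddCommGroup E] {μ : Measure α}
    (f : α → E) : eLpNorm f 2 μ ^ 2 = ∫⁻ x, ‖f x‖ₑ ^ 2 ∂μ := by
  have h := eLpNorm_nnreal_pow_eq_lintegral (p := 2) (f := f) (μ := μ) (by norm_num)
  norm_num at h
  exact_mod_cast h

lemma memLp_two_of_lintegral {α E : Type*} [MeasurableSpace α] [NormedAddCommGroup E]
    {μ : Measure α} {f : α → E} (hf : AEStronglyMeasurable f μ)
    (h : ∫⁻ x, ‖f x‖ₑ ^ 2 ∂μ < ⊤) : MemLp f 2 μ := by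
  refine ⟨hf, ?_⟩
  rw [← eLpNorm_two_sq] at h
  exact (ENNReal.pow_lt_top_iff.1 h).resolve_right (by norm_num)

/-- The kernel of the stochastic convolution at the space-time point `(t,r)`. -/
def convKernel (t r : ℝ) (p : ℝ × ℝ) : ℝ := if p.1 < t then heatKernel (t - p.1) r p.2 else 0

lemma volST_eq_prod : volST = (volume.restrict (Ioi (0 : ℝ))).prod vol01 := by
  rw [Measure.prod_restrict]; rfl

lemma measurable_convKernel (t r : ℝ) : Measurable (convKernel t r) := by
  have hs : MeasurableSet {p : ℝ × ℝ | p.1 < t} := measurableSet_lt measurable_fst measurable_const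
  have hc : ContinuousOn (fun p : ℝ × ℝ => heatKernel (t - p.1) r p.2) {p : ℝ × ℝ | p.1 < t} := by
    have h2 : Continuous fun p : ℝ × ℝ => ((t - p.1, r, p.2) : ℝ × ℝ × ℝ) := by fun_prop
    exact continuousOn_heatKernel.comp h2.continuousOn fun p hp => ⟨by simpa using hp, trivial⟩
  have h3 : convKernel t r =
      {p : ℝ × ℝ | p.1 < t}.piecewise (fun p => heatKernel (t - p.1) r p.2) fun _ => 0 := by
    ext p; simp [convKernel, Set.piecewise]
  rw [h3]
  exact hc.measurable_piecewise continuousOn_const hs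

lemma lintegral_heatKernel_sq {t : ℝ} (ht : 0 < t) (r : ℝ) :
    ∫⁻ x in Ioo (0 : ℝ) 1, ‖heatKernel t r x‖ₑ ^ 2 = ENNReal.ofReal (heatKernel (2 * t) r r) := by
  rw [← eLpNorm_two_sq, ← norm_heatVec_sq ht, ← toH_heatKernel ht, toH_of_memLp (memLp_heatKernel ht r),
    Lp.norm_toLp, ← ENNReal.toReal_pow, ENNReal.ofReal_toReal]
  exact ENNReal.pow_ne_top (memLp_heatKernel ht r).2.ne

/-- The space integral at time s is g_{2(t-s)}(r,r), and the substitution τ = t - s produces q_t(r).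
By the isometry of the white noise this is the variance of v(t,r). -/
lemma lintegral_convKernel_sq {t : ℝ} (ht : 0 < t) (r : ℝ) :
    ∫⁻ p, ‖convKernel t r p‖ₑ ^ 2 ∂volST = ENNReal.ofReal (varSeries t r) := by
  rw [volST_eq_prod, lintegral_prod _ (((measurable_convKernel t r).enorm.pow_const _).aemeasurable)]
  have h1 : ∀ s : ℝ, ∫⁻ x, ‖convKernel t r (s, x)‖ₑ ^ 2 ∂vol01 =
      (Iio t).indicator (fun s => ENNReal.ofReal (heatKernel (2 * (t - s)) r r)) s := by
    intro s
    by_cases hs : s < t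
    · simp only [convKernel, hs, if_true, indicator, mem_Iio]
      exact lintegral_heatKernel_sq (by linarith) r
    · simp [convKernel, hs, indicator]
  simp_rw [h1]
  rw [lintegral_indicator measurableSet_Iio, Measure.restrict_restrict measurableSet_Iio,
    Iio_inter_Ioi]
  have h2 := (Measure.measurePreserving_sub_left volume t).setLIntegral_comp_preimage_emb
    (Homeomorph.subLeft t).measurableEmbedding
    (fun τ => ENNReal.ofReal (heatKernel (2 * τ) r r)) (Ioo 0 t)
  rw [preimage_const_sub_Ioo, sub_self, sub_zero] at h2
  obtain ⟨h3, h4⟩ := integrableOn_heatKernel_diag_and_qVar ht r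
  rw [h2, ← ofReal_integral_eq_lintegral_ofReal h3]
  · rw [← h4, qVar]
  · filter_upwards [ae_restrict_mem measurableSet_Ioo] with τ hτ
    rw [Pi.zero_apply, ← norm_heatVec_sq hτ.1]
    exact sq_nonneg _

lemma memLp_convKernel {t : ℝ} (ht : 0 < t) (r : ℝ) : MemLp (convKernel t r) 2 volST :=
  memLp_two_of_lintegral (measurable_convKernel t r).aestronglyMeasurable
    (by rw [lintegral_convKernel_sq ht]; exact ENNReal.ofReal_lt_top)

variable {Ω : Type*} [MeasurableSpace Ω] {P : Measure Ω}

/-- The stochastic convolution at `(t,r)` is centered Gaussian with variance `q_t(r)`. -/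
lemma hasLaw_wienerIntegral {ξ : Lp ℝ 2 volST →ₗᵢ[ℝ] Lp ℝ 2 P} (hξ : IsWhiteNoise P ξ)
    {t : ℝ} (ht : 0 < t) (r : ℝ) :
    HasLaw (wienerIntegral ξ (convKernel t r)) (gaussianReal 0 (varSeries t r).toNNReal) P := by
  have h := hξ ((memLp_convKernel ht r).toLp _)
  have hn : ‖(memLp_convKernel ht r).toLp (convKernel t r)‖₊ ^ 2 = (varSeries t r).toNNReal := by
    apply NNReal.eq
    rw [NNReal.coe_pow, coe_nnnorm, Lp.norm_toLp, ← ENNReal.toReal_pow, eLpNorm_two_sq,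
      lintegral_convKernel_sq ht, ENNReal.toReal_ofReal (varSeries_nonneg t r),
      Real.coe_toNNReal _ (varSeries_nonneg t r)]
  rw [hn] at h
  rw [wienerIntegral, dif_pos (memLp_convKernel ht r)]
  exact h

end

/-! ### Gaussian kernels and admissible kernels. -/

section

/-- The standard Gaussian density. -/
def gaussDens (x : ℝ) : ℝ := (√(2 * Real.pi))⁻¹ * Real.exp (-(x ^ 2 / 2))

/-- The second derivative of the standard Gaussian density. -/
def gaussDens₂ (x : ℝ) : ℝ := (x ^ 2 - 1) * gaussDens x

/-- The third derivative of the standard Gaussian density. -/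
def gaussDens₃ (x : ℝ) : ℝ := (3 * x - x ^ 3) * gaussDens x

/-- The second derivative of the centered Gaussian density of variance `q`. -/
def gaussKer₂ (q x : ℝ) : ℝ := 1 / (q * √q) * gaussDens₂ (x / √q)

/-- The third derivative of the centered Gaussian density of variance `q`. -/
def gaussKer₃ (q x : ℝ) : ℝ := 1 / q ^ 2 * gaussDens₃ (x / √q)

@[fun_prop]
lemma continuous_gaussDens : Continuous gaussDens := by unfold gaussDens; fun_prop

@[fun_prop]
lemma continuous_gaussDens₂ : Continuous gaussDens₂ := by unfold gaussDens₂; fun_prop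

@[fun_prop]
lemma continuous_gaussDens₃ : Continuous gaussDens₃ := by unfold gaussDens₃; fun_prop

lemma hasDerivAt_gaussDens (x : ℝ) : HasDerivAt gaussDens (-x * gaussDens x) x := by
  have h := (((hasDerivAt_pow 2 x).div_const 2).neg.exp).const_mul (√(2 * Real.pi))⁻¹
  refine h.congr_deriv ?_
  simp [gaussDens]; ring

lemma hasDerivAt_gaussDens₂ (x : ℝ) : HasDerivAt gaussDens₂ (gaussDens₃ x) x := by
  have h := ((hasDerivAt_pow 2 x).sub_const 1).mul (hasDerivAt_gaussDens x)
  refine h.congr_deriv ?_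
  simp [gaussDens₃]; ring

lemma inv_sqrt_two_pi_le : (√(2 * Real.pi))⁻¹ ≤ 1 := by
  apply inv_le_one_of_one_le₀
  rw [Real.one_le_sqrt]
  linarith [Real.pi_gt_three]

lemma gaussDens_nonneg (x : ℝ) : 0 ≤ gaussDens x := by unfold gaussDens; positivity

/-- Half of the Gaussian exponent absorbs polynomials of degree four through exp(y) ≥ 1 + y + y²/2
at y = x²/4. The second and third derivatives are both covered. -/
lemma gaussDens_le (x : ℝ) :
    (1 + x ^ 2 / 4 + x ^ 4 / 32) * gaussDens x ≤ Real.exp (-(1 / 4) * x ^ 2) := by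
  have h1 : gaussDens x ≤ Real.exp (-(x ^ 2 / 2)) := by
    unfold gaussDens
    exact mul_le_of_le_one_left (Real.exp_nonneg _) inv_sqrt_two_pi_le
  have h2 := Real.quadratic_le_exp_of_nonneg (x := x ^ 2 / 4) (by positivity)
  have h3 : Real.exp (-(1 / 4) * x ^ 2) = Real.exp (x ^ 2 / 4) * Real.exp (-(x ^ 2 / 2)) := by
    rw [← Real.exp_add]; ring_nf
  rw [h3]
  refine mul_le_mul ?_ h1 (gaussDens_nonneg x) (Real.exp_nonneg _)
  nlinarith

lemma abs_gaussDens₂_le (x : ℝ) : |gaussDens₂ x| ≤ 16 * Real.exp (-(1 / 4) * x ^ 2) := by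
  rw [gaussDens₂, abs_mul, abs_of_nonneg (gaussDens_nonneg x)]
  refine le_trans ?_ (mul_le_mul_of_nonneg_left (gaussDens_le x) (by norm_num))
  rw [← mul_assoc]
  refine mul_le_mul_of_nonneg_right ?_ (gaussDens_nonneg x)
  rw [abs_le]
  constructor <;> nlinarith [sq_nonneg x, sq_nonneg (x ^ 2)]

lemma abs_gaussDens₃_le (x : ℝ) : |gaussDens₃ x| ≤ 16 * Real.exp (-(1 / 4) * x ^ 2) := by
  rw [gaussDens₃, abs_mul, abs_of_nonneg (gaussDens_nonneg x)]
  refine le_trans ?_ (mul_le_mul_of_nonneg_left (gaussDens_le x) (by norm_num))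
  rw [← mul_assoc]
  refine mul_le_mul_of_nonneg_right ?_ (gaussDens_nonneg x)
  have h1 : |3 * x - x ^ 3| ≤ |x| * (3 + |x| ^ 2) := by
    rw [show 3 * x - x ^ 3 = x * (3 - x ^ 2) by ring, abs_mul, sq_abs]
    refine mul_le_mul_of_nonneg_left ?_ (abs_nonneg x)
    rw [abs_le]; constructor <;> nlinarith [sq_nonneg x]
  refine h1.trans ?_
  have h2 : x ^ 2 = |x| ^ 2 := (sq_abs x).symm
  have h4 : x ^ 4 = |x| ^ 4 := by rw [show x ^ 4 = (x ^ 2) ^ 2 by ring, h2]; ring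
  rw [h2, h4]
  nlinarith [sq_nonneg (|x| - 1), sq_nonneg |x|, sq_nonneg (|x| ^ 2), mul_nonneg (sq_nonneg (|x| - 1)) (sq_nonneg |x|)]

lemma integrable_gaussDens₃ : Integrable gaussDens₃ := by
  refine ((integrable_exp_neg_mul_sq (b := 1 / 4) (by norm_num)).const_mul 16).mono'
    continuous_gaussDens₃.aestronglyMeasurable (ae_of_all _ fun x => ?_)
  simpa using abs_gaussDens₃_le x

/-- A constant that bounds the Gaussian kernels. -/
def gaussBound : ℝ := 16 + ∫ x, |gaussDens₃ x|

lemma gaussBound_ge : 16 ≤ gaussBound := by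
  have : 0 ≤ ∫ x, |gaussDens₃ x| := integral_nonneg fun x => abs_nonneg _
  unfold gaussBound; linarith

lemma abs_le_gaussBound {a x : ℝ} (h : |a| ≤ 16 * Real.exp (-(1 / 4) * x ^ 2)) :
    |a| ≤ gaussBound := by
  have h1 : Real.exp (-(1 / 4) * x ^ 2) ≤ 1 := by
    rw [Real.exp_le_one_iff]; nlinarith [sq_nonneg x]
  linarith [gaussBound_ge]

/-- Functions of a variance `q` and a position `x`, with their derivatives in `x`, that are bounded
like the second derivative of the centered Gaussian density of variance `q`. -/
structure IsAdmissible (A : ℝ) (f f' : ℝ → ℝ → ℝ) : Prop where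
  measurable : Measurable (Function.uncurry f)
  measurable_deriv : Measurable (Function.uncurry f')
  hasDerivAt : ∀ q, 0 < q → ∀ x, HasDerivAt (f q) (f' q x) x
  continuous_deriv : ∀ q, 0 < q → Continuous (f' q)
  bound : ∀ q, 0 < q → ∀ x, |f q x| ≤ A / (q * √q)
  bound_deriv : ∀ q, 0 < q → ∀ x, |f' q x| ≤ A / q ^ 2
  lintegral_deriv : ∀ q, 0 < q → ∫⁻ x, ‖f' q x‖ₑ ≤ ENNReal.ofReal (A / (q * √q))

lemma IsAdmissible.sub {A B : ℝ} {f f' g g' : ℝ → ℝ → ℝ} (hf : IsAdmissible A f f')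
    (hg : IsAdmissible B g g') (hA : 0 ≤ A) (hB : 0 ≤ B) :
    IsAdmissible (A + B) (fun q x => f q x - g q x) (fun q x => f' q x - g' q x) where
  measurable := hf.measurable.sub hg.measurable
  measurable_deriv := hf.measurable_deriv.sub hg.measurable_deriv
  hasDerivAt q hq x := (hf.hasDerivAt q hq x).sub (hg.hasDerivAt q hq x)
  continuous_deriv q hq := (hf.continuous_deriv q hq).sub (hg.continuous_deriv q hq)
  bound q hq x := by
    rw [add_div]
    exact (abs_sub _ _).trans (add_le_add (hf.bound q hq x) (hg.bound q hq x))
  bound_deriv q hq x := by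
    rw [add_div]
    exact (abs_sub _ _).trans (add_le_add (hf.bound_deriv q hq x) (hg.bound_deriv q hq x))
  lintegral_deriv q hq := by
    rw [add_div, ENNReal.ofReal_add (by positivity) (by positivity)]
    refine le_trans (lintegral_mono fun x => enorm_sub_le) ?_
    rw [lintegral_add_left (hf.continuous_deriv q hq).measurable.enorm]
    exact add_le_add (hf.lintegral_deriv q hq) (hg.lintegral_deriv q hq)

@[fun_prop]
lemma measurable_gaussKer₂ : Measurable (Function.uncurry gaussKer₂) := by
  have h := continuous_gaussDens₂.measurable
  unfold gaussKer₂ Function.uncurry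
  fun_prop

@[fun_prop]
lemma measurable_gaussKer₃ : Measurable (Function.uncurry gaussKer₃) := by
  have h := continuous_gaussDens₃.measurable
  unfold gaussKer₃ Function.uncurry
  fun_prop

lemma continuous_gaussKer₂ (q : ℝ) : Continuous (gaussKer₂ q) := by
  unfold gaussKer₂; fun_prop

lemma continuous_gaussKer₃ (q : ℝ) : Continuous (gaussKer₃ q) := by
  unfold gaussKer₃; fun_prop

lemma hasDerivAt_gaussKer₂ {q : ℝ} (hq : 0 < q) (x : ℝ) :
    HasDerivAt (gaussKer₂ q) (gaussKer₃ q x) x := by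
  have h := ((hasDerivAt_gaussDens₂ (x / √q)).comp x ((hasDerivAt_id x).div_const (√q))).const_mul
    (1 / (q * √q))
  refine h.congr_deriv ?_
  have h1 : √q * √q = q := Real.mul_self_sqrt hq.le
  have h2 : 0 < √q := Real.sqrt_pos.2 hq
  rw [gaussKer₃]
  field_simp
  rw [show √q ^ 2 = q by rw [sq, h1]]

lemma abs_gaussKer₂_le {q : ℝ} (hq : 0 < q) (x : ℝ) : |gaussKer₂ q x| ≤ gaussBound / (q * √q) := by
  rw [gaussKer₂, abs_mul, abs_of_nonneg (by positivity), div_mul_eq_mul_div, one_mul]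
  gcongr
  exact abs_le_gaussBound (abs_gaussDens₂_le _)

lemma abs_gaussKer₃_le {q : ℝ} (hq : 0 < q) (x : ℝ) : |gaussKer₃ q x| ≤ gaussBound / q ^ 2 := by
  rw [gaussKer₃, abs_mul, abs_of_nonneg (by positivity), div_mul_eq_mul_div, one_mul]
  gcongr
  exact abs_le_gaussBound (abs_gaussDens₃_le _)

lemma gaussKer₂_neg (q x : ℝ) : gaussKer₂ q (-x) = gaussKer₂ q x := by
  simp only [gaussKer₂, gaussDens₂, gaussDens, neg_div, neg_sq]

/-- Rescaling by √q improves the power q^(-2) of the sup bound to q^(-3/2). This half power is the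
gain that makes the energy of the potentials finite. -/
lemma lintegral_gaussKer₃_le {q : ℝ} (hq : 0 < q) :
    ∫⁻ x, ‖gaussKer₃ q x‖ₑ ≤ ENNReal.ofReal (gaussBound / (q * √q)) := by
  have h2 : 0 < √q := Real.sqrt_pos.2 hq
  have h1 : √q * √q = q := Real.mul_self_sqrt hq.le
  have hint : Integrable fun x => gaussDens₃ (x / √q) := integrable_gaussDens₃.comp_div h2.ne'
  have : ∀ x, ‖gaussKer₃ q x‖ₑ = ENNReal.ofReal (1 / q ^ 2 * |gaussDens₃ (x / √q)|) := by
    intro x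
    rw [← ofReal_norm, gaussKer₃, norm_mul, Real.norm_of_nonneg (by positivity), Real.norm_eq_abs]
  simp_rw [this]
  rw [← ofReal_integral_eq_lintegral_ofReal (hint.abs.const_mul _)
    (ae_of_all _ fun x => by positivity), integral_const_mul,
    Measure.integral_comp_div (fun x => |gaussDens₃ x|), abs_of_pos h2, smul_eq_mul]
  apply ENNReal.ofReal_le_ofReal
  have h3 : 1 / q ^ 2 * (√q * ∫ x, |gaussDens₃ x|) = (∫ x, |gaussDens₃ x|) / (q * √q) := by
    have h4 : √q ^ 2 = q := by rw [sq, h1]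
    field_simp
    rw [h4]
  rw [h3]
  gcongr
  unfold gaussBound; linarith

/-- The convolution of `gaussKer₂ q` with the image of `ν` under `u ↦ ε u`. -/
def convKer₂ (ν : Measure ℝ) (ε q x : ℝ) : ℝ := ∫ u, gaussKer₂ q (x - ε * u) ∂ν

/-- The convolution of `gaussKer₃ q` with the image of `ν` under `u ↦ ε u`. -/
def convKer₃ (ν : Measure ℝ) (ε q x : ℝ) : ℝ := ∫ u, gaussKer₃ q (x - ε * u) ∂ν

variable (ν : Measure ℝ) [IsProbabilityMeasure ν]

lemma integrable_of_continuous_of_bounded {f : ℝ → ℝ} (hf : Continuous f) (C : ℝ)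
    (hb : ∀ x, |f x| ≤ C) : Integrable f ν :=
  (integrable_const C).mono' hf.aestronglyMeasurable (ae_of_all _ hb)

/-- Averaging translates against a probability measure preserves the sup bounds and the L¹ bound.
The constant is thus the same for all ε, with ε = 0 giving the unsmoothed kernel, and this
uniformity supplies every dominating function in the limit ε → 0. -/
lemma isAdmissible_convKer (ε : ℝ) :
    IsAdmissible gaussBound (convKer₂ ν ε) (convKer₃ ν ε) where
  measurable := by
    have h : Measurable fun p : (ℝ × ℝ) × ℝ => gaussKer₂ p.1.1 (p.1.2 - ε * p.2) :=
      measurable_gaussKer₂.comp (by fun_prop : Measurable fun p : (ℝ × ℝ) × ℝ => (p.1.1, p.1.2 - ε * p.2))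
    exact (h.stronglyMeasurable.integral_prod_right (ν := ν)).measurable
  measurable_deriv := by
    have h : Measurable fun p : (ℝ × ℝ) × ℝ => gaussKer₃ p.1.1 (p.1.2 - ε * p.2) :=
      measurable_gaussKer₃.comp (by fun_prop : Measurable fun p : (ℝ × ℝ) × ℝ => (p.1.1, p.1.2 - ε * p.2))
    exact (h.stronglyMeasurable.integral_prod_right (ν := ν)).measurable
  hasDerivAt q hq x := by
    refine (hasDerivAt_integral_of_dominated_loc_of_deriv_le (μ := ν)
      (F := fun x u => gaussKer₂ q (x - ε * u)) (F' := fun x u => gaussKer₃ q (x - ε * u))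
      (bound := fun _ => gaussBound / q ^ 2) (s := univ) univ_mem ?_ ?_ ?_ ?_ ?_ ?_).2
    · exact Eventually.of_forall fun y =>
        ((continuous_gaussKer₂ q).comp (by fun_prop)).aestronglyMeasurable
    · exact integrable_of_continuous_of_bounded ν ((continuous_gaussKer₂ q).comp (by fun_prop)) _
        fun u => abs_gaussKer₂_le hq _
    · exact ((continuous_gaussKer₃ q).comp (by fun_prop)).aestronglyMeasurable
    · exact ae_of_all _ fun u y _ => abs_gaussKer₃_le hq _
    · exact integrable_const _
    · refine ae_of_all _ fun u y _ => ?_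
      exact (hasDerivAt_gaussKer₂ hq (y - ε * u)).comp_sub_const y (ε * u)
  continuous_deriv q hq := by
    refine continuous_of_dominated (bound := fun _ => gaussBound / q ^ 2) ?_ ?_ (integrable_const _) ?_
    · exact fun x => ((continuous_gaussKer₃ q).comp (by fun_prop)).aestronglyMeasurable
    · exact fun x => ae_of_all _ fun u => abs_gaussKer₃_le hq _
    · exact ae_of_all _ fun u => (continuous_gaussKer₃ q).comp (by fun_prop)
  bound q hq x := by
    have h := norm_integral_le_of_norm_le_const (μ := ν) (f := fun u => gaussKer₂ q (x - ε * u))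
      (ae_of_all _ fun u => abs_gaussKer₂_le hq _)
    simpa [convKer₂] using h
  bound_deriv q hq x := by
    have h := norm_integral_le_of_norm_le_const (μ := ν) (f := fun u => gaussKer₃ q (x - ε * u))
      (ae_of_all _ fun u => abs_gaussKer₃_le hq _)
    simpa [convKer₃] using h
  lintegral_deriv q hq := by
    calc ∫⁻ x, ‖convKer₃ ν ε q x‖ₑ
        ≤ ∫⁻ x, ∫⁻ u, ‖gaussKer₃ q (x - ε * u)‖ₑ ∂ν :=
          lintegral_mono fun x => enorm_integral_le_lintegral_enorm _
      _ = ∫⁻ u, (∫⁻ x, ‖gaussKer₃ q (x - ε * u)‖ₑ) ∂ν := by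
          refine lintegral_lintegral_swap (Measurable.aemeasurable ?_)
          exact ((continuous_gaussKer₃ q).comp
            (by fun_prop : Continuous fun p : ℝ × ℝ => p.1 - ε * p.2)).measurable.enorm
      _ = ∫⁻ u, (∫⁻ x, ‖gaussKer₃ q x‖ₑ) ∂ν := by
          congr 1 with u
          exact lintegral_sub_right_eq_self (fun x => ‖gaussKer₃ q x‖ₑ) (ε * u)
      _ ≤ ENNReal.ofReal (gaussBound / (q * √q)) := by
          rw [lintegral_const, measure_univ, mul_one]
          exact lintegral_gaussKer₃_le hq

lemma convKer₂_zero (q x : ℝ) : convKer₂ ν 0 q x = gaussKer₂ q x := by simp [convKer₂]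

lemma tendsto_convKer₂ {q : ℝ} (hq : 0 < q) (x : ℝ) :
    Tendsto (fun ε => convKer₂ ν ε q x) (𝓝 0) (𝓝 (convKer₂ ν 0 q x)) := by
  have : Continuous fun ε => convKer₂ ν ε q x :=
    continuous_of_dominated (bound := fun _ => gaussBound / (q * √q))
      (fun ε => ((continuous_gaussKer₂ q).comp (by fun_prop)).aestronglyMeasurable)
      (fun ε => ae_of_all _ fun u => abs_gaussKer₂_le hq _) (integrable_const _)
      (ae_of_all _ fun u => (continuous_gaussKer₂ q).comp (by fun_prop))
  exact this.tendsto 0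

lemma tendsto_convKer₃ {q : ℝ} (hq : 0 < q) (x : ℝ) :
    Tendsto (fun ε => convKer₃ ν ε q x) (𝓝 0) (𝓝 (convKer₃ ν 0 q x)) := by
  have : Continuous fun ε => convKer₃ ν ε q x :=
    continuous_of_dominated (bound := fun _ => gaussBound / q ^ 2)
      (fun ε => ((continuous_gaussKer₃ q).comp (by fun_prop)).aestronglyMeasurable)
      (fun ε => ae_of_all _ fun u => abs_gaussKer₃_le hq _) (integrable_const _)
      (ae_of_all _ fun u => (continuous_gaussKer₃ q).comp (by fun_prop))
  exact this.tendsto 0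

end

/-! ### Mollification and the semigroup applied to G_ε. -/

section

/-- The measure `ρ(u) du` on `[-1,1]`. -/
def mollMeasure (ρ : ℝ → ℝ) : Measure ℝ :=
  (volume.restrict (Icc (-1) 1)).withDensity fun u => ENNReal.ofReal (ρ u)

lemma isProbabilityMeasure_mollMeasure {ρ : ℝ → ℝ} (hρ : Continuous ρ) (hρ_nonneg : ∀ y, 0 ≤ ρ y)
    (hρ_int : ∫ y in Icc (-1 : ℝ) 1, ρ y = 1) : IsProbabilityMeasure (mollMeasure ρ) := by
  constructor
  rw [mollMeasure, withDensity_apply _ MeasurableSet.univ, Measure.restrict_univ,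
    ← ofReal_integral_eq_lintegral_ofReal hρ.integrableOn_Icc (ae_of_all _ hρ_nonneg), hρ_int]
  simp

lemma integral_mollMeasure {ρ : ℝ → ℝ} (hρ : Continuous ρ) (hρ_nonneg : ∀ y, 0 ≤ ρ y)
    (hρ_supp : Function.support ρ ⊆ Icc (-1) 1) (f : ℝ → ℝ) :
    ∫ u, f u ∂(mollMeasure ρ) = ∫ u, ρ u * f u := by
  rw [mollMeasure, integral_withDensity_eq_integral_toReal_smul hρ.measurable.ennreal_ofReal
    (ae_of_all _ fun _ => ENNReal.ofReal_lt_top)]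
  simp_rw [ENNReal.toReal_ofReal (hρ_nonneg _), smul_eq_mul]
  refine setIntegral_eq_integral_of_forall_compl_eq_zero fun x hx => ?_
  rw [Function.notMem_support.1 fun h => hx (hρ_supp h), zero_mul]

/-- The centered Gaussian density of variance `q`. -/
def gaussKer₀ (q x : ℝ) : ℝ := 1 / √q * gaussDens (x / √q)

/-- The derivative of the centered Gaussian density of variance `q`. -/
def gaussKer₁ (q x : ℝ) : ℝ := 1 / q * (-(x / √q) * gaussDens (x / √q))

lemma hasDerivAt_gaussKer₀ {q : ℝ} (hq : 0 < q) (x : ℝ) :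
    HasDerivAt (gaussKer₀ q) (gaussKer₁ q x) x := by
  have h := ((hasDerivAt_gaussDens (x / √q)).comp x ((hasDerivAt_id x).div_const (√q))).const_mul
    (1 / √q)
  refine h.congr_deriv ?_
  have h1 : √q * √q = q := Real.mul_self_sqrt hq.le
  have h2 : 0 < √q := Real.sqrt_pos.2 hq
  rw [gaussKer₁]
  field_simp
  rw [show √q ^ 2 = q by rw [sq, h1]]
  ring

lemma hasDerivAt_gaussKer₁ {q : ℝ} (hq : 0 < q) (x : ℝ) :
    HasDerivAt (gaussKer₁ q) (gaussKer₂ q x) x := by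
  have h0 : HasDerivAt (fun y => -y * gaussDens y) (gaussDens₂ (x / √q)) (x / √q) := by
    refine ((hasDerivAt_neg (x / √q)).mul (hasDerivAt_gaussDens (x / √q))).congr_deriv ?_
    rw [gaussDens₂]; ring
  have h := (h0.comp x ((hasDerivAt_id x).div_const (√q))).const_mul (1 / q)
  refine h.congr_deriv ?_
  rw [gaussKer₂]
  have h2 : 0 < √q := Real.sqrt_pos.2 hq
  field_simp

lemma gaussianPDFReal_eq {q : ℝ} (hq : 0 < q) (x : ℝ) :
    gaussianPDFReal 0 q.toNNReal x = gaussKer₀ q x := by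
  have h1 : √q ^ 2 = q := Real.sq_sqrt hq.le
  have h2 : 0 < √q := Real.sqrt_pos.2 hq
  rw [gaussianPDFReal, gaussKer₀, gaussDens, Real.coe_toNNReal _ hq.le, div_pow, h1,
    Real.sqrt_mul (by positivity)]
  rw [mul_inv, sub_zero, one_div, ← mul_assoc, mul_comm (√q)⁻¹]
  congr 2
  field_simp

lemma mollifier_contDiff {ρ : ℝ → ℝ} (hρ : ContDiff ℝ (⊤ : ℕ∞) ρ) (ε : ℝ) :
    ContDiff ℝ (⊤ : ℕ∞) (mollifier ρ ε) := by
  unfold mollifier; fun_prop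

lemma mollifier_hasCompactSupport {ρ : ℝ → ℝ} (hρ_supp : Function.support ρ ⊆ Icc (-1) 1)
    {ε : ℝ} (hε : 0 < ε) : HasCompactSupport (mollifier ρ ε) := by
  refine HasCompactSupport.intro (isCompact_Icc (a := -ε) (b := ε)) fun x hx => ?_
  have : x / ε ∉ Function.support ρ := by
    intro h
    apply hx
    have h2 := hρ_supp h
    rw [mem_Icc, le_div_iff₀ hε, div_le_iff₀ hε] at h2
    exact ⟨by linarith [h2.1], by linarith [h2.2]⟩
  rw [mollifier, Function.notMem_support.1 this, mul_zero]

lemma integral_deriv_mul_eq {R R' g g' : ℝ → ℝ} (hR : ∀ x, HasDerivAt R (R' x) x)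
    (hg : ∀ x, HasDerivAt g (g' x) x) (hR' : Continuous R') (hg' : Continuous g')
    (hRc : HasCompactSupport R) (hRc' : HasCompactSupport R') :
    ∫ x, R' x * g x = -∫ x, R x * g' x := by
  have hRcont : Continuous R := continuous_iff_continuousAt.2 fun x => (hR x).continuousAt
  have hgcont : Continuous g := continuous_iff_continuousAt.2 fun x => (hg x).continuousAt
  have i1 : Integrable (R * g') := (hRcont.mul hg').integrable_of_hasCompactSupport hRc.mul_right
  have i2 : Integrable (R' * g) := (hR'.mul hgcont).integrable_of_hasCompactSupport hRc'.mul_right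
  have i3 : Integrable (R * g) := (hRcont.mul hgcont).integrable_of_hasCompactSupport hRc.mul_right
  have := integral_mul_deriv_eq_deriv_mul_of_integrable (fun x _ => hR x) (fun x _ => hg x) i1 i2 i3
  rw [this, neg_neg]

/-- Two integrations by parts move the derivatives from ρ_ε to the Gaussian density; compact support
of the mollifier removes the boundary terms. Evenness of the second derivative of the density then
turns the correlation into a convolution, and y = εu rescales it. -/
lemma integral_gaussian_iteratedDeriv_mollifier {ρ : ℝ → ℝ} (hρ : ContDiff ℝ (⊤ : ℕ∞) ρ)
    (hρ_nonneg : ∀ y, 0 ≤ ρ y)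
    (hρ_supp : Function.support ρ ⊆ Icc (-1) 1) {ε : ℝ} (hε : 0 < ε) {q : ℝ} (hq : 0 < q) (m : ℝ) :
    ∫ x, iteratedDeriv 2 (mollifier ρ ε) (m + x) ∂(gaussianReal 0 q.toNNReal) =
      convKer₂ (mollMeasure ρ) ε q m := by
  have hq' : q.toNNReal ≠ 0 := by simpa using hq
  rw [integral_gaussianReal_eq_integral_smul hq']
  set R := mollifier ρ ε with hRdef
  have hR : ContDiff ℝ (⊤ : ℕ∞) R := mollifier_contDiff hρ ε
  have hRc : HasCompactSupport R := mollifier_hasCompactSupport hρ_supp hε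
  have hR1 : ContDiff ℝ (⊤ : ℕ∞) (deriv R) := ContDiff.deriv' (by simpa using hR)
  have hR2 : Continuous (deriv (deriv R)) := hR1.continuous_deriv (by simp)
  have d0 : ∀ x, HasDerivAt R (deriv R x) x :=
    fun x => (hR.differentiable (by simp) x).hasDerivAt
  have d1 : ∀ x, HasDerivAt (deriv R) (deriv (deriv R) x) x :=
    fun x => (hR1.differentiable (by simp) x).hasDerivAt
  have hcs : ∀ f : ℝ → ℝ, HasCompactSupport f → HasCompactSupport fun x => f (m + x) :=
    fun f hf => hf.comp_homeomorph (Homeomorph.addLeft m)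
  have c1 : Continuous (gaussKer₁ q) := by unfold gaussKer₁; fun_prop
  have s1 := integral_deriv_mul_eq (R := fun x => deriv R (m + x)) (g := gaussKer₀ q)
    (fun x => (d1 (m + x)).comp_const_add m x) (hasDerivAt_gaussKer₀ hq) (by fun_prop) c1
    (hcs _ hRc.deriv) (hcs _ hRc.deriv.deriv)
  have s2 := integral_deriv_mul_eq (R := fun x => R (m + x)) (g := gaussKer₁ q)
    (fun x => (d0 (m + x)).comp_const_add m x) (hasDerivAt_gaussKer₁ hq)
    (hR1.continuous.comp (by fun_prop)) (continuous_gaussKer₂ q) (hcs _ hRc) (hcs _ hRc.deriv)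
  have h1 : ∀ x, gaussianPDFReal 0 q.toNNReal x • iteratedDeriv 2 R (m + x) =
      deriv (deriv R) (m + x) * gaussKer₀ q x := by
    intro x
    rw [gaussianPDFReal_eq hq, iteratedDeriv_succ, iteratedDeriv_one, smul_eq_mul, mul_comm]
  simp_rw [h1]
  rw [s1, s2, neg_neg, convKer₂, integral_mollMeasure hρ.continuous hρ_nonneg hρ_supp]
  have s3 := integral_add_left_eq_self (μ := volume) (fun y => R y * gaussKer₂ q (m - y)) m
  have s4 := Measure.integral_comp_div (fun u => ρ u * gaussKer₂ q (m - ε * u)) ε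
  rw [abs_of_pos hε, smul_eq_mul] at s4
  calc ∫ x, R (m + x) * gaussKer₂ q x = ∫ x, R (m + x) * gaussKer₂ q (m - (m + x)) := by
        congr 1 with x
        rw [← gaussKer₂_neg q x]
        ring_nf
    _ = ∫ y, (1 / ε) * (ρ (y / ε) * gaussKer₂ q (m - ε * (y / ε))) := by
        rw [s3]
        congr 1 with y
        rw [hRdef, mollifier, mul_div_cancel₀ _ hε.ne']
        ring
    _ = _ := by
        rw [integral_const_mul, s4]
        field_simp

lemma abs_inner_heatVec_le {a t : ℝ} (ha : 0 < a) (hat : a ≤ t) (r : ℝ) (z : H) :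
    |⟪heatVec t r, z⟫_ℝ| ≤ heatBound a * ‖z‖ :=
  (abs_real_inner_le_norm _ _).trans
    (mul_le_mul_of_nonneg_right (norm_heatVec_le ha hat r) (norm_nonneg z))

section Semigroup

variable {Ω : Type*} [MeasurableSpace Ω] {P : Measure Ω}
  {ξ : Lp ℝ 2 volST →ₗᵢ[ℝ] Lp ℝ 2 P} {z : H} {v : ℝ → ℝ → Ω → ℝ}

lemma IsSHESolution.ae_eq (hv : IsSHESolution ξ z v) {t : ℝ} (ht : 0 < t) {r : ℝ}
    (hr : r ∈ Icc (0 : ℝ) 1) :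
    ∀ᵐ ω ∂P, v t r ω = ⟪heatVec t r, z⟫_ℝ + wienerIntegral ξ (convKernel t r) ω := by
  rw [← heatFlow_eq_inner ht]
  exact hv.mild t ht r hr

variable [IsProbabilityMeasure P]

/-- The bound does not depend on r, so it can be integrated over (0,1). -/
lemma IsSHESolution.lintegral_sq_le (hv : IsSHESolution ξ z v) {t : ℝ} (ht : 0 < t) {r : ℝ}
    (hr : r ∈ Icc (0 : ℝ) 1) :
    ∫⁻ ω, ‖v t r ω‖ₑ ^ 2 ∂P ≤ (ENNReal.ofReal (heatBound t * ‖z‖) +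
      ENNReal.ofReal (√(∑' k : ℕ, 1 / eigval (k + 1) * 2))) ^ 2 := by
  rw [← eLpNorm_two_sq]
  gcongr
  have hW : AEStronglyMeasurable (wienerIntegral ξ (convKernel t r)) P := by
    rw [wienerIntegral, dif_pos (memLp_convKernel ht r)]
    exact (Lp.memLp _).1
  have h1 : eLpNorm (v t r) 2 P = eLpNorm
      ((fun _ => ⟪heatVec t r, z⟫_ℝ) + wienerIntegral ξ (convKernel t r)) 2 P :=
    eLpNorm_congr_ae (hv.ae_eq ht hr)
  rw [h1]
  refine (eLpNorm_add_le aestronglyMeasurable_const hW (by norm_num)).trans (add_le_add ?_ ?_)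
  · rw [eLpNorm_const _ (by norm_num) (NeZero.ne P), measure_univ, ENNReal.one_rpow, mul_one,
      ← ofReal_norm]
    exact ENNReal.ofReal_le_ofReal (abs_inner_heatVec_le ht le_rfl r z)
  · rw [wienerIntegral, dif_pos (memLp_convKernel ht r)]
    change eLpNorm (ξ ((memLp_convKernel ht r).toLp _)) 2 P ≤ _
    rw [← Lp.enorm_def, ← ofReal_norm, ξ.norm_map]
    apply ENNReal.ofReal_le_ofReal
    apply Real.le_sqrt_of_sq_le
    rw [Lp.norm_toLp, ← ENNReal.toReal_pow, eLpNorm_two_sq, lintegral_convKernel_sq ht,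
      ENNReal.toReal_ofReal (varSeries_nonneg t r)]
    exact varSeries_le t r

/-- Since `toH` sends functions outside L² to 0, this is what ensures that the functional is really
evaluated at the path of the solution. Tonelli turns the pointwise moment bound into almost sure
square integrability. -/
lemma IsSHESolution.ae_memLp (hv : IsSHESolution ξ z v) {t : ℝ} (ht : 0 < t) :
    ∀ᵐ ω ∂P, MemLp (fun x => v t x ω) 2 vol01 := by
  have hm := hv.aemeasurable t ht.le
  have hm2 : AEMeasurable (fun p : ℝ × Ω => ‖v t p.1 p.2‖ₑ ^ 2) (vol01.prod P) :=
    hm.enorm.pow_const _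
  have hfin : ∫⁻ p, ‖v t p.1 p.2‖ₑ ^ 2 ∂(vol01.prod P) < ⊤ := by
    rw [lintegral_prod _ hm2]
    refine lt_of_le_of_lt (setLIntegral_mono' measurableSet_Ioo fun r hr =>
      hv.lintegral_sq_le ht (Ioo_subset_Icc_self hr)) ?_
    rw [lintegral_const]
    exact ENNReal.mul_lt_top (by finiteness) (measure_lt_top _ _)
  rw [lintegral_prod_symm _ hm2] at hfin
  have h1 := ae_lt_top' hm2.prod_swap.lintegral_prod_right' hfin.ne
  have h2 := (hm.prod_swap.aestronglyMeasurable).prodMk_left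
  filter_upwards [h1, h2] with ω h3 h4
  exact memLp_two_of_lintegral h4 h3

lemma exists_bound_iteratedDeriv_mollifier {ρ : ℝ → ℝ} (hρ : ContDiff ℝ (⊤ : ℕ∞) ρ)
    (hρ_supp : Function.support ρ ⊆ Icc (-1) 1) {ε : ℝ} (hε : 0 < ε) :
    Continuous (iteratedDeriv 2 (mollifier ρ ε)) ∧
      ∃ C, ∀ x, ‖iteratedDeriv 2 (mollifier ρ ε) x‖ ≤ C := by
  have hc : Continuous (iteratedDeriv 2 (mollifier ρ ε)) :=
    (mollifier_contDiff hρ ε).continuous_iteratedDeriv 2 (ENat.natCast_le_of_coe_top_le_withTop le_rfl 2)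
  refine ⟨hc, ?_⟩
  have hs : HasCompactSupport (iteratedDeriv 2 (mollifier ρ ε)) := by
    rw [iteratedDeriv_succ, iteratedDeriv_one]
    exact (mollifier_hasCompactSupport hρ_supp hε).deriv.deriv
  exact hs.exists_bound_of_continuous hc

/-- `Q_t G_ε` as an integral of smoothed Gaussian kernels. -/
lemma IsSHESolution.integral_Geps (hv : IsSHESolution ξ z v) (hξ : IsWhiteNoise P ξ)
    {ρ : ℝ → ℝ} (hρ : ContDiff ℝ (⊤ : ℕ∞) ρ) (hρ_nonneg : ∀ y, 0 ≤ ρ y)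
    (hρ_supp : Function.support ρ ⊆ Icc (-1) 1) {h : ℝ → ℝ} (hh : Continuous h)
    (hh_compact : HasCompactSupport h) {ε t : ℝ} (hε : 0 < ε) (ht : 0 < t) :
    ∫ ω, Geps h ρ ε (toH fun x => v t x ω) ∂P = (1 / 2) * ∫ r in Ioo (0 : ℝ) 1,
      h r * convKer₂ (mollMeasure ρ) ε (varSeries t r) ⟪heatVec t r, z⟫_ℝ := by
  obtain ⟨hRc, C, hC⟩ := exists_bound_iteratedDeriv_mollifier hρ hρ_supp hε
  obtain ⟨D, hD⟩ := hh_compact.exists_bound_of_continuous hh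
  set R := iteratedDeriv 2 (mollifier ρ ε) with hR
  have h1 : ∀ᵐ ω ∂P, Geps h ρ ε (toH fun x => v t x ω) =
      (1 / 2) * ∫ r in Ioo (0 : ℝ) 1, h r * R (v t r ω) := by
    filter_upwards [hv.ae_memLp ht] with ω hω
    rw [Geps]
    congr 1
    refine integral_congr_ae ?_
    filter_upwards [coeFn_toH hω] with r hr
    rw [hr]
  rw [integral_congr_ae h1, integral_const_mul]
  congr 1
  have hm : AEStronglyMeasurable (fun p : ℝ × Ω => h p.1 * R (v t p.1 p.2)) (vol01.prod P) := by
    refine AEStronglyMeasurable.mul (hh.measurable.comp measurable_fst).aestronglyMeasurable ?_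
    exact hRc.comp_aestronglyMeasurable (hv.aemeasurable t ht.le).aestronglyMeasurable
  have hint : Integrable (fun p : ℝ × Ω => h p.1 * R (v t p.1 p.2)) (vol01.prod P) := by
    refine (integrable_const (D * C)).mono' hm (ae_of_all _ fun p => ?_)
    rw [norm_mul]
    exact mul_le_mul (hD _) (hC _) (norm_nonneg _) ((norm_nonneg _).trans (hD 0))
  -- Fubini brings the expectation inside the integral over r, where only the one-point law of
  -- v(t,r) matters.
  rw [integral_integral_swap (f := fun ω r => h r * R (v t r ω)) hint.swap]
  refine setIntegral_congr_fun measurableSet_Ioo fun r hr => ?_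
  rw [integral_const_mul]
  congr 1
  have hq := varSeries_pos ht hr
  have hlaw := hasLaw_wienerIntegral hξ ht r
  rw [← integral_gaussian_iteratedDeriv_mollifier hρ hρ_nonneg hρ_supp hε hq,
    ← hlaw.map_eq, ← hR, integral_map (f := fun x => R (⟪heatVec t r, z⟫_ℝ + x)) hlaw.aemeasurable
      (hRc.comp (continuous_const.add continuous_id)).aestronglyMeasurable]
  refine integral_congr_ae ?_
  filter_upwards [hv.ae_eq ht (Ioo_subset_Icc_self hr)] with ω hω
  rw [hω]

end Semigroup

/-- The integrand of `G^{(t)}` in terms of the second derivative of the Gaussian density. -/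
lemma GtIntegrand_eq (h : ℝ → ℝ) {t : ℝ} (ht : 0 < t) (z : H) {r : ℝ} (hr : r ∈ Ioo (0 : ℝ) 1) :
    GtIntegrand h t z r = (1 / 2) * (h r * gaussKer₂ (varSeries t r) ⟪heatVec t r, z⟫_ℝ) := by
  have hq := varSeries_pos ht hr
  rw [GtIntegrand, qVar_eq ht, heatFlow_eq_inner ht]
  generalize varSeries t r = q at *
  have h1 : √q ^ 2 = q := Real.sq_sqrt hq.le
  have h2 : 0 < √q := Real.sqrt_pos.2 hq
  rw [gaussKer₂, gaussDens₂, gaussDens, Real.sqrt_mul (by positivity), div_pow, div_pow, h1]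
  have h3 : ∀ x : ℝ, x ^ 2 / (2 * q) = x ^ 2 / q / 2 := fun x => by field_simp
  rw [h3]
  have h4 : 0 < √(2 * Real.pi) := by positivity
  field_simp

end

section

/-! ### The covariance operator of the Brownian bridge -/

/-- The function `u ↦ 1_{u ≤ s} - s`, whose Gram matrix is the covariance of the bridge. -/
def bridgeFun (s u : ℝ) : ℝ := (if u ≤ s then 1 else 0) - s

/-- `bridgeFun s` as an element of `H`. -/
def bridgeVec (s : ℝ) : H := toH (bridgeFun s)

lemma measurable_bridgeFun (s : ℝ) : Measurable (bridgeFun s) :=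
  (Measurable.ite measurableSet_Iic measurable_const measurable_const).sub_const s

lemma memLp_bridgeFun (s : ℝ) : MemLp (bridgeFun s) 2 vol01 := by
  refine memLp_of_bounded (measurable_bridgeFun s).aestronglyMeasurable (1 + |s|)
    (ae_of_all _ fun u => ?_)
  refine (norm_sub_le _ _).trans (add_le_add ?_ le_rfl)
  split_ifs <;> simp

lemma inner_bridgeVec {s t : ℝ} (hs : s ∈ Icc (0 : ℝ) 1) (ht : t ∈ Icc (0 : ℝ) 1) :
    ⟪bridgeVec s, bridgeVec t⟫_ℝ = min s t - s * t := by
  have key : ∀ a ∈ Icc (0 : ℝ) 1, ∫ u in Ioo (0 : ℝ) 1, (if u ≤ a then (1 : ℝ) else 0) = a := by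
    intro a ha
    have h1 : (fun u : ℝ => if u ≤ a then (1 : ℝ) else 0) = (Iic a).indicator 1 := by
      ext u; simp [indicator]
    rw [h1, ← integral_Ioc_eq_integral_Ioo, integral_indicator_one measurableSet_Iic,
      measureReal_restrict_apply measurableSet_Iic, inter_comm, Ioc_inter_Iic, min_eq_right ha.2]
    simp [ha.1]
  have hi : ∀ a : ℝ, Integrable (fun u => if u ≤ a then (1 : ℝ) else 0) vol01 := fun a =>
    (integrable_const (1 : ℝ)).mono' (Measurable.ite measurableSet_Iic measurable_const
      measurable_const).aestronglyMeasurable (ae_of_all _ fun u => by split_ifs <;> simp)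
  have hst : min s t ∈ Icc (0 : ℝ) 1 := ⟨le_min hs.1 ht.1, (min_le_left _ _).trans hs.2⟩
  unfold bridgeVec
  rw [inner_toH_toH (memLp_bridgeFun s) (memLp_bridgeFun t)]
  have h2 : ∀ u, bridgeFun s u * bridgeFun t u = (if u ≤ min s t then 1 else 0)
      - t * (if u ≤ s then 1 else 0) - s * (if u ≤ t then 1 else 0) + s * t := by
    intro u
    simp only [bridgeFun, le_min_iff]
    by_cases h3 : u ≤ s <;> by_cases h4 : u ≤ t <;> simp [h3, h4] <;> ring
  simp_rw [h2]
  have i1 : Integrable (fun u => (if u ≤ min s t then (1 : ℝ) else 0) - t * (if u ≤ s then 1 else 0))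
      vol01 := (hi _).sub ((hi _).const_mul t)
  have i2 : Integrable (fun u => (if u ≤ min s t then (1 : ℝ) else 0) - t * (if u ≤ s then 1 else 0)
      - s * (if u ≤ t then 1 else 0)) vol01 := i1.sub ((hi _).const_mul s)
  rw [integral_add i2 (integrable_const _), integral_sub i1 ((hi _).const_mul s),
    integral_sub (hi _) ((hi _).const_mul t), integral_const_mul, integral_const_mul,
    key _ hst, key _ hs, key _ ht]
  simp
  ring

lemma norm_bridgeVec_le {s : ℝ} (hs : s ∈ Icc (0 : ℝ) 1) : ‖bridgeVec s‖ ≤ 1 := by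
  have h := inner_bridgeVec hs hs
  rw [real_inner_self_eq_norm_sq, min_self] at h
  nlinarith [norm_nonneg (bridgeVec s), hs.1, hs.2, mul_nonneg hs.1 hs.1]

/-- The squared distance expands through the Gram matrix into s(1-s) + t(1-t) - 2(min s t - st),
which is continuous and vanishes at s = t. -/
lemma continuousOn_bridgeVec : ContinuousOn bridgeVec (Icc 0 1) := by
  intro t ht
  rw [ContinuousWithinAt, tendsto_iff_norm_sub_tendsto_zero]
  have h1 : Tendsto (fun s => (s - s * s) + (t - t * t) - 2 * (min s t - s * t))
      (𝓝[Icc 0 1] t) (𝓝 ((t - t * t) + (t - t * t) - 2 * (min t t - t * t))) := by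
    refine (Continuous.tendsto ?_ t).mono_left nhdsWithin_le_nhds
    fun_prop
  have h2 : Tendsto (fun s => ‖bridgeVec s - bridgeVec t‖ ^ 2) (𝓝[Icc 0 1] t) (𝓝 0) := by
    have h3 : (t - t * t) + (t - t * t) - 2 * (min t t - t * t) = 0 := by rw [min_self]; ring
    rw [h3] at h1
    refine h1.congr' ?_
    filter_upwards [self_mem_nhdsWithin] with s hs
    rw [norm_sub_sq_real, ← real_inner_self_eq_norm_sq, ← real_inner_self_eq_norm_sq,
      inner_bridgeVec hs hs, inner_bridgeVec ht ht, inner_bridgeVec hs ht, min_self, min_self]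
    ring
  have h4 := h2.sqrt
  simpa using h4

lemma aestronglyMeasurable_bridgeVec : AEStronglyMeasurable bridgeVec vol01 :=
  (continuousOn_bridgeVec.mono Ioo_subset_Icc_self).aestronglyMeasurable measurableSet_Ioo

lemma integrable_smul_bridgeVec (l : H) : Integrable (fun s => l s • bridgeVec s) vol01 := by
  refine (coeFn_integrable l).norm.mono'
    ((coeFn_integrable l).1.smul aestronglyMeasurable_bridgeVec) ?_
  filter_upwards [ae_restrict_mem measurableSet_Ioo] with s hs
  rw [norm_smul]
  exact mul_le_of_le_one_right (norm_nonneg _) (norm_bridgeVec_le (Ioo_subset_Icc_self hs))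

/-- The square root of the covariance operator of the bridge. -/
def bridgeOp (l : H) : H := ∫ s in Ioo (0 : ℝ) 1, l s • bridgeVec s

lemma bridgeOp_add (l m : H) : bridgeOp (l + m) = bridgeOp l + bridgeOp m := by
  rw [bridgeOp, bridgeOp, bridgeOp,
    ← integral_add (integrable_smul_bridgeVec l) (integrable_smul_bridgeVec m)]
  refine integral_congr_ae ?_
  filter_upwards [Lp.coeFn_add l m] with s hs
  rw [hs, Pi.add_apply, add_smul]

lemma bridgeOp_smul (c : ℝ) (l : H) : bridgeOp (c • l) = c • bridgeOp l := by
  rw [bridgeOp, bridgeOp, ← integral_smul]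
  refine integral_congr_ae ?_
  filter_upwards [Lp.coeFn_smul c l] with s hs
  rw [hs, Pi.smul_apply, smul_eq_mul, mul_smul]

/-- The covariance of the bridge is the Green function of -∂² with Dirichlet conditions, so e_k is
an eigenfunction with eigenvalue 1/λ_k. The integral is split at s, and an explicit antiderivative
is used on each side. -/
lemma integral_e_mul_cov (k : ℕ) {s : ℝ} (hs : s ∈ Icc (0 : ℝ) 1) :
    ∫ r in Ioo (0 : ℝ) 1, e (k + 1) r * (min r s - r * s) = e (k + 1) s / eigval (k + 1) := by
  set w : ℝ := ((k + 1 : ℕ) : ℝ) * Real.pi with hw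
  have hw0 : w ≠ 0 := by positivity
  have hsin : Real.sin w = 0 := Real.sin_nat_mul_pi _
  rw [← integral_Ioc_eq_integral_Ioo, ← intervalIntegral.integral_of_le zero_le_one]
  have hc : Continuous fun r => e (k + 1) r * (min r s - r * s) := by fun_prop
  rw [← intervalIntegral.integral_add_adjacent_intervals (b := s)
    (hc.intervalIntegrable _ _) (hc.intervalIntegrable _ _)]
  have d1 : ∀ r : ℝ, HasDerivAt
      (fun r => √2 * (1 - s) * (Real.sin (w * r) / w ^ 2 - r * Real.cos (w * r) / w))
      (√2 * Real.sin (w * r) * (r - r * s)) r := by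
    intro r
    have hm : HasDerivAt (fun r => w * r) w r := by simpa using (hasDerivAt_id r).const_mul w
    have := (((hm.sin).div_const (w ^ 2)).sub (((hasDerivAt_id r).mul hm.cos).div_const w)).const_mul
      (√2 * (1 - s))
    refine this.congr_deriv ?_
    simp only [id]
    field_simp
    ring
  have d2 : ∀ r : ℝ, HasDerivAt
      (fun r => √2 * s * (-Real.cos (w * r) / w - (Real.sin (w * r) / w ^ 2 - r * Real.cos (w * r) / w)))
      (√2 * Real.sin (w * r) * (s - r * s)) r := by
    intro r
    have hm : HasDerivAt (fun r => w * r) w r := by simpa using (hasDerivAt_id r).const_mul w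
    have := (((hm.cos).neg.div_const w).sub
      (((hm.sin).div_const (w ^ 2)).sub (((hasDerivAt_id r).mul hm.cos).div_const w))).const_mul
      (√2 * s)
    refine this.congr_deriv ?_
    simp only [id]
    field_simp
    ring
  have i1 : ∫ r in (0 : ℝ)..s, e (k + 1) r * (min r s - r * s) =
      ∫ r in (0 : ℝ)..s, √2 * Real.sin (w * r) * (r - r * s) := by
    refine intervalIntegral.integral_congr fun r hr => ?_
    rw [uIcc_of_le hs.1] at hr
    simp only [e, min_eq_left hr.2, hw]
  have i2 : ∫ r in s..(1 : ℝ), e (k + 1) r * (min r s - r * s) =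
      ∫ r in s..(1 : ℝ), √2 * Real.sin (w * r) * (s - r * s) := by
    refine intervalIntegral.integral_congr fun r hr => ?_
    rw [uIcc_of_le hs.2] at hr
    simp only [e, min_eq_right hr.1, hw]
  rw [i1, i2, intervalIntegral.integral_eq_sub_of_hasDerivAt (fun r _ => d1 r)
      (Continuous.intervalIntegrable (by fun_prop) _ _),
    intervalIntegral.integral_eq_sub_of_hasDerivAt (fun r _ => d2 r)
      (Continuous.intervalIntegrable (by fun_prop) _ _)]
  have hl : eigval (k + 1) = w ^ 2 := by rw [eigval, hw, mul_pow]
  rw [hl, e, ← hw]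
  simp only [mul_one, hsin, mul_zero, Real.sin_zero, Real.cos_zero]
  field_simp
  ring

/-- The eigenfunction identity in operator form: distinct sine coordinates of the bridge are
uncorrelated, and the k-th has variance 1/λ_k. -/
lemma inner_bridgeOp_eH (k : ℕ) (l : H) :
    ⟪bridgeOp (eH k), bridgeOp l⟫_ℝ = ⟪eH k, l⟫_ℝ / eigval (k + 1) := by
  have h1 : ∀ s ∈ Ioo (0 : ℝ) 1, ⟪bridgeOp (eH k), bridgeVec s⟫_ℝ = e (k + 1) s / eigval (k + 1) := by
    intro s hs
    rw [real_inner_comm, bridgeOp, ← integral_inner (integrable_smul_bridgeVec _),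
      ← integral_e_mul_cov k (Ioo_subset_Icc_self hs)]
    refine integral_congr_ae ?_
    filter_upwards [coeFn_toH (memLp_e (k + 1)), ae_restrict_mem measurableSet_Ioo] with r hr hr2
    rw [eH, hr, inner_smul_right, inner_bridgeVec (Ioo_subset_Icc_self hs) (Ioo_subset_Icc_self hr2),
      min_comm, mul_comm s r]
  conv_lhs => rw [bridgeOp.eq_1 l]
  rw [← integral_inner (integrable_smul_bridgeVec _), inner_eH, ← integral_div]
  refine integral_congr_ae ?_
  filter_upwards [ae_restrict_mem measurableSet_Ioo] with s hs
  rw [inner_smul_right, h1 s hs]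
  ring

/-! ### The characteristic function of the law of the bridge -/

lemma coeFn_sum_smul_toH {ι : Type*} (s : Finset ι) (c : ι → ℝ) (f : ι → ℝ → ℝ)
    (hf : ∀ i, MemLp (f i) 2 vol01) :
    ((∑ i ∈ s, c i • toH (f i) : H) : ℝ → ℝ) =ᵐ[vol01] fun x => ∑ i ∈ s, c i * f i x := by
  classical
  induction s using Finset.induction_on with
  | empty =>
    simp only [Finset.sum_empty]
    exact Lp.coeFn_zero ℝ 2 vol01
  | insert a s ha ih =>
    rw [Finset.sum_insert ha]
    filter_upwards [Lp.coeFn_add (c a • toH (f a)) (∑ i ∈ s, c i • toH (f i)), ih,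
      Lp.coeFn_smul (c a) (toH (f a)), coeFn_toH (hf a)] with r hr1 hr2 hr3 hr4
    rw [hr1, Pi.add_apply, hr2, hr3, Pi.smul_apply, hr4, Finset.sum_insert ha, smul_eq_mul]

/-- The indicator of `[j/n, (j+1)/n)`. -/
def stepInd (n j : ℕ) (s : ℝ) : ℝ := if ⌊n * s⌋₊ = j then 1 else 0

lemma measurable_stepInd (n j : ℕ) : Measurable (stepInd n j) := by
  refine Measurable.ite ?_ measurable_const measurable_const
  exact (Nat.measurable_floor.comp (measurable_const_mul (n : ℝ))) (measurableSet_singleton j)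

lemma memLp_stepInd (n j : ℕ) : MemLp (stepInd n j) 2 vol01 :=
  memLp_of_bounded (measurable_stepInd n j).aestronglyMeasurable 1
    (ae_of_all _ fun x => by unfold stepInd; split_ifs <;> simp)

lemma sum_stepInd_smul {E : Type*} [AddCommGroup E] [Module ℝ E] (x : ℝ → E) {n : ℕ} (hn : 0 < n)
    {s : ℝ} (hs : s ∈ Ioo (0 : ℝ) 1) :
    ∑ j ∈ Finset.range n, stepInd n j s • x (j / n) = x (⌊n * s⌋₊ / n) := by
  have hn' : (0 : ℝ) < n := by exact_mod_cast hn
  have h1 : ⌊n * s⌋₊ ∈ Finset.range n := by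
    rw [Finset.mem_range, Nat.floor_lt (by nlinarith [hs.1])]
    nlinarith [hs.2]
  rw [Finset.sum_eq_single_of_mem _ h1 fun j _ hj => by simp [stepInd, hj.symm]]
  simp [stepInd]

lemma floor_div_mem {n : ℕ} (hn : 0 < n) {s : ℝ} (hs : s ∈ Ioo (0 : ℝ) 1) :
    (⌊n * s⌋₊ : ℝ) / n ∈ Icc (0 : ℝ) 1 := by
  have hn' : (0 : ℝ) < n := by exact_mod_cast hn
  refine ⟨by positivity, ?_⟩
  rw [div_le_one hn']
  exact (Nat.floor_le (by nlinarith [hs.1])).trans (by nlinarith [hs.2])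

lemma tendsto_floor_div {s : ℝ} (hs : s ∈ Ioo (0 : ℝ) 1) :
    Tendsto (fun n : ℕ => (⌊(n : ℝ) * s⌋₊ : ℝ) / n) atTop (𝓝[Icc 0 1] s) := by
  refine tendsto_nhdsWithin_iff.2 ⟨?_, ?_⟩
  · have h := (tendsto_nat_floor_mul_div_atTop (R := ℝ) hs.1.le).comp tendsto_natCast_atTop_atTop
    refine h.congr fun n => ?_
    simp [mul_comm]
  · filter_upwards [eventually_gt_atTop 0] with n hn using floor_div_mem hn hs

/-- The step function approximation of `∫ l(s) b_s ds` -/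
lemma tendsto_sum_bridgeVec (l : H) :
    Tendsto (fun n : ℕ => ∑ j ∈ Finset.range n, ⟪toH (stepInd n j), l⟫_ℝ • bridgeVec (j / n)) atTop
      (𝓝 (bridgeOp l)) := by
  have hi : ∀ n j, Integrable (fun s => stepInd n j s * l s) vol01 := fun n j =>
    (coeFn_integrable l).bdd_mul (c := 1) (measurable_stepInd n j).aestronglyMeasurable
      (ae_of_all _ fun s => by unfold stepInd; split_ifs <;> simp)
  have h1 : ∀ n, ∑ j ∈ Finset.range n, ⟪toH (stepInd n j), l⟫_ℝ • bridgeVec (j / n) =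
      ∫ s in Ioo (0 : ℝ) 1, ∑ j ∈ Finset.range n, (stepInd n j s * l s) • bridgeVec (j / n) := by
    intro n
    rw [integral_finsetSum _ fun j _ => (hi n j).smul_const _]
    refine Finset.sum_congr rfl fun j _ => ?_
    rw [integral_smul_const, inner_toH_left (memLp_stepInd n j)]
  simp_rw [h1]
  have h2 : ∀ n : ℕ, 0 < n → ∀ s ∈ Ioo (0 : ℝ) 1,
      ∑ j ∈ Finset.range n, (stepInd n j s * l s) • bridgeVec (j / n) =
        l s • bridgeVec (⌊n * s⌋₊ / n) := by
    intro n hn s hs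
    rw [← sum_stepInd_smul bridgeVec hn hs, Finset.smul_sum]
    refine Finset.sum_congr rfl fun j _ => ?_
    rw [mul_comm, mul_smul]
  refine tendsto_integral_filter_of_dominated_convergence (fun s => ‖l s‖) ?_ ?_
    (coeFn_integrable l).norm ?_
  · exact Eventually.of_forall fun n =>
      (integrable_finsetSum _ fun j _ => (hi n j).smul_const _).1
  · filter_upwards [eventually_gt_atTop 0] with n hn
    filter_upwards [ae_restrict_mem measurableSet_Ioo] with s hs
    rw [h2 n hn s hs, norm_smul]
    exact mul_le_of_le_one_right (norm_nonneg _) (norm_bridgeVec_le (floor_div_mem hn hs))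
  · filter_upwards [ae_restrict_mem measurableSet_Ioo] with s hs
    have h3 := (continuousOn_bridgeVec s (Ioo_subset_Icc_self hs)).tendsto.comp (tendsto_floor_div hs)
    refine (h3.const_smul (l s)).congr' ?_
    filter_upwards [eventually_gt_atTop 0] with n hn
    rw [h2 n hn s hs]; rfl

/-- A continuous path is approximated in H by step functions built from finitely many of its values.
This reduces the law on H to the finite-dimensional laws. -/
lemma tendsto_sum_smul_toH_stepInd {b : ℝ → ℝ} (hb : ContinuousOn b (Icc 0 1)) :
    Tendsto (fun n : ℕ => ∑ j ∈ Finset.range n, b (j / n) • toH (stepInd n j)) atTop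
      (𝓝 (toH b)) := by
  obtain ⟨C, hC⟩ := isCompact_Icc.exists_bound_of_continuousOn hb
  have hbm : AEStronglyMeasurable b vol01 :=
    (hb.mono Ioo_subset_Icc_self).aestronglyMeasurable measurableSet_Ioo
  have hbL : MemLp b 2 vol01 := memLp_of_bounded hbm C (by
    filter_upwards [ae_restrict_mem measurableSet_Ioo] with s hs using hC s (Ioo_subset_Icc_self hs))
  rw [Lp.tendsto_Lp_iff_tendsto_eLpNorm']
  have key := tendsto_eLpNorm_of_bounded (μ := vol01) (l := atTop)
    (F := fun (n : ℕ) s => b (⌊n * s⌋₊ / n)) (G := b) (C + C) ?_ hbm ?_ ?_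
  · refine key.congr' ?_
    filter_upwards [eventually_gt_atTop 0] with n hn
    refine eLpNorm_congr_ae ?_
    filter_upwards [coeFn_sum_smul_toH (Finset.range n) (fun j => b (j / n)) (stepInd n)
      (memLp_stepInd n), coeFn_toH hbL, Lp.coeFn_sub (∑ j ∈ Finset.range n, b (j / n) • toH (stepInd n j)) (toH b),
      ae_restrict_mem measurableSet_Ioo] with s h1 h2 h3 hs
    rw [Pi.sub_apply, h1, h2, ← sum_stepInd_smul b hn hs]
    simp only [smul_eq_mul, mul_comm]
  · filter_upwards [eventually_gt_atTop 0] with n hn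
    have h1 : Measurable fun s => ∑ j ∈ Finset.range n, stepInd n j s • b (j / n) :=
      Finset.measurable_sum _ fun j _ => (measurable_stepInd n j).smul_const _
    refine h1.aestronglyMeasurable.congr ?_
    filter_upwards [ae_restrict_mem measurableSet_Ioo] with s hs
    rw [sum_stepInd_smul b hn hs]
  · filter_upwards [eventually_gt_atTop 0] with n hn
    filter_upwards [ae_restrict_mem measurableSet_Ioo] with s hs
    exact (norm_sub_le _ _).trans
      (add_le_add (hC _ (floor_div_mem hn hs)) (hC _ (Ioo_subset_Icc_self hs)))
  · filter_upwards [ae_restrict_mem measurableSet_Ioo] with s hs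
    exact (hb s (Ioo_subset_Icc_self hs)).tendsto.comp (tendsto_floor_div hs)

section Bridge

variable {Ω : Type*} [MeasurableSpace Ω] {P : Measure Ω} {β : ℝ → Ω → ℝ}

lemma div_mem_Icc {n j : ℕ} (hj : j < n) : (j / n : ℝ) ∈ Icc (0 : ℝ) 1 := by
  have hn : (0 : ℝ) < n := by exact_mod_cast (Nat.zero_le j).trans_lt hj
  exact ⟨by positivity, (div_le_one hn).2 (by exact_mod_cast hj.le)⟩

/-- The characteristic function of a linear combination of values of the bridge. -/
lemma IsBrownianBridge.integral_exp_sum [IsProbabilityMeasure P] (hβ : IsBrownianBridge P β) (n : ℕ) (a : ℕ → ℝ) :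
    ∫ ω, Complex.exp (((∑ j ∈ Finset.range n, a j * β (j / n) ω : ℝ) : ℂ) * Complex.I) ∂P =
      Complex.exp (-(((‖∑ j ∈ Finset.range n, a j • bridgeVec (j / n)‖ ^ 2 : ℝ) : ℂ) / 2)) := by
  let τ : Fin n → Icc (0 : ℝ) 1 := fun j => ⟨(j : ℕ) / n, div_mem_Icc j.2⟩
  have hG : IsGaussianProcess (fun (j : Fin n) ω => a j • β ((j : ℕ) / n) ω) P :=
    IsGaussianProcess.smul (X := fun (j : Fin n) ω => β ((j : ℕ) / n) ω) (fun j => a j)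
      (hβ.gaussian.comp_right τ)
  have hX : HasGaussianLaw (fun ω => ∑ j : Fin n, a j • β ((j : ℕ) / n) ω) P :=
    hG.hasGaussianLaw_fun_sum (I := Finset.univ)
  have hmem : ∀ j : Fin n, MemLp (fun ω => a j • β ((j : ℕ) / n) ω) 2 P :=
    fun j => (hG.hasGaussianLaw_eval j).memLp_two
  have hmean : ∫ ω, ∑ j : Fin n, a j • β ((j : ℕ) / n) ω ∂P = 0 := by
    rw [integral_finsetSum _ fun j _ => (hmem j).integrable (by norm_num)]
    refine Finset.sum_eq_zero fun j _ => ?_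
    rw [integral_smul, hβ.mean _ (div_mem_Icc j.2), smul_zero]
  have hvar : Var[fun ω => ∑ j : Fin n, a j • β ((j : ℕ) / n) ω; P] =
      ‖∑ j ∈ Finset.range n, a j • bridgeVec (j / n)‖ ^ 2 := by
    rw [variance_fun_sum hmem, ← Fin.sum_univ_eq_sum_range (fun j => a j • bridgeVec (j / n)),
      ← real_inner_self_eq_norm_sq, sum_inner]
    refine Finset.sum_congr rfl fun i _ => ?_
    rw [inner_sum]
    refine Finset.sum_congr rfl fun j _ => ?_
    simp only [smul_eq_mul]
    rw [covariance_const_mul_left, covariance_const_mul_right,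
      hβ.cov _ (div_mem_Icc i.2) _ (div_mem_Icc j.2), inner_smul_left, inner_smul_right,
      inner_bridgeVec (div_mem_Icc i.2) (div_mem_Icc j.2)]
    simp
  have hmap := hX.map_eq_gaussianReal
  rw [hmean, hvar] at hmap
  have hch := charFun_gaussianReal (μ := 0)
    (v := (‖∑ j ∈ Finset.range n, a j • bridgeVec (j / n)‖ ^ 2).toNNReal) 1
  rw [← hmap, charFun_apply_real, integral_map hX.aemeasurable (by fun_prop)] at hch
  simp only [smul_eq_mul] at hch
  simp_rw [← Fin.sum_univ_eq_sum_range (fun j => a j * β (j / n) _)]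
  convert hch using 2
  · simp
  · rw [Real.coe_toNNReal _ (sq_nonneg _)]
    simp

lemma IsBrownianBridge.aemeasurable_apply (hβ : IsBrownianBridge P β) {t : ℝ}
    (ht : t ∈ Icc (0 : ℝ) 1) : AEMeasurable (β t) P :=
  hβ.gaussian.aemeasurable ⟨t, ht⟩

lemma IsBrownianBridge.ae_tendsto (hβ : IsBrownianBridge P β) :
    ∀ᵐ ω ∂P, Tendsto (fun n : ℕ => ∑ j ∈ Finset.range n, β (j / n) ω • toH (stepInd n j)) atTop
      (𝓝 (toH fun x => β x ω)) := by
  filter_upwards [hβ.continuous] with ω hω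
  exact tendsto_sum_smul_toH_stepInd hω

lemma IsBrownianBridge.aemeasurable_step (hβ : IsBrownianBridge P β) (n : ℕ) :
    AEMeasurable (fun ω => ∑ j ∈ Finset.range n, β (j / n) ω • toH (stepInd n j)) P :=
  Finset.aemeasurable_fun_sum _ fun _ hj =>
    (hβ.aemeasurable_apply (div_mem_Icc (Finset.mem_range.1 hj))).smul_const _

/-- Without measurability the image measure in `lawOnH` would be the zero measure. -/
lemma IsBrownianBridge.aemeasurable_toH (hβ : IsBrownianBridge P β) :
    AEMeasurable (fun ω => toH fun x => β x ω) P :=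
  aemeasurable_of_tendsto_metrizable_ae atTop hβ.aemeasurable_step hβ.ae_tendsto

variable [IsProbabilityMeasure P]

lemma IsBrownianBridge.isProbabilityMeasure_lawOnH (hβ : IsBrownianBridge P β) :
    IsProbabilityMeasure (lawOnH P β) :=
  Measure.isProbabilityMeasure_map hβ.aemeasurable_toH

/-- The step approximations of the path are finite Gaussian sums with the variances given by the
Gram matrix of `bridgeVec`. Both sides pass to the limit, the left by bounded convergence and the
right by continuity of the norm. -/
lemma IsBrownianBridge.charFun_lawOnH (hβ : IsBrownianBridge P β) (l : H) :
    charFun (lawOnH P β) l = Complex.exp (-(((‖bridgeOp l‖ ^ 2 : ℝ) : ℂ) / 2)) := by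
  rw [charFun_apply, lawOnH, integral_map hβ.aemeasurable_toH (by fun_prop)]
  have h1 : Tendsto (fun n : ℕ => ∫ ω, Complex.exp ((⟪∑ j ∈ Finset.range n, β (j / n) ω •
      toH (stepInd n j), l⟫_ℝ : ℂ) * Complex.I) ∂P) atTop
      (𝓝 (∫ ω, Complex.exp ((⟪toH fun x => β x ω, l⟫_ℝ : ℂ) * Complex.I) ∂P)) := by
    refine tendsto_integral_of_dominated_convergence (fun _ => 1) ?_ (integrable_const _) ?_ ?_
    · intro n
      have hc : Continuous fun z : H => Complex.exp ((⟪z, l⟫_ℝ : ℂ) * Complex.I) := by fun_prop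
      exact (hc.measurable.comp_aemeasurable (hβ.aemeasurable_step n)).aestronglyMeasurable
    · exact fun n => ae_of_all _ fun ω => by rw [Complex.norm_exp_ofReal_mul_I]
    · filter_upwards [hβ.ae_tendsto] with ω hω
      have hc : Continuous fun z : H => Complex.exp ((⟪z, l⟫_ℝ : ℂ) * Complex.I) := by fun_prop
      exact (hc.tendsto _).comp hω
  have h2 : ∀ n : ℕ, ∫ ω, Complex.exp ((⟪∑ j ∈ Finset.range n, β (j / n) ω •
      toH (stepInd n j), l⟫_ℝ : ℂ) * Complex.I) ∂P = Complex.exp (-(((‖∑ j ∈ Finset.range n,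
        ⟪toH (stepInd n j), l⟫_ℝ • bridgeVec (j / n)‖ ^ 2 : ℝ) : ℂ) / 2)) := by
    intro n
    rw [← hβ.integral_exp_sum n fun j => ⟪toH (stepInd n j), l⟫_ℝ]
    congr 1 with ω
    rw [sum_inner]
    congr 4 with j
    rw [inner_smul_left, mul_comm]; rfl
  simp_rw [h2] at h1
  refine tendsto_nhds_unique h1 ?_
  have hc : Continuous fun z : H => Complex.exp (-(((‖z‖ ^ 2 : ℝ) : ℂ) / 2)) := by fun_prop
  exact (hc.tendsto _).comp (tendsto_sum_bridgeVec l)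

end Bridge

end

/-! ### Coordinates and integration by parts under the law of the bridge. -/

section

/-- `μ` is the law of the Brownian bridge, in terms of its characteristic function. -/
structure IsBridgeLaw (μ : Measure H) : Prop where
  isProbabilityMeasure : IsProbabilityMeasure μ
  charFun_eq : ∀ l, charFun μ l = Complex.exp (-(((‖bridgeOp l‖ ^ 2 : ℝ) : ℂ) / 2))

/-- The variance of the `k`-th coordinate of the bridge. -/
def coordVar (k : ℕ) : ℝ := 1 / eigval (k + 1)

lemma coordVar_pos (k : ℕ) : 0 < coordVar k := one_div_pos.2 (eigval_pos k)

/-- The law of the `k`-th coordinate of the bridge. -/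
abbrev coordLaw (k : ℕ) : Measure ℝ := gaussianReal 0 (coordVar k).toNNReal

/-- The point with the `k`-th coordinate of `z` replaced by `x`. -/
def replaceCoord (k : ℕ) (x : ℝ) (z : H) : H := x • eH k + (z - ⟪eH k, z⟫_ℝ • eH k)

lemma continuous_replaceCoord (k : ℕ) :
    Continuous fun p : ℝ × H => replaceCoord k p.1 p.2 := by
  unfold replaceCoord; fun_prop

lemma inner_eH_replaceCoord (k : ℕ) (x : ℝ) (z : H) : ⟪eH k, replaceCoord k x z⟫_ℝ = x := by
  simp [replaceCoord, inner_add_right, inner_sub_right, inner_smul_right]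

/-- Pythagoras: l minus its component along e_k has an image orthogonal to that of e_k.
Exponentiated, this factorizes the characteristic function, which is the independence of the k-th
coordinate from the others. -/
lemma norm_bridgeOp_sq (k : ℕ) (l : H) :
    ‖bridgeOp l‖ ^ 2 = coordVar k * ⟪eH k, l⟫_ℝ ^ 2 + ‖bridgeOp (l - ⟪eH k, l⟫_ℝ • eH k)‖ ^ 2 := by
  set c := ⟪eH k, l⟫_ℝ with hc
  set m := l - c • eH k with hm
  have hl : l = c • eH k + m := by rw [hm]; abel
  have h1 : ⟪eH k, m⟫_ℝ = 0 := by
    rw [hm, inner_sub_right, inner_smul_right, inner_eH_eH]; simp [hc]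
  have h2 : ⟪bridgeOp (eH k), bridgeOp m⟫_ℝ = 0 := by rw [inner_bridgeOp_eH, h1, zero_div]
  have h3 : ‖bridgeOp (eH k)‖ ^ 2 = coordVar k := by
    rw [← real_inner_self_eq_norm_sq, inner_bridgeOp_eH, inner_eH_eH, if_pos rfl, coordVar]
  rw [hl, bridgeOp_add, bridgeOp_smul, norm_add_sq_real, norm_smul, mul_pow, h3, inner_smul_left, h2]
  simp [mul_comm]

variable {μ : Measure H}

/-- The `k`-th coordinate is independent of the other ones under the law of the bridge. -/
lemma IsBridgeLaw.map_replaceCoord (hμ : IsBridgeLaw μ) (k : ℕ) :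
    ((coordLaw k).prod μ).map (fun p => replaceCoord k p.1 p.2) = μ := by
  have := hμ.isProbabilityMeasure
  have hm := (continuous_replaceCoord k).measurable
  have : IsProbabilityMeasure (((coordLaw k).prod μ).map (fun p => replaceCoord k p.1 p.2)) :=
    Measure.isProbabilityMeasure_map hm.aemeasurable
  refine Measure.ext_of_charFun (funext fun l => ?_)
  rw [charFun_apply, integral_map hm.aemeasurable (by fun_prop)]
  have h1 : ∀ p : ℝ × H, Complex.exp ((⟪replaceCoord k p.1 p.2, l⟫_ℝ : ℂ) * Complex.I) =
      Complex.exp ((⟪eH k, l⟫_ℝ : ℂ) * p.1 * Complex.I) *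
        Complex.exp ((⟪p.2, l - ⟪eH k, l⟫_ℝ • eH k⟫_ℝ : ℂ) * Complex.I) := by
    intro p
    rw [← Complex.exp_add, ← add_mul]
    congr 2
    rw [replaceCoord, inner_add_left, inner_smul_left, inner_sub_left, inner_smul_left,
      inner_sub_right, inner_smul_right, real_inner_comm (eH k) p.2]
    simp
    ring
  simp_rw [h1]
  rw [integral_prod_mul (μ := coordLaw k) (ν := μ)
    (fun x : ℝ => Complex.exp ((⟪eH k, l⟫_ℝ : ℂ) * x * Complex.I))
    (fun z : H => Complex.exp ((⟪z, l - ⟪eH k, l⟫_ℝ • eH k⟫_ℝ : ℂ) * Complex.I)),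
    ← charFun_apply_real, ← charFun_apply, charFun_gaussianReal, hμ.charFun_eq, hμ.charFun_eq,
    ← Complex.exp_add, norm_bridgeOp_sq k l, Real.coe_toNNReal _ (coordVar_pos k).le]
  congr 1
  push_cast
  ring

lemma IsBridgeLaw.integral_eq (hμ : IsBridgeLaw μ) (k : ℕ) {f : H → ℝ} (hf : Integrable f μ) :
    ∫ z, f z ∂μ = ∫ w, ∫ x, f (replaceCoord k x w) ∂(coordLaw k) ∂μ := by
  have := hμ.isProbabilityMeasure
  have hm := (continuous_replaceCoord k).measurable
  have hf2 := hf
  rw [← hμ.map_replaceCoord k] at hf2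
  conv_lhs => rw [← hμ.map_replaceCoord k]
  rw [integral_map hm.aemeasurable hf2.1, integral_prod_symm]
  exact hf2.comp_measurable hm

lemma IsBridgeLaw.lintegral_eq (hμ : IsBridgeLaw μ) (k : ℕ) {f : H → ENNReal} (hf : Measurable f) :
    ∫⁻ z, f z ∂μ = ∫⁻ w, ∫⁻ x, f (replaceCoord k x w) ∂(coordLaw k) ∂μ := by
  have := hμ.isProbabilityMeasure
  have hm := (continuous_replaceCoord k).measurable
  conv_lhs => rw [← hμ.map_replaceCoord k]
  rw [lintegral_map hf hm, lintegral_prod_symm (fun p : ℝ × H => f (replaceCoord k p.1 p.2)) (hf.comp hm).aemeasurable]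

lemma IsBridgeLaw.memLp_inner_eH (hμ : IsBridgeLaw μ) (k : ℕ) :
    MemLp (fun z => ⟪eH k, z⟫_ℝ) 2 μ := by
  have := hμ.isProbabilityMeasure
  have hm := (continuous_replaceCoord k).measurable
  rw [← hμ.map_replaceCoord k, memLp_map_measure_iff (by fun_prop) hm.aemeasurable]
  have h1 : (fun z => ⟪eH k, z⟫_ℝ) ∘ (fun p : ℝ × H => replaceCoord k p.1 p.2) = fun p => p.1 := by
    ext p; exact inner_eH_replaceCoord k p.1 p.2
  rw [h1]
  exact (memLp_id_gaussianReal' 2 (by simp)).comp_fst μ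

lemma integrable_gaussKer₁ {q : ℝ} (hq : 0 < q) : Integrable (gaussKer₁ q) := by
  have h2 : 0 < √q := Real.sqrt_pos.2 hq
  have h : Integrable fun x => -x * gaussDens x := by
    refine ((integrable_exp_neg_mul_sq (b := 1 / 4) (by norm_num))).mono'
      (by fun_prop) (ae_of_all _ fun x => ?_)
    refine le_trans ?_ (gaussDens_le x)
    rw [norm_mul, norm_neg, Real.norm_of_nonneg (gaussDens_nonneg x), Real.norm_eq_abs]
    refine mul_le_mul_of_nonneg_right ?_ (gaussDens_nonneg x)
    nlinarith [sq_nonneg (|x| / 2 - 1), sq_abs x, sq_nonneg (x ^ 2)]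
  exact (h.comp_div h2.ne').const_mul (1 / q)

lemma gaussKer₁_eq {q : ℝ} (hq : 0 < q) (x : ℝ) : gaussKer₁ q x = -(x / q * gaussKer₀ q x) := by
  have h2 : 0 < √q := Real.sqrt_pos.2 hq
  rw [gaussKer₁, gaussKer₀]
  field_simp

lemma integrable_gaussKer₀ {q : ℝ} (hq : 0 < q) : Integrable (gaussKer₀ q) := by
  refine (integrable_gaussianPDFReal 0 q.toNNReal).congr (ae_of_all _ fun x => gaussianPDFReal_eq hq x)

/-- Stein's lemma. -/
lemma integral_deriv_gaussianReal {q : ℝ} (hq : 0 < q) {F F' : ℝ → ℝ}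
    (hF : ∀ x, HasDerivAt F (F' x) x) (hF'm : Measurable F') {C : ℝ} (hC : ∀ x, |F x| ≤ C)
    (hC' : ∀ x, |F' x| ≤ C) :
    ∫ x, F' x ∂(gaussianReal 0 q.toNNReal) = ∫ x, F x * (x / q) ∂(gaussianReal 0 q.toNNReal) := by
  have hq' : q.toNNReal ≠ 0 := by simpa using hq
  have hFc : Continuous F := continuous_iff_continuousAt.2 fun x => (hF x).continuousAt
  rw [integral_gaussianReal_eq_integral_smul hq', integral_gaussianReal_eq_integral_smul hq']
  simp_rw [gaussianPDFReal_eq hq, smul_eq_mul]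
  have i1 : Integrable (F * gaussKer₁ q) :=
    (integrable_gaussKer₁ hq).bdd_mul hFc.aestronglyMeasurable (ae_of_all _ hC)
  have i2 : Integrable (F' * gaussKer₀ q) :=
    (integrable_gaussKer₀ hq).bdd_mul hF'm.aestronglyMeasurable (ae_of_all _ hC')
  have i3 : Integrable (F * gaussKer₀ q) :=
    (integrable_gaussKer₀ hq).bdd_mul hFc.aestronglyMeasurable (ae_of_all _ hC)
  have h := integral_mul_deriv_eq_deriv_mul_of_integrable (fun x _ => hF x)
    (fun x _ => hasDerivAt_gaussKer₀ hq x) i1 i2 i3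
  simp_rw [mul_comm (gaussKer₀ q _) (F' _)]
  rw [← neg_eq_iff_eq_neg.2 h, ← integral_neg]
  congr 1 with x
  rw [gaussKer₁_eq hq]
  ring

/-- Integration by parts for the law of the bridge. -/
lemma IsBridgeLaw.integral_lineDeriv (hμ : IsBridgeLaw μ) (k : ℕ) {f f' : H → ℝ}
    (hf : ∀ (z : H) (x : ℝ), HasDerivAt (fun x : ℝ => f (z + x • eH k)) (f' (z + x • eH k)) x)
    (hfm : Measurable f) (hfm' : Measurable f') {C : ℝ} (hC : ∀ z, |f z| ≤ C)
    (hC' : ∀ z, |f' z| ≤ C) :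
    ∫ z, f' z ∂μ = ∫ z, f z * (eigval (k + 1) * ⟪eH k, z⟫_ℝ) ∂μ := by
  have := hμ.isProbabilityMeasure
  have i1 : Integrable f' μ :=
    (integrable_const C).mono' hfm'.aestronglyMeasurable (ae_of_all _ hC')
  have i2 : Integrable (fun z => f z * (eigval (k + 1) * ⟪eH k, z⟫_ℝ)) μ :=
    (((hμ.memLp_inner_eH k).integrable (by norm_num)).const_mul _).bdd_mul
      hfm.aestronglyMeasurable (ae_of_all _ hC)
  rw [hμ.integral_eq k i1, hμ.integral_eq k i2]
  congr 1 with w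
  have h1 : ∀ x, replaceCoord k x w = (w - ⟪eH k, w⟫_ℝ • eH k) + x • eH k := fun x => add_comm _ _
  have h2 := integral_deriv_gaussianReal (coordVar_pos k)
    (F := fun x => f (replaceCoord k x w)) (F' := fun x => f' (replaceCoord k x w)) (C := C)
    (fun x => by simp_rw [h1]; exact hf _ x)
    (hfm'.comp ((continuous_replaceCoord k).comp (by fun_prop : Continuous fun x : ℝ => (x, w))).measurable)
    (fun x => hC _) (fun x => hC' _)
  rw [h2]
  congr 1 with x
  rw [inner_eH_replaceCoord, coordVar]
  field_simp

lemma gaussKer₀_le {q : ℝ} (x : ℝ) : gaussKer₀ q x ≤ 1 / √q := by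
  rw [gaussKer₀]
  refine mul_le_of_le_one_right (by positivity) ?_
  unfold gaussDens
  refine mul_le_one₀ inv_sqrt_two_pi_le (Real.exp_nonneg _) ?_
  rw [Real.exp_le_one_iff]
  nlinarith [sq_nonneg (x / √q)]

lemma lintegral_comp_affine {g : ℝ → ENNReal} (hg : Measurable g) {a : ℝ} (ha : a ≠ 0) (b : ℝ) :
    ∫⁻ x, g (x * a + b) = ENNReal.ofReal |a⁻¹| * ∫⁻ x, g x := by
  have h1 : ∫⁻ x, g (x * a + b) = ∫⁻ y, g (y + b) ∂(Measure.map (· * a) volume) := by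
    rw [lintegral_map (by fun_prop) (by fun_prop)]
  rw [h1, Real.map_volume_mul_right ha, lintegral_smul_measure,
    lintegral_add_right_eq_self (fun y => g y) b]
  rfl

/-- A bound for the law of a linear functional under the law of the bridge. -/
lemma IsBridgeLaw.lintegral_inner_le (hμ : IsBridgeLaw μ) (k : ℕ) {l : H}
    (hl : ⟪eH k, l⟫_ℝ ≠ 0) {g : ℝ → ENNReal} (hg : Measurable g) :
    ∫⁻ z, g ⟪l, z⟫_ℝ ∂μ ≤
      ENNReal.ofReal (1 / √(coordVar k)) * ENNReal.ofReal |(⟪eH k, l⟫_ℝ)⁻¹| * ∫⁻ x, g x := by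
  have := hμ.isProbabilityMeasure
  rw [hμ.lintegral_eq k (by fun_prop)]
  -- With the other coordinates frozen, ⟨l, ·⟩ is affine in the k-th one with slope ⟨e_k, l⟩.
  -- Bounding the Gaussian density of that coordinate by its maximum leaves a Lebesgue integral.
  have h1 : ∀ w, ∫⁻ x, g ⟪l, replaceCoord k x w⟫_ℝ ∂(coordLaw k) ≤
      ENNReal.ofReal (1 / √(coordVar k)) * (ENNReal.ofReal |(⟪eH k, l⟫_ℝ)⁻¹| * ∫⁻ x, g x) := by
    intro w
    have hq' : (coordVar k).toNNReal ≠ 0 := by simpa using coordVar_pos k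
    have h2 : ∀ x, ⟪l, replaceCoord k x w⟫_ℝ =
        x * ⟪eH k, l⟫_ℝ + ⟪l, w - ⟪eH k, w⟫_ℝ • eH k⟫_ℝ := by
      intro x
      rw [replaceCoord, inner_add_right, inner_smul_right, real_inner_comm l]
    simp_rw [h2]
    rw [coordLaw, gaussianReal_of_var_ne_zero _ hq',
      lintegral_withDensity_eq_lintegral_mul _ (measurable_gaussianPDF _ _) (by fun_prop),
      ← lintegral_comp_affine hg hl ⟪l, w - ⟪eH k, w⟫_ℝ • eH k⟫_ℝ, ← lintegral_const_mul _ (by fun_prop)]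
    refine lintegral_mono fun x => ?_
    rw [Pi.mul_apply]
    refine mul_le_mul_left ?_ _
    rw [gaussianPDF, gaussianPDFReal_eq (coordVar_pos k)]
    exact ENNReal.ofReal_le_ofReal (gaussKer₀_le x)
  refine (lintegral_mono h1).trans ?_
  rw [lintegral_const, measure_univ, mul_one, mul_assoc]

end

section

/-! ### Cylindrical functionals -/

/-- The span of the sine functions. -/
abbrev sineSpan : Submodule ℝ H := Submodule.span ℝ (range eH)

/-- The map `z ↦ (⟨l_i, z⟩)_i`. -/
def innerMap {m : ℕ} (l : Fin m → H) : H →L[ℝ] (Fin m → ℝ) :=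
  ContinuousLinearMap.pi fun i => innerSL ℝ (l i)

lemma innerMap_apply {m : ℕ} (l : Fin m → H) (z : H) : innerMap l z = fun i => ⟪l i, z⟫_ℝ := rfl

lemma gradient_eq (F : H → ℝ) (z : H) :
    gradient F z = (InnerProductSpace.toDual ℝ H).symm (fderiv ℝ F z) := rfl

lemma inner_gradient (F : H → ℝ) (z w : H) : ⟪gradient F z, w⟫_ℝ = fderiv ℝ F z w := by
  rw [gradient_eq, InnerProductSpace.toDual_symm_apply]

lemma norm_gradient (F : H → ℝ) (z : H) : ‖gradient F z‖ = ‖fderiv ℝ F z‖ := by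
  rw [gradient_eq, LinearIsometryEquiv.norm_map]

lemma continuous_gradient {F : H → ℝ} (hF : ContDiff ℝ 1 F) : Continuous (gradient F) :=
  (InnerProductSpace.toDual ℝ H).symm.continuous.comp (hF.continuous_fderiv (by simp))

lemma IsCylindrical.contDiff {φ : H → ℝ} (hφ : IsCylindrical φ) : ContDiff ℝ 1 φ := by
  obtain ⟨m, ψ, l, hψ, -, -, h⟩ := hφ
  have h2 : φ = ψ ∘ innerMap l := funext h
  rw [h2]
  exact (hψ.of_le (ENat.natCast_le_of_coe_top_le_withTop le_rfl 1)).comp (innerMap l).contDiff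

lemma IsCylindrical.exists_bound {φ : H → ℝ} (hφ : IsCylindrical φ) :
    ∃ C, (∀ z, |φ z| ≤ C) ∧ ∀ z, ‖gradient φ z‖ ≤ C := by
  obtain ⟨m, ψ, l, hψ, hb, -, h⟩ := hφ
  obtain ⟨C₀, h0⟩ := hb 0
  obtain ⟨C₁, h1⟩ := hb 1
  have h2 : φ = ψ ∘ innerMap l := funext h
  refine ⟨max C₀ (C₁ * ‖innerMap l‖), fun z => ?_, fun z => ?_⟩
  · refine le_max_of_le_left ?_
    have := h0 (innerMap l z)
    rw [norm_iteratedFDeriv_zero, Real.norm_eq_abs] at this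
    rwa [h2]
  · refine le_max_of_le_right ?_
    rw [norm_gradient, h2, fderiv_comp _ (hψ.differentiable (by simp) _)
      (innerMap l).differentiableAt, ContinuousLinearMap.fderiv]
    refine (ContinuousLinearMap.opNorm_comp_le _ _).trans ?_
    refine mul_le_mul_of_nonneg_right ?_ (norm_nonneg _)
    have := h1 (innerMap l z)
    rwa [norm_iteratedFDeriv_one] at this

/-- The gradient is a combination of the l_i. Consequently limits of such gradients stay in the
closed sine span, where testing against the e_k determines a vector. -/
lemma IsCylindrical.gradient_mem {φ : H → ℝ} (hφ : IsCylindrical φ) (z : H) :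
    gradient φ z ∈ sineSpan := by
  obtain ⟨m, ψ, l, hψ, -, hl, h⟩ := hφ
  have h2 : φ = ψ ∘ innerMap l := funext h
  have h3 : gradient φ z = ∑ i, fderiv ℝ ψ (innerMap l z) (Pi.single i 1) • l i := by
    refine ext_inner_right ℝ fun w => ?_
    rw [inner_gradient, h2, fderiv_comp _ (hψ.differentiable (by simp) _)
      (innerMap l).differentiableAt, ContinuousLinearMap.fderiv, ContinuousLinearMap.comp_apply,
      sum_inner]
    conv_lhs => rw [← Finset.univ_sum_single (innerMap l w), map_sum]
    refine Finset.sum_congr rfl fun i _ => ?_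
    have h4 : (Pi.single i (innerMap l w i) : Fin m → ℝ) = ⟪l i, w⟫_ℝ • Pi.single i (1 : ℝ) := by
      rw [← Pi.single_smul, smul_eq_mul, mul_one]
      rfl
    rw [h4, inner_smul_left, map_smul, smul_eq_mul, mul_comm]
    rfl
  rw [h3]
  exact Submodule.sum_mem _ fun i _ => Submodule.smul_mem _ _ (hl i)

variable {μ : Measure H}

lemma IsCylindrical.aestronglyMeasurable {φ : H → ℝ} (hφ : IsCylindrical φ) :
    AEStronglyMeasurable φ μ := hφ.contDiff.continuous.aestronglyMeasurable

lemma IsCylindrical.aestronglyMeasurable_gradient {φ : H → ℝ} (hφ : IsCylindrical φ) :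
    AEStronglyMeasurable (gradient φ) μ := (continuous_gradient hφ.contDiff).aestronglyMeasurable

lemma IsCylindrical.memLp [IsFiniteMeasure μ] {φ : H → ℝ} (hφ : IsCylindrical φ) : MemLp φ 2 μ := by
  obtain ⟨C, hC, -⟩ := hφ.exists_bound
  exact MemLp.of_bound hφ.aestronglyMeasurable C (ae_of_all _ hC)

lemma IsCylindrical.memLp_gradient [IsFiniteMeasure μ] {φ : H → ℝ} (hφ : IsCylindrical φ) :
    MemLp (gradient φ) 2 μ := by
  obtain ⟨C, -, hC⟩ := hφ.exists_bound
  exact MemLp.of_bound hφ.aestronglyMeasurable_gradient C (ae_of_all _ hC)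

/-! ### Uniqueness of the gradient -/

lemma tendsto_integral_mul_of_eLpNorm {α : Type*} [MeasurableSpace α] {μ : Measure α}
    {f : ℕ → α → ℝ} {g w : α → ℝ} (hf : ∀ n, MemLp (f n) 2 μ) (hg : MemLp g 2 μ)
    (hw : MemLp w 2 μ) (h : Tendsto (fun n => eLpNorm (fun x => f n x - g x) 2 μ) atTop (𝓝 0)) :
    Tendsto (fun n => ∫ x, f n x * w x ∂μ) atTop (𝓝 (∫ x, g x * w x ∂μ)) := by
  refine tendsto_integral_of_L1' (fun x => g x * w x) (hg.1.mul hw.1)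
    (Eventually.of_forall fun n => (hf n).integrable_mul hw) ?_
  have h1 := ENNReal.Tendsto.mul_const (b := eLpNorm w 2 μ) h (Or.inr hw.2.ne)
  rw [zero_mul] at h1
  refine tendsto_of_tendsto_of_tendsto_of_le_of_le tendsto_const_nhds h1 (fun n => zero_le)
    fun n => ?_
  have h2 := eLpNorm_smul_le_mul_eLpNorm (p := 2) (q := 2) (r := 1) hw.1 ((hf n).1.sub hg.1)
  refine le_trans (le_of_eq ?_) h2
  congr 1
  ext x
  simp [sub_mul]

/-- The finite measures with densities d⁺ and d⁻ have equal characteristic functions, so they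
coincide, and so do their densities almost everywhere. -/
lemma ae_eq_zero_of_integral_trig [IsFiniteMeasure μ] {d : H → ℝ} (hd : Integrable d μ)
    (hcos : ∀ l, ∫ z, Real.cos ⟪z, l⟫_ℝ * d z ∂μ = 0)
    (hsin : ∀ l, ∫ z, Real.sin ⟪z, l⟫_ℝ * d z ∂μ = 0) : d =ᵐ[μ] 0 := by
  have hlim : ∀ f : H → ℝ, Integrable f μ → ∫⁻ z, ENNReal.ofReal (f z) ∂μ ≠ ⊤ := fun f hf =>
    (lt_of_le_of_lt (lintegral_mono fun z => Real.ofReal_le_enorm _) hf.2).ne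
  wlog hm : Measurable d generalizing d
  · have h1 := hd.1.ae_eq_mk
    have h2 := this (d := hd.1.mk d) (hd.congr h1)
      (fun l => by
        rw [← hcos l]
        refine integral_congr_ae ?_
        filter_upwards [h1] with z hz
        rw [hz])
      (fun l => by
        rw [← hsin l]
        refine integral_congr_ae ?_
        filter_upwards [h1] with z hz
        rw [hz]) hd.1.stronglyMeasurable_mk.measurable
    exact h1.trans h2
  have hmn : Measurable fun z => -d z := hm.neg
  have hp := hlim d hd
  have hn := hlim (fun z => -d z) hd.neg
  have : IsFiniteMeasure (μ.withDensity fun z => ENNReal.ofReal (d z)) := isFiniteMeasure_withDensity hp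
  have : IsFiniteMeasure (μ.withDensity fun z => ENNReal.ofReal (-d z)) := isFiniteMeasure_withDensity hn
  have hchar : charFun (μ.withDensity fun z => ENNReal.ofReal (d z)) =
      charFun (μ.withDensity fun z => ENNReal.ofReal (-d z)) := by
    ext l
    have hmeas : AEStronglyMeasurable (fun z : H => Complex.exp ((⟪z, l⟫_ℝ : ℂ) * Complex.I)) μ :=
      Continuous.aestronglyMeasurable (by fun_prop)
    have hi : ∀ f : H → ℝ, Integrable f μ →
        Integrable (fun z => f z • Complex.exp ((⟪z, l⟫_ℝ : ℂ) * Complex.I)) μ := by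
      intro f hf
      refine hf.norm.mono' (hf.1.smul hmeas) (ae_of_all _ fun z => ?_)
      rw [norm_smul, Complex.norm_exp_ofReal_mul_I, mul_one]
    rw [charFun_apply, charFun_apply,
      integral_withDensity_eq_integral_toReal_smul hm.ennreal_ofReal (ae_of_all _ fun _ => ENNReal.ofReal_lt_top),
      integral_withDensity_eq_integral_toReal_smul hmn.ennreal_ofReal (ae_of_all _ fun _ => ENNReal.ofReal_lt_top),
      ← sub_eq_zero, ← integral_sub]
    · have h1 : ∀ z, (ENNReal.ofReal (d z)).toReal • Complex.exp ((⟪z, l⟫_ℝ : ℂ) * Complex.I)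
          - (ENNReal.ofReal (-d z)).toReal • Complex.exp ((⟪z, l⟫_ℝ : ℂ) * Complex.I) =
          ((Real.cos ⟪z, l⟫_ℝ * d z : ℝ) : ℂ) + ((Real.sin ⟪z, l⟫_ℝ * d z : ℝ) : ℂ) * Complex.I := by
        intro z
        rw [← sub_smul, ENNReal.toReal_ofReal', ENNReal.toReal_ofReal',
          max_zero_sub_max_neg_zero_eq_self, Complex.exp_mul_I, Complex.real_smul]
        push_cast
        ring
      simp_rw [h1]
      have hc : Integrable (fun z => Real.cos ⟪z, l⟫_ℝ * d z) μ :=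
        hd.bdd_mul (c := 1) (Continuous.aestronglyMeasurable (by fun_prop))
          (ae_of_all _ fun z => Real.abs_cos_le_one _)
      have hs : Integrable (fun z => Real.sin ⟪z, l⟫_ℝ * d z) μ :=
        hd.bdd_mul (c := 1) (Continuous.aestronglyMeasurable (by fun_prop))
          (ae_of_all _ fun z => Real.abs_sin_le_one _)
      rw [integral_add hc.ofReal (hs.ofReal.mul_const _), integral_mul_const, integral_complex_ofReal,
        integral_complex_ofReal, hcos, hsin]
      simp
    · exact hi _ (integrable_toReal_of_lintegral_ne_top hm.ennreal_ofReal.aemeasurable hp)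
    · exact hi _ (integrable_toReal_of_lintegral_ne_top hmn.ennreal_ofReal.aemeasurable hn)
  have heq := Measure.ext_of_charFun hchar
  rw [withDensity_eq_iff hm.ennreal_ofReal.aemeasurable hmn.ennreal_ofReal.aemeasurable hp] at heq
  filter_upwards [heq] with z hz
  rcases le_total (d z) 0 with h | h
  · rw [ENNReal.ofReal_of_nonpos h] at hz
    have := ENNReal.ofReal_eq_zero.1 hz.symm
    simp only [Pi.zero_apply]; linarith
  · rw [ENNReal.ofReal_of_nonpos (p := -d z) (by linarith)] at hz
    have := ENNReal.ofReal_eq_zero.1 hz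
    simp only [Pi.zero_apply]; linarith

/-- The weak characterization of the gradient of `F`, tested with `χ`. -/
lemma HasSobolevGradient.integral_mul (hμ : IsBridgeLaw μ) {F : H → ℝ} {g : H → H}
    (h : HasSobolevGradient μ F g) (k : ℕ) {χ χ' : H → ℝ}
    (hχ : ∀ (z : H) (x : ℝ), HasDerivAt (fun x : ℝ => χ (z + x • eH k)) (χ' (z + x • eH k)) x)
    (hχm : Measurable χ) (hχm' : Measurable χ') {C : ℝ} (hC : ∀ z, |χ z| ≤ C)
    (hC' : ∀ z, |χ' z| ≤ C) :
    ∫ z, χ z * ⟪g z, eH k⟫_ℝ ∂μ =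
      ∫ z, F z * (eigval (k + 1) * ⟪eH k, z⟫_ℝ * χ z - χ' z) ∂μ := by
  have := hμ.isProbabilityMeasure
  obtain ⟨φ, hφ, h1, h2⟩ := h.approx
  have hχL : MemLp χ 2 μ := MemLp.of_bound hχm.aestronglyMeasurable C (ae_of_all _ hC)
  have hχL' : MemLp χ' 2 μ := MemLp.of_bound hχm'.aestronglyMeasurable C (ae_of_all _ hC')
  have hzχ : MemLp (fun z => eigval (k + 1) * ⟪eH k, z⟫_ℝ * χ z) 2 μ := by
    have := ((hμ.memLp_inner_eH k).const_mul (eigval (k + 1))).mul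
      (r := 2) (MemLp.of_bound (p := ⊤) hχm.aestronglyMeasurable C (ae_of_all _ hC))
    refine this.ae_eq (ae_of_all _ fun z => ?_)
    simp [mul_comm]
  have hw : MemLp (fun z => eigval (k + 1) * ⟪eH k, z⟫_ℝ * χ z - χ' z) 2 μ := hzχ.sub hχL'
  -- Integration by parts for the product φ_n χ. In both integrals φ_n or its gradient is paired
  -- with a fixed L² function, so the identity survives L² convergence.
  have hid : ∀ n, ∫ z, ⟪gradient (φ n) z, eH k⟫_ℝ * χ z ∂μ =
      ∫ z, φ n z * (eigval (k + 1) * ⟪eH k, z⟫_ℝ * χ z - χ' z) ∂μ := by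
    intro n
    obtain ⟨D, hD, hD'⟩ := (hφ n).exists_bound
    have hD0 : 0 ≤ D := (abs_nonneg _).trans (hD 0)
    have hC0 : 0 ≤ C := (abs_nonneg _).trans (hC 0)
    have hgb : ∀ z, |⟪gradient (φ n) z, eH k⟫_ℝ| ≤ D := fun z =>
      (abs_real_inner_le_norm _ _).trans (by rw [norm_eH, mul_one]; exact hD' z)
    have hgm : Measurable fun z => ⟪gradient (φ n) z, eH k⟫_ℝ :=
      ((continuous_gradient (hφ n).contDiff).inner continuous_const).measurable
    have hφm : Measurable (φ n) := (hφ n).contDiff.continuous.measurable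
    have hder : ∀ (z : H) (x : ℝ), HasDerivAt (fun x : ℝ => φ n (z + x • eH k))
        ⟪gradient (φ n) (z + x • eH k), eH k⟫_ℝ x := by
      intro z x
      rw [inner_gradient]
      have h3 : HasDerivAt (fun x : ℝ => z + x • eH k) (eH k) x := by
        simpa using ((hasDerivAt_id x).smul_const (eH k)).const_add z
      exact ((hφ n).contDiff.differentiable (by simp) (z + x • eH k)).hasFDerivAt.comp_hasDerivAt x h3
    have key := hμ.integral_lineDeriv k (f := fun z => φ n z * χ z)
      (f' := fun z => ⟪gradient (φ n) z, eH k⟫_ℝ * χ z + φ n z * χ' z) (C := D * C + D * C)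
      (fun z x => (hder z x).mul (hχ z x)) (hφm.mul hχm) ((hgm.mul hχm).add (hφm.mul hχm'))
      (fun z => by
        rw [abs_mul]
        have := mul_le_mul (hD z) (hC z) (abs_nonneg _) hD0
        nlinarith [mul_nonneg hD0 hC0])
      (fun z => by
        refine (abs_add_le _ _).trans (add_le_add ?_ ?_) <;> rw [abs_mul]
        · exact mul_le_mul (hgb z) (hC z) (abs_nonneg _) hD0
        · exact mul_le_mul (hD z) (hC' z) (abs_nonneg _) hD0)
    have i1 : Integrable (fun z => ⟪gradient (φ n) z, eH k⟫_ℝ * χ z) μ :=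
      (MemLp.of_bound (p := 2) hgm.aestronglyMeasurable D (ae_of_all _ hgb)).integrable_mul hχL
    have i2 : Integrable (fun z => φ n z * χ' z) μ := (hφ n).memLp.integrable_mul hχL'
    have i3 : Integrable (fun z => φ n z * (eigval (k + 1) * ⟪eH k, z⟫_ℝ * χ z)) μ :=
      (hφ n).memLp.integrable_mul hzχ
    rw [integral_add i1 i2] at key
    simp_rw [mul_sub]
    rw [integral_sub i3 i2, eq_sub_iff_add_eq, key]
    congr 1 with z
    ring
  have hgL : MemLp (fun z => ⟪g z, eH k⟫_ℝ) 2 μ := h.memLp_grad.inner_const _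
  have t1 := tendsto_integral_mul_of_eLpNorm (f := fun n z => ⟪gradient (φ n) z, eH k⟫_ℝ)
    (g := fun z => ⟪g z, eH k⟫_ℝ) (w := χ) (fun n => (hφ n).memLp_gradient.inner_const _) hgL hχL (by
      refine tendsto_of_tendsto_of_tendsto_of_le_of_le tendsto_const_nhds h2 (fun n => zero_le)
        fun n => eLpNorm_mono fun z => ?_
      rw [← inner_sub_left]
      exact (norm_inner_le_norm _ _).trans (by rw [norm_eH, mul_one]))
  have t2 := tendsto_integral_mul_of_eLpNorm (fun n => (hφ n).memLp) h.memLp hw h1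
  simp_rw [hid] at t1
  rw [← tendsto_nhds_unique t1 t2]
  congr 1 with z
  ring

/-- A subsequence of the cylindrical gradients converges almost everywhere, and the closed span
contains its limits. -/
lemma HasSobolevGradient.ae_mem {F : H → ℝ} {g : H → H} (h : HasSobolevGradient μ F g) :
    ∀ᵐ z ∂μ, g z ∈ sineSpan.topologicalClosure := by
  obtain ⟨φ, hφ, -, h2⟩ := h.approx
  obtain ⟨ns, -, hns⟩ := (tendstoInMeasure_of_tendsto_eLpNorm (by norm_num)
    (fun n => (hφ n).aestronglyMeasurable_gradient) h.memLp_grad.1 h2).exists_seq_tendsto_ae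
  filter_upwards [hns] with z hz
  exact sineSpan.isClosed_topologicalClosure.mem_of_tendsto hz
    (Eventually.of_forall fun n => subset_closure ((hφ _).gradient_mem z))

lemma eq_zero_of_mem_closure_of_inner {x : H} (hx : x ∈ sineSpan.topologicalClosure)
    (h : ∀ k, ⟪x, eH k⟫_ℝ = 0) : x = 0 := by
  have h1 : sineSpan ≤ (ℝ ∙ x)ᗮ := by
    rw [Submodule.span_le]
    rintro _ ⟨k, rfl⟩
    exact Submodule.mem_orthogonal_singleton_iff_inner_right.2 (h k)
  have h2 : sineSpan.topologicalClosure ≤ (ℝ ∙ x)ᗮ :=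
    Submodule.topologicalClosure_minimal _ h1 (Submodule.isClosed_orthogonal _)
  exact inner_self_eq_zero.1 (Submodule.mem_orthogonal_singleton_iff_inner_right.1 (h2 hx))

/-- The gradient of a functional in `W^{1,2}(μ)` is unique. -/
lemma HasSobolevGradient.unique (hμ : IsBridgeLaw μ) {F : H → ℝ} {g g' : H → H}
    (h : HasSobolevGradient μ F g) (h' : HasSobolevGradient μ F g') : g =ᵐ[μ] g' := by
  have := hμ.isProbabilityMeasure
  -- The weak characterization expresses ∫ χ ⟨g, e_k⟩ by F and χ alone; the test functions cos⟨·,l⟩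
  -- and sin⟨·,l⟩ are rich enough to conclude.
  have hk : ∀ k, (fun z => ⟪g z - g' z, eH k⟫_ℝ) =ᵐ[μ] 0 := by
    intro k
    have hL : ∀ {f : H → H}, HasSobolevGradient μ F f → Integrable (fun z => ⟪f z, eH k⟫_ℝ) μ :=
      fun hf => (hf.memLp_grad.inner_const (eH k)).integrable (by norm_num)
    have hmul : ∀ {χ χ' : H → ℝ}, (∀ (z : H) (x : ℝ), HasDerivAt (fun x : ℝ => χ (z + x • eH k))
        (χ' (z + x • eH k)) x) → Continuous χ → Continuous χ' → ∀ C : ℝ, (∀ z, |χ z| ≤ C) →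
        (∀ z, |χ' z| ≤ C) → ∫ z, χ z * ⟪g z - g' z, eH k⟫_ℝ ∂μ = 0 := by
      intro χ χ' h1 h2 h3 C h4 h5
      have hi : ∀ {f : H → H}, HasSobolevGradient μ F f →
          Integrable (fun z => χ z * ⟪f z, eH k⟫_ℝ) μ :=
        fun hf => (hL hf).bdd_mul h2.aestronglyMeasurable (ae_of_all _ h4)
      simp_rw [inner_sub_left, mul_sub]
      rw [integral_sub (hi h) (hi h'), h.integral_mul hμ k h1 h2.measurable h3.measurable h4 h5,
        h'.integral_mul hμ k h1 h2.measurable h3.measurable h4 h5, sub_self]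
    have hline : ∀ (l z : H) (x : ℝ),
        HasDerivAt (fun x : ℝ => ⟪z + x • eH k, l⟫_ℝ) ⟪eH k, l⟫_ℝ x := by
      intro l z x
      have h1 : (fun x : ℝ => ⟪z + x • eH k, l⟫_ℝ) = fun x => ⟪z, l⟫_ℝ + x * ⟪eH k, l⟫_ℝ := by
        ext x
        rw [inner_add_left, inner_smul_left]
        rfl
      rw [h1]
      simpa using ((hasDerivAt_id x).mul_const ⟪eH k, l⟫_ℝ).const_add ⟪z, l⟫_ℝ
    refine ae_eq_zero_of_integral_trig ?_ (fun l => ?_) fun l => ?_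
    · simp_rw [inner_sub_left]
      exact (hL h).sub (hL h')
    · refine hmul (χ' := fun z => -Real.sin ⟪z, l⟫_ℝ * ⟪eH k, l⟫_ℝ) (fun z x => (hline l z x).cos)
        (by fun_prop) (by fun_prop) (1 + |⟪eH k, l⟫_ℝ|) (fun z => ?_) fun z => ?_
      · linarith [Real.abs_cos_le_one ⟪z, l⟫_ℝ, abs_nonneg ⟪eH k, l⟫_ℝ]
      · rw [abs_mul, abs_neg]
        nlinarith [Real.abs_sin_le_one ⟪z, l⟫_ℝ, abs_nonneg ⟪eH k, l⟫_ℝ]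
    · refine hmul (χ' := fun z => Real.cos ⟪z, l⟫_ℝ * ⟪eH k, l⟫_ℝ) (fun z x => (hline l z x).sin)
        (by fun_prop) (by fun_prop) (1 + |⟪eH k, l⟫_ℝ|) (fun z => ?_) fun z => ?_
      · linarith [Real.abs_sin_le_one ⟪z, l⟫_ℝ, abs_nonneg ⟪eH k, l⟫_ℝ]
      · rw [abs_mul]
        nlinarith [Real.abs_cos_le_one ⟪z, l⟫_ℝ, abs_nonneg ⟪eH k, l⟫_ℝ]
  filter_upwards [ae_all_iff.2 hk, h.ae_mem, h'.ae_mem] with z hz h1 h2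
  exact sub_eq_zero.1 (eq_zero_of_mem_closure_of_inner (Submodule.sub_mem _ h1 h2) hz)

end

/-! ### Closedness of the gradient and approximation by cylindrical functionals. -/

section

variable {μ : Measure H}

lemma IsCylindrical.hasSobolevGradient [IsFiniteMeasure μ] {φ : H → ℝ} (hφ : IsCylindrical φ) :
    HasSobolevGradient μ φ (gradient φ) where
  memLp := hφ.memLp
  memLp_grad := hφ.memLp_gradient
  approx := ⟨fun _ => φ, fun _ => hφ, by simp, by simp⟩

/-- The graph of the gradient is closed. -/
lemma HasSobolevGradient.of_tendsto {F : ℕ → H → ℝ} {G : ℕ → H → H} {F₀ : H → ℝ} {G₀ : H → H}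
    (h : ∀ n, HasSobolevGradient μ (F n) (G n)) (hF₀ : MemLp F₀ 2 μ) (hG₀ : MemLp G₀ 2 μ)
    (hF : Tendsto (fun n => eLpNorm (fun z => F n z - F₀ z) 2 μ) atTop (𝓝 0))
    (hG : Tendsto (fun n => eLpNorm (fun z => G n z - G₀ z) 2 μ) atTop (𝓝 0)) :
    HasSobolevGradient μ F₀ G₀ := by
  refine ⟨hF₀, hG₀, ?_⟩
  have hδ : ∀ n : ℕ, (0 : ENNReal) < ((n : ENNReal) + 1)⁻¹ := fun n => by simp
  have hex : ∀ n : ℕ, ∃ φ, IsCylindrical φ ∧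
      eLpNorm (fun z => φ z - F n z) 2 μ ≤ ((n : ENNReal) + 1)⁻¹ ∧
      eLpNorm (fun z => gradient φ z - G n z) 2 μ ≤ ((n : ENNReal) + 1)⁻¹ := by
    intro n
    obtain ⟨φ, hφ, h1, h2⟩ := (h n).approx
    obtain ⟨k, hk1, hk2⟩ := ((h1.eventually (ge_mem_nhds (hδ n))).and
      (h2.eventually (ge_mem_nhds (hδ n)))).exists
    exact ⟨φ k, hφ k, hk1, hk2⟩
  choose φ hφ h1 h2 using hex
  have hlim : Tendsto (fun n : ℕ => ((n : ENNReal) + 1)⁻¹) atTop (𝓝 0) := by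
    have := ENNReal.tendsto_inv_nat_nhds_zero.comp (tendsto_add_atTop_nat 1)
    refine this.congr fun n => ?_
    simp
  refine ⟨φ, hφ, ?_, ?_⟩
  · have := hlim.add hF
    rw [add_zero] at this
    refine tendsto_of_tendsto_of_tendsto_of_le_of_le tendsto_const_nhds this (fun n => zero_le)
      fun n => ?_
    refine le_trans (le_of_eq ?_) ((eLpNorm_add_le ((hφ n).aestronglyMeasurable.sub (h n).memLp.1)
      ((h n).memLp.1.sub hF₀.1) (by norm_num)).trans (add_le_add_left (h1 n) _))
    congr 1 with z
    simp
  · have := hlim.add hG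
    rw [add_zero] at this
    refine tendsto_of_tendsto_of_tendsto_of_le_of_le tendsto_const_nhds this (fun n => zero_le)
      fun n => ?_
    refine le_trans (le_of_eq ?_) ((eLpNorm_add_le
      ((hφ n).aestronglyMeasurable_gradient.sub (h n).memLp_grad.1)
      ((h n).memLp_grad.1.sub hG₀.1) (by norm_num)).trans (add_le_add_left (h2 n) _))
    congr 1 with z
    simp

/-- On a finite measure space, uniform bounds and pointwise convergence of values and derivatives
replace convergence in L². The successive extensions of the class of functionals below rest on this
criterion. -/
lemma HasSobolevGradient.of_pointwise [IsFiniteMeasure μ] {F : ℕ → H → ℝ} {F₀ : H → ℝ}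
    (h : ∀ n, HasSobolevGradient μ (F n) (gradient (F n))) (h₀ : ContDiff ℝ 1 F₀) (C : ℝ)
    (hF₀ : ∀ z, |F₀ z| ≤ C) (hG₀ : ∀ z, ‖gradient F₀ z‖ ≤ C)
    (hF : ∀ n z, |F n z| ≤ C) (hG : ∀ n z, ‖gradient (F n) z‖ ≤ C)
    (hFl : ∀ z, Tendsto (fun n => F n z) atTop (𝓝 (F₀ z)))
    (hGl : ∀ z, Tendsto (fun n => fderiv ℝ (F n) z) atTop (𝓝 (fderiv ℝ F₀ z))) :
    HasSobolevGradient μ F₀ (gradient F₀) := by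
  refine HasSobolevGradient.of_tendsto h
    (MemLp.of_bound h₀.continuous.aestronglyMeasurable C (ae_of_all _ hF₀))
    (MemLp.of_bound (continuous_gradient h₀).aestronglyMeasurable C (ae_of_all _ hG₀)) ?_ ?_
  · exact tendsto_eLpNorm_of_bounded (C + C) (Eventually.of_forall fun n => (h n).memLp.1)
      h₀.continuous.aestronglyMeasurable (Eventually.of_forall fun n => ae_of_all _ fun z =>
        (norm_sub_le _ _).trans (add_le_add (hF n z) (hF₀ z))) (ae_of_all _ hFl)
  · refine tendsto_eLpNorm_of_bounded (C + C) (Eventually.of_forall fun n => (h n).memLp_grad.1)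
      (continuous_gradient h₀).aestronglyMeasurable (Eventually.of_forall fun n => ae_of_all _ fun z =>
        (norm_sub_le _ _).trans (add_le_add (hG n z) (hG₀ z))) (ae_of_all _ fun z => ?_)
    exact ((InnerProductSpace.toDual ℝ H).symm.continuous.tendsto _).comp (hGl z)

lemma fderiv_comp_innerMap {m : ℕ} (l : Fin m → H) {ψ : (Fin m → ℝ) → ℝ} (hψ : ContDiff ℝ 1 ψ)
    (z : H) : fderiv ℝ (ψ ∘ innerMap l) z = (fderiv ℝ ψ (innerMap l z)).comp (innerMap l) := by
  rw [fderiv_comp _ (hψ.differentiable (by simp) _) (innerMap l).differentiableAt,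
    ContinuousLinearMap.fderiv]

lemma norm_gradient_comp_innerMap_le {m : ℕ} (l : Fin m → H) {ψ : (Fin m → ℝ) → ℝ}
    (hψ : ContDiff ℝ 1 ψ) {C : ℝ} (hC : ∀ y, ‖fderiv ℝ ψ y‖ ≤ C) (z : H) :
    ‖gradient (ψ ∘ innerMap l) z‖ ≤ C * ‖innerMap l‖ := by
  rw [norm_gradient, fderiv_comp_innerMap l hψ]
  exact (ContinuousLinearMap.opNorm_comp_le _ _).trans
    (mul_le_mul_of_nonneg_right (hC _) (norm_nonneg _))

lemma tendsto_fderiv_comp_innerMap {m : ℕ} (l : Fin m → H) {ψ : ℕ → (Fin m → ℝ) → ℝ}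
    {ψ₀ : (Fin m → ℝ) → ℝ} (hψ : ∀ n, ContDiff ℝ 1 (ψ n)) (hψ₀ : ContDiff ℝ 1 ψ₀)
    (h : ∀ y, Tendsto (fun n => fderiv ℝ (ψ n) y) atTop (𝓝 (fderiv ℝ ψ₀ y))) (z : H) :
    Tendsto (fun n => fderiv ℝ (ψ n ∘ innerMap l) z) atTop (𝓝 (fderiv ℝ (ψ₀ ∘ innerMap l) z)) := by
  simp_rw [fderiv_comp_innerMap l (hψ _), fderiv_comp_innerMap l hψ₀]
  have hc : Continuous fun T : (Fin m → ℝ) →L[ℝ] ℝ => T.comp (innerMap l) := by fun_prop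
  exact (hc.tendsto _).comp (h _)

/-- A sequence of smooth bump functions at `0` with shrinking supports. -/
def bumpSeq (m n : ℕ) : ContDiffBump (0 : Fin m → ℝ) where
  rIn := 1 / (2 * ((n : ℝ) + 1))
  rOut := 1 / ((n : ℝ) + 1)
  rIn_pos := by positivity
  rIn_lt_rOut := one_div_lt_one_div_of_lt (by positivity) (by linarith [(Nat.cast_nonneg n : (0 : ℝ) ≤ n)])

lemma tendsto_bumpSeq (m : ℕ) : Tendsto (fun n => (bumpSeq m n).rOut) atTop (𝓝 0) :=
  tendsto_one_div_add_atTop_nhds_zero_nat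

/-- Mollification along `bumpSeq`. -/
def mollify {m : ℕ} {E : Type*} [NormedAddCommGroup E] [NormedSpace ℝ E] (n : ℕ)
    (f : (Fin m → ℝ) → E) : (Fin m → ℝ) → E :=
  convolution ((bumpSeq m n).normed volume) f (ContinuousLinearMap.lsmul ℝ ℝ) volume

lemma tendsto_mollify {m : ℕ} {E : Type*} [NormedAddCommGroup E] [NormedSpace ℝ E] [CompleteSpace E]
    {f : (Fin m → ℝ) → E} (hf : Continuous f) (y : Fin m → ℝ) :
    Tendsto (fun n => mollify n f y) atTop (𝓝 (f y)) :=
  ContDiffBump.convolution_tendsto_right_of_continuous (tendsto_bumpSeq m) hf y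

/-- The mollification differs from f(y) by at most the oscillation bound 2C, and |f(y)| ≤ C. Only
uniformity in n matters, so the factor 3 is harmless. -/
lemma norm_mollify_le {m : ℕ} {E : Type*} [NormedAddCommGroup E] [NormedSpace ℝ E] [CompleteSpace E]
    {f : (Fin m → ℝ) → E} (hf : Continuous f) {C : ℝ} (hC : ∀ y, ‖f y‖ ≤ C) (n : ℕ)
    (y : Fin m → ℝ) : ‖mollify n f y‖ ≤ 3 * C := by
  have h := ContDiffBump.dist_normed_convolution_le (μ := volume) (φ := bumpSeq m n) (x₀ := y)
    (g := f) (ε := C + C) hf.aestronglyMeasurable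
    (fun x _ => (dist_eq_norm (f x) (f y)).trans_le ((norm_sub_le _ _).trans (add_le_add (hC x) (hC y))))
  rw [dist_eq_norm] at h
  have h2 := norm_le_norm_add_norm_sub' (mollify n f y) (f y)
  have h3 := hC y
  unfold mollify at *
  linarith

lemma mollify_properties {m : ℕ} {ψ : (Fin m → ℝ) → ℝ} (hψ : ContDiff ℝ 1 ψ)
    (hc : HasCompactSupport ψ) (n : ℕ) :
    ContDiff ℝ (⊤ : ℕ∞) (mollify n ψ) ∧ HasCompactSupport (mollify n ψ) ∧
      fderiv ℝ (mollify n ψ) = mollify n (fderiv ℝ ψ) := by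
  refine ⟨?_, ?_, ?_⟩
  · exact HasCompactSupport.contDiff_convolution_left _ (bumpSeq m n).hasCompactSupport_normed
      (bumpSeq m n).contDiff_normed hψ.continuous.locallyIntegrable
  · exact HasCompactSupport.convolution _ (bumpSeq m n).hasCompactSupport_normed hc
  · ext1 y
    have h := HasCompactSupport.hasFDerivAt_convolution_right (𝕜 := ℝ) (μ := volume)
      (f := (bumpSeq m n).normed volume) (ContinuousLinearMap.lsmul ℝ ℝ) hc
      ((bumpSeq m n).continuous_normed.locallyIntegrable) hψ y
    exact h.fderiv

lemma isCylindrical_of_hasCompactSupport {m : ℕ} {ψ : (Fin m → ℝ) → ℝ}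
    (hψ : ContDiff ℝ (⊤ : ℕ∞) ψ) (hc : HasCompactSupport ψ) {l : Fin m → H}
    (hl : ∀ i, l i ∈ sineSpan) : IsCylindrical (ψ ∘ innerMap l) := by
  refine ⟨m, ψ, l, hψ, fun n => ?_, hl, fun z => rfl⟩
  exact (hc.iteratedFDeriv n).exists_bound_of_continuous
    (hψ.continuous_iteratedFDeriv (ENat.natCast_le_of_coe_top_le_withTop le_rfl n))

/-- Mollification commutes with the derivative and keeps compact support, so the mollified
functionals are cylindrical and converge boundedly together with their gradients. -/
lemma hasSobolevGradient_of_hasCompactSupport [IsFiniteMeasure μ] {m : ℕ} {ψ : (Fin m → ℝ) → ℝ}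
    (hψ : ContDiff ℝ 1 ψ) (hc : HasCompactSupport ψ) {l : Fin m → H} (hl : ∀ i, l i ∈ sineSpan) :
    HasSobolevGradient μ (ψ ∘ innerMap l) (gradient (ψ ∘ innerMap l)) := by
  have hp := mollify_properties hψ hc
  obtain ⟨C₀, hC₀⟩ := hc.exists_bound_of_continuous hψ.continuous
  obtain ⟨C₁, hC₁⟩ := (hc.fderiv (𝕜 := ℝ)).exists_bound_of_continuous (hψ.continuous_fderiv (by simp))
  have h1 : ∀ n, ContDiff ℝ 1 (mollify n ψ) := fun n =>
    (hp n).1.of_le (ENat.natCast_le_of_coe_top_le_withTop le_rfl 1)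
  have hn0 : 0 ≤ C₀ := (norm_nonneg _).trans (hC₀ 0)
  have hn1 : 0 ≤ C₁ := (norm_nonneg _).trans (hC₁ 0)
  have hb1 : ∀ n y, ‖fderiv ℝ (mollify n ψ) y‖ ≤ 3 * C₁ := fun n y => by
    rw [(hp n).2.2]; exact norm_mollify_le (hψ.continuous_fderiv (by simp)) hC₁ n y
  have hmul : 0 ≤ C₁ * ‖innerMap l‖ := by positivity
  refine HasSobolevGradient.of_pointwise (F := fun n => mollify n ψ ∘ innerMap l)
    (fun n => (isCylindrical_of_hasCompactSupport (hp n).1 (hp n).2.1 hl).hasSobolevGradient)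
    (hψ.comp (innerMap l).contDiff) (3 * C₀ + 3 * C₁ * ‖innerMap l‖) ?_ ?_ ?_ ?_ ?_ ?_
  · intro z
    have := hC₀ (innerMap l z)
    rw [Real.norm_eq_abs] at this
    simp only [Function.comp_apply]
    linarith
  · intro z
    linarith [norm_gradient_comp_innerMap_le l hψ hC₁ z]
  · intro n z
    have := norm_mollify_le hψ.continuous hC₀ n (innerMap l z)
    rw [Real.norm_eq_abs] at this
    simp only [Function.comp_apply]
    linarith
  · intro n z
    linarith [norm_gradient_comp_innerMap_le l (h1 n) (hb1 n) z]
  · exact fun z => tendsto_mollify hψ.continuous _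
  · refine fun z => tendsto_fderiv_comp_innerMap l h1 hψ (fun y => ?_) z
    simp_rw [(hp _).2.2]
    exact tendsto_mollify (hψ.continuous_fderiv (by simp)) y

/-- Reduction to compact support by the cut-offs b(c_n y) with c_n = 1/(n+1) → 0; as c_n ≤ 1, their
derivatives remain bounded. -/
lemma hasSobolevGradient_of_bounded [IsFiniteMeasure μ] {m : ℕ} {ψ : (Fin m → ℝ) → ℝ}
    (hψ : ContDiff ℝ 1 ψ) {C : ℝ} (hC : ∀ y, |ψ y| ≤ C) (hC' : ∀ y, ‖fderiv ℝ ψ y‖ ≤ C)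
    {l : Fin m → H} (hl : ∀ i, l i ∈ sineSpan) :
    HasSobolevGradient μ (ψ ∘ innerMap l) (gradient (ψ ∘ innerMap l)) := by
  let b : ContDiffBump (0 : Fin m → ℝ) := ⟨1, 2, one_pos, one_lt_two⟩
  let c : ℕ → ℝ := fun n => 1 / ((n : ℝ) + 1)
  have hcpos : ∀ n, 0 < c n := fun n => by positivity
  have hc1 : ∀ n, c n ≤ 1 := fun n => by
    rw [div_le_one (by positivity)]; linarith [(Nat.cast_nonneg n : (0 : ℝ) ≤ n)]
  have hb : ContDiff ℝ 1 (b : (Fin m → ℝ) → ℝ) := b.contDiff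
  let χ : ℕ → (Fin m → ℝ) → ℝ := fun n y => b (c n • y)
  have hχ : ∀ n, ContDiff ℝ 1 (χ n) := fun n => hb.comp (contDiff_const_smul (c n))
  have hχc : ∀ n, HasCompactSupport (χ n) := fun n =>
    b.hasCompactSupport.comp_smul (hcpos n).ne'
  obtain ⟨D, hD⟩ := (b.hasCompactSupport.fderiv (𝕜 := ℝ)).exists_bound_of_continuous
    (hb.continuous_fderiv (by simp))
  have hD0 : 0 ≤ D := (norm_nonneg _).trans (hD 0)
  have hC0 : 0 ≤ C := (abs_nonneg _).trans (hC 0)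
  have hχd : ∀ n y, ‖fderiv ℝ (χ n) y‖ ≤ D := by
    intro n y
    have h1 : fderiv ℝ (χ n) y = c n • fderiv ℝ b (c n • y) := fderiv_comp_smul (f := b) (c n)
    rw [h1, norm_smul, Real.norm_of_nonneg (hcpos n).le]
    exact (mul_le_mul (hc1 n) (hD _) (norm_nonneg _) zero_le_one).trans_eq (one_mul D)
  let ψn : ℕ → (Fin m → ℝ) → ℝ := fun n y => χ n y * ψ y
  have hψn : ∀ n, ContDiff ℝ 1 (ψn n) := fun n => (hχ n).mul hψ
  have hψb : ∀ n y, |ψn n y| ≤ C := by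
    intro n y
    have h1 : |χ n y| ≤ 1 := abs_le.2 ⟨by linarith [b.nonneg (x := c n • y)], b.le_one⟩
    rw [abs_mul]
    exact (mul_le_mul h1 (hC y) (abs_nonneg _) zero_le_one).trans_eq (one_mul C)
  have hψd : ∀ n y, ‖fderiv ℝ (ψn n) y‖ ≤ C + C * D := by
    intro n y
    have h1 : |χ n y| ≤ 1 := abs_le.2 ⟨by linarith [b.nonneg (x := c n • y)], b.le_one⟩
    have h2 : fderiv ℝ (ψn n) y = χ n y • fderiv ℝ ψ y + ψ y • fderiv ℝ (χ n) y :=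
      fderiv_fun_mul ((hχ n).differentiable (by simp) y) (hψ.differentiable (by simp) y)
    rw [h2]
    refine (norm_add_le _ _).trans (add_le_add ?_ ?_) <;> rw [norm_smul, Real.norm_eq_abs]
    · exact (mul_le_mul h1 (hC' y) (norm_nonneg _) zero_le_one).trans_eq (one_mul C)
    · exact mul_le_mul (hC y) (hχd n y) (norm_nonneg _) hC0
  -- Equality on a whole neighborhood, and not only at y, is needed so that the derivatives agree as
  -- well.
  have hev : ∀ y, ∀ᶠ n in atTop, ψn n =ᶠ[𝓝 y] ψ := by
    intro y
    have ht : Tendsto (fun n => c n * (‖y‖ + 1)) atTop (𝓝 (0 * (‖y‖ + 1))) :=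
      tendsto_one_div_add_atTop_nhds_zero_nat.mul_const _
    rw [zero_mul] at ht
    filter_upwards [ht.eventually (ge_mem_nhds one_pos)] with n hn
    filter_upwards [Metric.ball_mem_nhds y one_pos] with x hx
    have hx2 : ‖x‖ ≤ ‖y‖ + 1 := by
      rw [mem_ball_iff_norm] at hx
      linarith [norm_le_norm_add_norm_sub' x y]
    have : b (c n • x) = 1 := by
      refine b.one_of_mem_closedBall ?_
      rw [mem_closedBall_zero_iff, norm_smul, Real.norm_of_nonneg (hcpos n).le]
      exact (mul_le_mul_of_nonneg_left hx2 (hcpos n).le).trans hn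
    simp only [ψn, χ, this, one_mul]
  have hCD : 0 ≤ C * D := mul_nonneg hC0 hD0
  refine HasSobolevGradient.of_pointwise (F := fun n => ψn n ∘ innerMap l)
    (fun n => hasSobolevGradient_of_hasCompactSupport (hψn n) ((hχc n).mul_right) hl)
    (hψ.comp (innerMap l).contDiff) (C + (C + C * D) * ‖innerMap l‖) ?_ ?_ ?_ ?_ ?_ ?_
  · intro z
    have : 0 ≤ (C + C * D) * ‖innerMap l‖ := by positivity
    exact (hC _).trans (by linarith)
  · intro z
    have h1 := norm_gradient_comp_innerMap_le l hψ hC' z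
    have : 0 ≤ C * D * ‖innerMap l‖ := by positivity
    linarith
  · intro n z
    have : 0 ≤ (C + C * D) * ‖innerMap l‖ := by positivity
    exact (hψb n _).trans (by linarith)
  · intro n z
    linarith [norm_gradient_comp_innerMap_le l (hψn n) (hψd n) z]
  · intro z
    refine tendsto_const_nhds.congr' ?_
    filter_upwards [hev (innerMap l z)] with n hn
    exact hn.eq_of_nhds.symm
  · refine fun z => tendsto_fderiv_comp_innerMap l hψn hψ (fun y => ?_) z
    refine tendsto_const_nhds.congr' ?_
    filter_upwards [hev y] with n hn
    exact hn.fderiv_eq.symm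

/-! ### Continuously differentiable functionals -/

/-- The projection onto the span of the first `m` sine functions. -/
def sineProj (m : ℕ) : H →L[ℝ] H :=
  ∑ i : Fin m, (innerSL ℝ (eH i)).smulRight (eH i)

lemma sineProj_apply (m : ℕ) (z : H) : sineProj m z = ∑ i : Fin m, ⟪eH i, z⟫_ℝ • eH i := by
  simp [sineProj]

lemma inner_sineProj (m : ℕ) (z w : H) : ⟪sineProj m z, w⟫_ℝ = ⟪z, sineProj m w⟫_ℝ := by
  simp only [sineProj_apply, sum_inner, inner_sum, inner_smul_left, inner_smul_right]
  refine Finset.sum_congr rfl fun i _ => ?_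
  rw [real_inner_comm z, mul_comm]
  rfl

lemma norm_sineProj_le (m : ℕ) (z : H) : ‖sineProj m z‖ ≤ ‖z‖ := by
  refine (sq_le_sq₀ (norm_nonneg _) (norm_nonneg _)).1 ?_
  have ho : Orthonormal ℝ fun i : Fin m => eH i :=
    orthonormal_eH.comp _ Fin.val_injective
  rw [sineProj_apply, ← real_inner_self_eq_norm_sq, ho.inner_sum]
  refine le_trans (le_of_eq ?_) (ho.sum_inner_products_le z (s := Finset.univ))
  refine Finset.sum_congr rfl fun i _ => ?_
  simp [sq]

lemma sineProj_eH {m k : ℕ} (h : k < m) : sineProj m (eH k) = eH k := by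
  rw [sineProj_apply, Finset.sum_eq_single ⟨k, h⟩]
  · simp
  · intro i _ hi
    have : (i : ℕ) ≠ k := fun h' => hi (Fin.ext h')
    simp [inner_eH_eH, this]
  · simp

/-- On the span the projections are eventually the identity, and being contractions they carry the
convergence over to the closure. -/
lemma tendsto_sineProj {x : H} (hx : x ∈ sineSpan.topologicalClosure) :
    Tendsto (fun m => sineProj m x) atTop (𝓝 x) := by
  have hspan : ∀ y ∈ sineSpan, ∀ᶠ m in atTop, sineProj m y = y := by
    intro y hy
    induction hy using Submodule.span_induction with
    | mem y hy =>
      obtain ⟨k, rfl⟩ := hy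
      filter_upwards [eventually_gt_atTop k] with m hm using sineProj_eH hm
    | zero => simp
    | add y w _ _ hy hw =>
      filter_upwards [hy, hw] with m h1 h2
      rw [map_add, h1, h2]
    | smul c y _ hy =>
      filter_upwards [hy] with m h1
      rw [map_smul, h1]
  rw [Metric.tendsto_atTop']
  intro ε hε
  obtain ⟨y, hy, hxy⟩ := Metric.mem_closure_iff.1 hx (ε / 2) (half_pos hε)
  obtain ⟨N, hN⟩ := eventually_atTop.1 (hspan y hy)
  refine ⟨N, fun m hm => ?_⟩
  rw [dist_eq_norm] at hxy ⊢
  have h1 : sineProj m x - x = sineProj m (x - y) - (x - y) := by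
    rw [map_sub, hN m hm.le]; abel
  rw [h1]
  calc _ ≤ ‖sineProj m (x - y)‖ + ‖x - y‖ := norm_sub_le _ _
    _ ≤ ‖x - y‖ + ‖x - y‖ := by gcongr; exact norm_sineProj_le _ _
    _ < ε := by linarith

/-- A bounded functional of class `C¹` with bounded gradient that depends on the sine coordinates
only is in `W^{1,2}(μ)`. -/
lemma hasSobolevGradient_of_contDiff [IsFiniteMeasure μ] {F : H → ℝ} (hF : ContDiff ℝ 1 F) {C : ℝ}
    (hC : ∀ z, |F z| ≤ C) (hC' : ∀ z, ‖gradient F z‖ ≤ C)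
    (hinv : ∀ z w, (∀ k, ⟪eH k, w⟫_ℝ = 0) → F (z + w) = F z) :
    HasSobolevGradient μ F (gradient F) := by
  have hC0 : 0 ≤ C := (abs_nonneg _).trans (hC 0)
  have hperp : ∀ w ∈ sineSpan.topologicalClosureᗮ, ∀ k, ⟪eH k, w⟫_ℝ = 0 := fun w hw k =>
    hw _ (subset_closure (Submodule.subset_span ⟨k, rfl⟩))
  have hfd : ∀ z w, (∀ k, ⟪eH k, w⟫_ℝ = 0) → fderiv ℝ F (z + w) = fderiv ℝ F z := by
    intro z w hw
    rw [← fderiv_comp_add_right]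
    congr 1
    exact funext fun y => hinv y w hw
  -- F is constant along directions orthogonal to the sine span, so its gradient is orthogonal to
  -- these directions.
  have hmem : ∀ z, gradient F z ∈ sineSpan.topologicalClosure := by
    intro z
    have : sineSpan.topologicalClosure.HasOrthogonalProjection := inferInstance
    rw [← Submodule.orthogonal_orthogonal sineSpan.topologicalClosure]
    intro w hw
    rw [real_inner_comm, inner_gradient]
    have h1 : HasDerivAt (fun s : ℝ => F (z + s • w)) (fderiv ℝ F (z + (0 : ℝ) • w) w) 0 := by
      have h3 : HasDerivAt (fun s : ℝ => z + s • w) w 0 := by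
        simpa using ((hasDerivAt_id (0 : ℝ)).smul_const w).const_add z
      exact (hF.differentiable (by simp) (z + (0 : ℝ) • w)).hasFDerivAt.comp_hasDerivAt 0 h3
    have h2 : (fun s : ℝ => F (z + s • w)) = fun _ => F z := by
      ext s
      exact hinv _ _ fun k => by rw [inner_smul_right, hperp w hw k, mul_zero]
    rw [h2] at h1
    have h4 := h1.unique (hasDerivAt_const 0 (F z))
    simpa using h4
  let J : (m : ℕ) → (Fin m → ℝ) →L[ℝ] H := fun m =>
    ∑ i : Fin m, (ContinuousLinearMap.proj (R := ℝ) (φ := fun _ : Fin m => ℝ) i).smulRight (eH i)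
  have hJ : ∀ m, (J m).comp (innerMap fun i : Fin m => eH i) = sineProj m := by
    intro m
    ext1 z
    simp [J, sineProj_apply, innerMap_apply]
  have hcomp : ∀ m, (F ∘ J m) ∘ innerMap (fun i : Fin m => eH i) = F ∘ sineProj m := by
    intro m
    rw [← hJ m]
    rfl
  have hgrad : ∀ m z, gradient (F ∘ sineProj m) z = sineProj m (gradient F (sineProj m z)) := by
    intro m z
    refine ext_inner_right ℝ fun w => ?_
    rw [inner_gradient, fderiv_comp _ (hF.differentiable (by simp) _) (sineProj m).differentiableAt,
      ContinuousLinearMap.fderiv, ContinuousLinearMap.comp_apply, ← inner_gradient, inner_sineProj]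
  -- The projections of z converge to its component p in the closed sine span. This suffices, since
  -- neither F nor its derivative sees the orthogonal component w.
  have hproj : ∀ z, ∃ p w, z = p + w ∧ Tendsto (fun m => sineProj m z) atTop (𝓝 p) ∧
      ∀ k, ⟪eH k, w⟫_ℝ = 0 := by
    intro z
    obtain ⟨p, hp, w, hw, rfl⟩ :=
      sineSpan.topologicalClosure.exists_add_mem_mem_orthogonal z
    refine ⟨p, w, rfl, ?_, hperp w hw⟩
    refine (tendsto_sineProj hp).congr fun m => ?_
    rw [map_add, sineProj_apply m w]
    simp [hperp w hw]
  refine HasSobolevGradient.of_pointwise (F := fun m => F ∘ sineProj m) (fun m => ?_) hF C hC hC'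
    (fun m z => hC _) (fun m z => ?_) (fun z => ?_) (fun z => ?_)
  · rw [← hcomp m]
    have hm : 0 ≤ C * ‖J m‖ := by positivity
    refine hasSobolevGradient_of_bounded (hF.comp (J m).contDiff) (C := C + C * ‖J m‖)
      (fun y => (hC _).trans (by linarith)) (fun y => ?_)
      (fun i => Submodule.subset_span ⟨i, rfl⟩)
    rw [fderiv_comp _ (hF.differentiable (by simp) _) (J m).differentiableAt,
      ContinuousLinearMap.fderiv]
    refine (ContinuousLinearMap.opNorm_comp_le _ _).trans ?_
    have h1 := hC' (J m y)
    rw [norm_gradient] at h1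
    nlinarith [norm_nonneg (J m)]
  · rw [hgrad]
    exact (norm_sineProj_le _ _).trans (hC' _)
  · obtain ⟨p, w, rfl, hp, hw⟩ := hproj z
    rw [hinv p w hw]
    exact (hF.continuous.tendsto p).comp hp
  · obtain ⟨p, w, hz, hp, hw⟩ := hproj z
    have h1 : Tendsto (fun m => gradient F (sineProj m z)) atTop (𝓝 (gradient F z)) := by
      have h2 : gradient F z = gradient F p := by rw [gradient_eq, hz, hfd p w hw]; rfl
      rw [h2]
      exact ((continuous_gradient hF).tendsto p).comp hp
    have h3 : Tendsto (fun m => sineProj m (gradient F (sineProj m z))) atTop (𝓝 (gradient F z)) := by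
      have h4 : Tendsto (fun m => sineProj m (gradient F (sineProj m z) - gradient F z)) atTop (𝓝 0) := by
        refine squeeze_zero_norm (fun m => norm_sineProj_le m _) ?_
        simpa using (h1.sub_const (gradient F z)).norm
      have h5 := h4.add (tendsto_sineProj (hmem z))
      rw [zero_add] at h5
      refine h5.congr fun m => ?_
      rw [map_sub, sub_add_cancel]
    simp_rw [← hgrad] at h3
    have h6 := ((InnerProductSpace.toDual ℝ H).continuous.tendsto _).comp h3
    simpa only [Function.comp_def, gradient_eq, LinearIsometryEquiv.apply_symm_apply] using h6

end

section

/-! ### Bounds in time -/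

lemma min_one_pos {t : ℝ} (ht : 0 < t) : 0 < min t 1 := lt_min ht one_pos

/-- The integrand is at most the sum of the integrands of Γ(1 - a) and Γ(1), the first serving t ≤ 1
and the second t ≥ 1. -/
lemma integrableOn_exp_mul_rpow {a : ℝ} (ha : a < 1) :
    IntegrableOn (fun t : ℝ => Real.exp (-t) * (min t 1) ^ (-a)) (Ioi 0) := by
  have h1 := (Real.GammaIntegral_convergent (s := 1 - a) (by linarith)).add
    (Real.GammaIntegral_convergent (s := 1) one_pos)
  refine Integrable.mono' h1 (by fun_prop) ((ae_restrict_iff' measurableSet_Ioi).2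
    (ae_of_all _ fun t (ht : 0 < t) => ?_))
  have h2 := min_one_pos ht
  rw [Real.norm_of_nonneg (by positivity), Pi.add_apply, ← mul_add]
  refine mul_le_mul_of_nonneg_left ?_ (Real.exp_nonneg _)
  rcases le_total t 1 with h | h
  · rw [min_eq_left h, show 1 - a - 1 = -a by ring]
    exact le_add_of_nonneg_right (by positivity)
  · rw [min_eq_right h, Real.one_rpow, sub_self, Real.rpow_zero]
    exact le_add_of_nonneg_left (by positivity)

lemma integrable_volST_of_fst {φ : ℝ → ℝ} (hφ : IntegrableOn φ (Ioi 0)) :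
    Integrable (fun p : ℝ × ℝ => φ p.1) volST := by
  rw [volST_eq_prod]
  exact Integrable.comp_fst hφ _

lemma integrable_exp_volST : Integrable (fun p : ℝ × ℝ => Real.exp (-p.1)) volST := by
  have := integrable_volST_of_fst (integrableOn_exp_mul_rpow (a := 0) one_pos)
  simpa using this

lemma ae_volST {p : ℝ × ℝ → Prop} (h : ∀ q : ℝ × ℝ, 0 < q.1 → q.2 ∈ Ioo (0 : ℝ) 1 → p q) :
    ∀ᵐ q ∂volST, p q :=
  (ae_restrict_iff' (measurableSet_Ioi.prod measurableSet_Ioo)).2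
    (ae_of_all _ fun q hq => h q hq.1 hq.2)

lemma aestronglyMeasurable_heatVec :
    AEStronglyMeasurable (fun p : ℝ × ℝ => heatVec p.1 p.2) volST :=
  (continuousOn_heatVec.mono (prod_mono le_rfl (subset_univ _))).aestronglyMeasurable
    (measurableSet_Ioi.prod measurableSet_Ioo)

/-! ### Cut-off functions -/

/-- `h` is bounded by `D` and vanishes where the distance to the boundary of `(0,1)` is small. -/
structure IsCutoff (h : ℝ → ℝ) (δ D : ℝ) : Prop where
  continuous : Continuous h
  pos : 0 < δ
  bound : ∀ r, |h r| ≤ D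
  mem : ∀ r, h r ≠ 0 → r ∈ Ioo (0 : ℝ) 1
  sin_ge : ∀ r, h r ≠ 0 → δ ≤ Real.sin (Real.pi * r)

/-- The constant in the lower bound for the variance. -/
def varConst (δ : ℝ) : ℝ := δ ^ 2 / (8 * Real.pi ^ 2)

lemma varConst_pos {δ : ℝ} (hδ : 0 < δ) : 0 < varConst δ := by
  have := Real.pi_pos
  unfold varConst; positivity

variable {h : ℝ → ℝ} {δ D A : ℝ} {f f' : ℝ → ℝ → ℝ}

lemma IsCutoff.bound_nonneg (hc : IsCutoff h δ D) : 0 ≤ D := (abs_nonneg _).trans (hc.bound 0)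

lemma IsAdmissible.nonneg (hf : IsAdmissible A f f') : 0 ≤ A := by
  have := (abs_nonneg _).trans (hf.bound 1 one_pos 0)
  simpa using this

lemma IsCutoff.varSeries_ge (hc : IsCutoff h δ D) {t r : ℝ} (ht : 0 < t) (hr : h r ≠ 0) :
    varConst δ * √(min t 1) ≤ varSeries t r := by
  refine le_trans (mul_le_mul_of_nonneg_right ?_ (Real.sqrt_nonneg _)) (StochHeat.varSeries_ge ht r)
  unfold varConst
  have := hc.sin_ge r hr
  have := hc.pos
  gcongr

lemma IsCutoff.varSeries_pos (hc : IsCutoff h δ D) {t r : ℝ} (ht : 0 < t) (hr : h r ≠ 0) :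
    0 < varSeries t r := StochHeat.varSeries_pos ht (hc.mem r hr)

/-- With q of order at least √t, the power q^(-3/2) costs t^(-3/4), which is integrable at 0. -/
lemma IsCutoff.div_mul_sqrt_le (hc : IsCutoff h δ D) (hA : 0 ≤ A) {t r : ℝ} (ht : 0 < t)
    (hr : h r ≠ 0) :
    A / (varSeries t r * √(varSeries t r)) ≤
      A / (varConst δ * √(varConst δ)) * (min t 1) ^ (-(3 / 4) : ℝ) := by
  have h1 := hc.varSeries_ge ht hr
  have h2 := varConst_pos hc.pos
  have h3 := min_one_pos ht
  have h4 : varConst δ * √(varConst δ) * (min t 1) ^ (3 / 4 : ℝ) =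
      (varConst δ * √(min t 1)) * √(varConst δ * √(min t 1)) := by
    rw [Real.sqrt_mul h2.le, Real.sqrt_eq_rpow (√(min t 1)), Real.sqrt_eq_rpow (min t 1),
      ← Real.rpow_mul h3.le, show (3 / 4 : ℝ) = 1 / 2 + 1 / 2 * (1 / 2) by norm_num,
      Real.rpow_add h3]
    ring
  rw [Real.rpow_neg h3.le, ← div_eq_mul_inv, div_div, h4]
  have h5 : 0 < √(min t 1) := Real.sqrt_pos.2 h3
  have h6 := varSeries_nonneg t r
  gcongr

/-- Here the cost is t^(-1), which is not integrable at 0. It serves for times bounded away from 0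
and as one factor in the second moment. -/
lemma IsCutoff.div_sq_le (hc : IsCutoff h δ D) (hA : 0 ≤ A) {t r : ℝ} (ht : 0 < t)
    (hr : h r ≠ 0) :
    A / varSeries t r ^ 2 ≤ A / varConst δ ^ 2 * (min t 1)⁻¹ := by
  have h1 := hc.varSeries_ge ht hr
  have h2 := varConst_pos hc.pos
  have h3 := min_one_pos ht
  have h4 : varConst δ ^ 2 * min t 1 = (varConst δ * √(min t 1)) ^ 2 := by
    rw [mul_pow, Real.sq_sqrt h3.le]
  rw [← div_eq_mul_inv, div_div, h4]
  have h5 : 0 < √(min t 1) := Real.sqrt_pos.2 h3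
  gcongr

/-! ### Potentials -/

/-- The integrand of the potential. -/
def potIntegrand (h : ℝ → ℝ) (f : ℝ → ℝ → ℝ) (z : H) (p : ℝ × ℝ) : ℝ :=
  1 / 2 * Real.exp (-p.1) * (h p.2 * f (varSeries p.1 p.2) ⟪heatVec p.1 p.2, z⟫_ℝ)

/-- The part in the times `S` of the potential
`z ↦ ∫ e^{-t} ½ ∫ h(r) f(q_t(r), z(t,r)) dr dt`. -/
def pot (h : ℝ → ℝ) (f : ℝ → ℝ → ℝ) (S : Set ℝ) (z : H) : ℝ :=
  ∫ p in Prod.fst ⁻¹' S, potIntegrand h f z p ∂volST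

/-- The part in the times `S` of the gradient of the potential. -/
def potGrad (h : ℝ → ℝ) (f' : ℝ → ℝ → ℝ) (S : Set ℝ) (z : H) : H :=
  ∫ p in Prod.fst ⁻¹' S, potIntegrand h f' z p • heatVec p.1 p.2 ∂volST

lemma aestronglyMeasurable_potIntegrand (hh : Continuous h)
    (hf : Measurable (Function.uncurry f)) (z : H) :
    AEStronglyMeasurable (potIntegrand h f z) volST := by
  have h1 : AEMeasurable (fun p : ℝ × ℝ => (varSeries p.1 p.2, ⟪heatVec p.1 p.2, z⟫_ℝ)) volST :=
    (continuous_varSeries.measurable.aemeasurable).prodMk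
      (aestronglyMeasurable_heatVec.inner_const).aemeasurable
  have h2 := (hf.comp_aemeasurable h1).aestronglyMeasurable
  exact (Continuous.aestronglyMeasurable (by fun_prop)).mul
    ((Continuous.aestronglyMeasurable (by fun_prop)).mul h2)

lemma abs_potIntegrand_le (hc : IsCutoff h δ D) {z : H} {p : ℝ × ℝ} {B : ℝ}
    (hB : 0 ≤ B) (hf : h p.2 ≠ 0 → |f (varSeries p.1 p.2) ⟪heatVec p.1 p.2, z⟫_ℝ| ≤ B) :
    |potIntegrand h f z p| ≤ D * B * Real.exp (-p.1) := by
  have hD := hc.bound_nonneg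
  have h1 : |h p.2 * f (varSeries p.1 p.2) ⟪heatVec p.1 p.2, z⟫_ℝ| ≤ D * B := by
    by_cases h0 : h p.2 = 0
    · rw [h0, zero_mul, abs_zero]; positivity
    · rw [abs_mul]
      exact mul_le_mul (hc.bound _) (hf h0) (abs_nonneg _) hD
  rw [potIntegrand, abs_mul, abs_of_nonneg (by positivity : (0:ℝ) ≤ 1 / 2 * Real.exp (-p.1))]
  have h2 := Real.exp_nonneg (-p.1)
  have h3 : 0 ≤ D * B := by positivity
  calc _ ≤ 1 / 2 * Real.exp (-p.1) * (D * B) := by gcongr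
    _ ≤ _ := by nlinarith

/-- The constant in the bound for the potential. -/
def potBound (A δ D : ℝ) : ℝ := D * (A / (varConst δ * √(varConst δ)))

lemma IsAdmissible.abs_potIntegrand_le (hf : IsAdmissible A f f') (hc : IsCutoff h δ D) (z : H)
    {p : ℝ × ℝ} (hp : 0 < p.1) :
    |potIntegrand h f z p| ≤
      potBound A δ D * (Real.exp (-p.1) * (min p.1 1) ^ (-(3 / 4) : ℝ)) := by
  have h1 := varConst_pos hc.pos
  have h2 := hf.nonneg
  have h3 := min_one_pos hp
  refine (StochHeat.abs_potIntegrand_le hc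
    (B := A / (varConst δ * √(varConst δ)) * (min p.1 1) ^ (-(3 / 4) : ℝ)) (by positivity)
    fun h0 => ?_).trans (le_of_eq (by rw [potBound]; ring))
  exact (hf.bound _ (hc.varSeries_pos hp h0) _).trans (hc.div_mul_sqrt_le h2 hp h0)

lemma integrable_potMajorant (C : ℝ) : Integrable
    (fun p : ℝ × ℝ => C * (Real.exp (-p.1) * (min p.1 1) ^ (-(3 / 4) : ℝ))) volST :=
  (integrable_volST_of_fst (integrableOn_exp_mul_rpow (a := 3 / 4) (by norm_num))).const_mul C

lemma IsAdmissible.integrable_potIntegrand (hf : IsAdmissible A f f') (hc : IsCutoff h δ D) (z : H) :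
    Integrable (potIntegrand h f z) volST :=
  (integrable_potMajorant _).mono' (aestronglyMeasurable_potIntegrand hc.continuous hf.measurable z)
    (ae_volST fun _ hp _ => (Real.norm_eq_abs _).trans_le (hf.abs_potIntegrand_le hc z hp))

lemma IsAdmissible.abs_pot_le (hf : IsAdmissible A f f') (hc : IsCutoff h δ D) (S : Set ℝ) (z : H) :
    |pot h f S z| ≤
      ∫ p, potBound A δ D * (Real.exp (-p.1) * (min p.1 1) ^ (-(3 / 4) : ℝ)) ∂volST := by
  refine (norm_integral_le_of_norm_le (integrable_potMajorant (potBound A δ D)).integrableOn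
    (ae_restrict_of_ae (ae_volST fun p hp _ =>
      (Real.norm_eq_abs _).trans_le (hf.abs_potIntegrand_le hc z hp)))).trans ?_
  refine setIntegral_le_integral (integrable_potMajorant _) (ae_volST fun p hp _ => ?_)
  have h1 := varConst_pos hc.pos
  have h2 := hf.nonneg
  have h3 := min_one_pos hp
  have h4 := hc.bound_nonneg
  simp only [potBound, Pi.zero_apply]
  positivity

/-! ### Potentials of times bounded away from zero -/

/-- The constant in the bound for the integrand of the gradient. -/
def gradBound (A δ D a : ℝ) : ℝ := D * (A / varConst δ ^ 2 * (min a 1)⁻¹) * heatBound a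

lemma IsAdmissible.norm_smul_heatVec_le (hf : IsAdmissible A f f') (hc : IsCutoff h δ D) (z : H)
    {a : ℝ} (ha : 0 < a) {p : ℝ × ℝ} (hp : a < p.1) :
    ‖potIntegrand h f' z p • heatVec p.1 p.2‖ ≤ gradBound A δ D a * Real.exp (-p.1) := by
  have h1 := varConst_pos hc.pos
  have h2 := hf.nonneg
  have h3 := min_one_pos ha
  have hp0 := ha.trans hp
  have h4 := hc.bound_nonneg
  rw [norm_smul]
  have h5 := StochHeat.abs_potIntegrand_le (f := f') (z := z) (p := p) hc
    (B := A / varConst δ ^ 2 * (min a 1)⁻¹) (by positivity) fun h0 =>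
      (hf.bound_deriv _ (hc.varSeries_pos hp0 h0) _).trans ((hc.div_sq_le h2 hp0 h0).trans (by gcongr))
  refine (mul_le_mul h5 (norm_heatVec_le ha hp.le p.2) (norm_nonneg _) (by positivity)).trans
    (le_of_eq (by rw [gradBound]; ring))

lemma aestronglyMeasurable_smul_heatVec (hh : Continuous h)
    (hf : Measurable (Function.uncurry f)) (z : H) :
    AEStronglyMeasurable (fun p => potIntegrand h f z p • heatVec p.1 p.2) volST :=
  (aestronglyMeasurable_potIntegrand hh hf z).smul aestronglyMeasurable_heatVec

lemma ae_strip {p : ℝ × ℝ → Prop} {a : ℝ} (h : ∀ q : ℝ × ℝ, a < q.1 → p q) :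
    ∀ᵐ q ∂volST.restrict (Prod.fst ⁻¹' Ioi a), p q :=
  (ae_restrict_iff' (measurable_fst measurableSet_Ioi)).2 (ae_of_all _ fun q hq => h q hq)

lemma IsAdmissible.integrableOn_smul_heatVec (hf : IsAdmissible A f f') (hc : IsCutoff h δ D)
    (z : H) {a : ℝ} (ha : 0 < a) :
    IntegrableOn (fun p => potIntegrand h f' z p • heatVec p.1 p.2) (Prod.fst ⁻¹' Ioi a) volST :=
  Integrable.mono' (integrable_exp_volST.const_mul _).integrableOn
    (aestronglyMeasurable_smul_heatVec hc.continuous hf.measurable_deriv z).restrict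
    (ae_strip fun _ hp => hf.norm_smul_heatVec_le hc z ha hp)

lemma IsAdmissible.norm_potGrad_le (hf : IsAdmissible A f f') (hc : IsCutoff h δ D)
    (z : H) {a : ℝ} (ha : 0 < a) :
    ‖potGrad h f' (Ioi a) z‖ ≤
      ∫ p in Prod.fst ⁻¹' Ioi a, gradBound A δ D a * Real.exp (-p.1) ∂volST :=
  norm_integral_le_of_norm_le (integrable_exp_volST.const_mul _).integrableOn
    (ae_strip fun _ hp => hf.norm_smul_heatVec_le hc z ha hp)

/-- Admissibility says nothing when q = 0; where the variance may vanish, the factor h(r) vanishes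
too. -/
lemma IsAdmissible.hasDerivAt_of_cutoff (hf : IsAdmissible A f f') (hc : IsCutoff h δ D) {t r : ℝ}
    (ht : 0 < t) (x : ℝ) :
    HasDerivAt (fun x => h r * f (varSeries t r) x) (h r * f' (varSeries t r) x) x := by
  by_cases h0 : h r = 0
  · simp only [h0, zero_mul]
    exact hasDerivAt_const x 0
  · exact (hf.hasDerivAt _ (hc.varSeries_pos ht h0) x).const_mul _

lemma IsAdmissible.continuous_of_cutoff (hf : IsAdmissible A f f') (hc : IsCutoff h δ D) {t r : ℝ}
    (ht : 0 < t) : Continuous fun x => h r * f' (varSeries t r) x := by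
  by_cases h0 : h r = 0
  · simp only [h0, zero_mul]
    exact continuous_const
  · exact continuous_const.mul (hf.continuous_deriv _ (hc.varSeries_pos ht h0))

lemma IsAdmissible.continuous_potGrad (hf : IsAdmissible A f f') (hc : IsCutoff h δ D)
    {a : ℝ} (ha : 0 < a) : Continuous (potGrad h f' (Ioi a)) := by
  refine continuous_of_dominated
    (fun z => (aestronglyMeasurable_smul_heatVec hc.continuous hf.measurable_deriv z).restrict)
    (fun z => ae_strip fun _ hp => hf.norm_smul_heatVec_le hc z ha hp)
    (integrable_exp_volST.const_mul _).integrableOn (ae_strip fun p hp => ?_)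
  have h1 := (hf.continuous_of_cutoff hc (r := p.2) (ha.trans hp)).comp
    (by fun_prop : Continuous fun z => ⟪heatVec p.1 p.2, z⟫_ℝ)
  exact (continuous_const.mul h1).smul continuous_const

lemma IsAdmissible.hasGradientAt_pot (hf : IsAdmissible A f f') (hc : IsCutoff h δ D)
    {a : ℝ} (ha : 0 < a) (z : H) : HasGradientAt (pot h f (Ioi a)) (potGrad h f' (Ioi a) z) z := by
  have hm : ∀ z, AEStronglyMeasurable
      (fun p : ℝ × ℝ => potIntegrand h f' z p • innerSL ℝ (heatVec p.1 p.2)) volST := fun z =>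
    (aestronglyMeasurable_potIntegrand hc.continuous hf.measurable_deriv z).smul
      ((innerSL ℝ).continuous.comp_aestronglyMeasurable aestronglyMeasurable_heatVec)
  have hn : ∀ z, ∀ p : ℝ × ℝ, a < p.1 →
      ‖potIntegrand h f' z p • innerSL ℝ (heatVec p.1 p.2)‖ ≤
        gradBound A δ D a * Real.exp (-p.1) := by
    intro z p hp
    have := hf.norm_smul_heatVec_le hc z ha hp
    rw [norm_smul] at this ⊢
    rwa [innerSL_apply_norm]
  have h1 : HasFDerivAt (pot h f (Ioi a)) (∫ p in Prod.fst ⁻¹' Ioi a,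
      potIntegrand h f' z p • innerSL ℝ (heatVec p.1 p.2) ∂volST) z := by
    refine hasFDerivAt_integral_of_dominated_of_fderiv_le (𝕜 := ℝ)
      (F' := fun z p => potIntegrand h f' z p • innerSL ℝ (heatVec p.1 p.2))
      (bound := fun p => gradBound A δ D a * Real.exp (-p.1)) (s := univ) univ_mem
      (Eventually.of_forall fun z =>
        (aestronglyMeasurable_potIntegrand hc.continuous hf.measurable z).restrict)
      (hf.integrable_potIntegrand hc z).integrableOn (hm z).restrict
      (ae_strip fun p hp z _ => hn z p hp) (integrable_exp_volST.const_mul _).integrableOn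
      (ae_strip fun p hp z _ => ?_)
    have h2 := ((hf.hasDerivAt_of_cutoff hc (r := p.2) (ha.trans hp)
      ⟪heatVec p.1 p.2, z⟫_ℝ).comp_hasFDerivAt z
      (innerSL ℝ (heatVec p.1 p.2)).hasFDerivAt).const_mul (1 / 2 * Real.exp (-p.1))
    rw [smul_smul] at h2
    exact h2
  -- It remains to identify the integral of the functionals ⟨g_t(r,·), ·⟩ with the functional of the
  -- H-valued integral `potGrad`.
  rw [hasGradientAt_iff_hasFDerivAt]
  refine h1.congr_fderiv (ContinuousLinearMap.ext fun w => Eq.symm ?_)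
  have hi : IntegrableOn (fun p : ℝ × ℝ => potIntegrand h f' z p • innerSL ℝ (heatVec p.1 p.2))
      (Prod.fst ⁻¹' Ioi a) volST :=
    Integrable.mono' (integrable_exp_volST.const_mul _).integrableOn (hm z).restrict
      (ae_strip fun p hp => hn z p hp)
  rw [InnerProductSpace.toDual_apply_apply, ContinuousLinearMap.integral_apply hi, real_inner_comm,
    potGrad, ← integral_inner (hf.integrableOn_smul_heatVec hc z ha)]
  congr 1 with p
  rw [inner_smul_right, real_inner_comm]
  rfl

lemma inner_heatVec_eq_zero {t : ℝ} (ht : 0 < t) (r : ℝ) {w : H} (hw : ∀ k, ⟪eH k, w⟫_ℝ = 0) :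
    ⟪heatVec t r, w⟫_ℝ = 0 := by
  have := hasSum_inner_heatVec ht r w
  simp only [hw, mul_zero] at this
  exact this.unique hasSum_zero

/-- Away from time 0 the potential is C¹ and bounded with its gradient. It depends on the sine
coordinates only, because every `heatVec` is a convergent sine series. -/
lemma IsAdmissible.hasSobolevGradient_pot {μ : Measure H} [IsFiniteMeasure μ]
    (hf : IsAdmissible A f f') (hc : IsCutoff h δ D) {a : ℝ} (ha : 0 < a) :
    HasSobolevGradient μ (pot h f (Ioi a)) (potGrad h f' (Ioi a)) := by
  have h1 : gradient (pot h f (Ioi a)) = potGrad h f' (Ioi a) :=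
    funext fun z => (hf.hasGradientAt_pot hc ha z).gradient
  rw [← h1]
  obtain ⟨C, hC⟩ : ∃ C, ∀ z, |pot h f (Ioi a) z| ≤ C := ⟨_, hf.abs_pot_le hc _⟩
  obtain ⟨C', hC'⟩ : ∃ C, ∀ z, ‖potGrad h f' (Ioi a) z‖ ≤ C :=
    ⟨_, fun z => hf.norm_potGrad_le hc z ha⟩
  refine hasSobolevGradient_of_contDiff (C := max C C') ?_
    (fun z => (hC z).trans (le_max_left _ _)) (fun z => h1 ▸ (hC' z).trans (le_max_right _ _)) fun z w hw => ?_
  · rw [contDiff_one_iff_hasFDerivAt]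
    exact ⟨fun z => InnerProductSpace.toDual ℝ H (potGrad h f' (Ioi a) z),
      (InnerProductSpace.toDual ℝ H).continuous.comp (hf.continuous_potGrad hc ha),
      fun z => (hf.hasGradientAt_pot hc ha z).hasFDerivAt⟩
  · refine setIntegral_congr_fun (measurable_fst measurableSet_Ioi) fun p (hp : a < p.1) => ?_
    simp only [potIntegrand]
    rw [inner_add_right, inner_heatVec_eq_zero (ha.trans hp) p.2 hw, add_zero]

end

section

variable {h : ℝ → ℝ} {δ D A : ℝ} {f f' : ℝ → ℝ → ℝ} {μ : Measure H}

/-! ### The energy of the potentials -/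

/-- The constant in the bound for the energy. -/
def energyConst : ℝ := 1 + ∫ t in Ioi (0 : ℝ), Real.exp (-t) * (min t 1) ^ (-(7 / 8) : ℝ)

lemma integral_exp_mul_rpow_nonneg :
    0 ≤ ∫ t in Ioi (0 : ℝ), Real.exp (-t) * (min t 1) ^ (-(7 / 8) : ℝ) :=
  setIntegral_nonneg measurableSet_Ioi fun t (ht : 0 < t) => by
    have := min_one_pos ht
    positivity

/-- The summand 1 in the definition makes the constant invertible, as the weighted Young inequality
requires. -/
lemma energyConst_pos : 0 < energyConst := by
  have := integral_exp_mul_rpow_nonneg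
  unfold energyConst
  linarith

/-- The weight in the bound for the energy. -/
def energyWeight (h : ℝ → ℝ) (p : ℝ × ℝ) : ENNReal :=
  ENNReal.ofReal (Real.exp (-p.1) * (min p.1 1) ^ (7 / 8 : ℝ) * h p.2 ^ 2)

lemma measurable_energyWeight (hh : Continuous h) : Measurable (energyWeight h) := by
  have := hh.measurable
  unfold energyWeight; fun_prop

/-- For each t the integral over r is at most ‖z‖² by contractivity of the heat semigroup, and the
time weight is integrable since 7/8 < 1. -/
lemma lintegral_exp_mul_inner_sq_le (z : H) :
    ∫⁻ p, ENNReal.ofReal (Real.exp (-p.1) * (min p.1 1) ^ (-(7 / 8) : ℝ)) *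
      ENNReal.ofReal (⟪heatVec p.1 p.2, z⟫_ℝ ^ 2) ∂volST ≤
        ENNReal.ofReal energyConst * ENNReal.ofReal (‖z‖ ^ 2) := by
  have hm : AEMeasurable (fun p : ℝ × ℝ => ENNReal.ofReal (⟪heatVec p.1 p.2, z⟫_ℝ ^ 2)) volST :=
    ((aestronglyMeasurable_heatVec.inner_const).aemeasurable.pow_const 2).ennreal_ofReal
  have hm2 : Measurable fun p : ℝ × ℝ =>
      ENNReal.ofReal (Real.exp (-p.1) * (min p.1 1) ^ (-(7 / 8) : ℝ)) := by fun_prop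
  have hm3 : AEMeasurable (fun p : ℝ × ℝ =>
      ENNReal.ofReal (Real.exp (-p.1) * (min p.1 1) ^ (-(7 / 8) : ℝ)) *
        ENNReal.ofReal (⟪heatVec p.1 p.2, z⟫_ℝ ^ 2)) volST := hm2.aemeasurable.mul hm
  rw [volST_eq_prod] at hm3 ⊢
  rw [lintegral_prod _ hm3]
  calc _ ≤ ∫⁻ t in Ioi (0 : ℝ), ENNReal.ofReal (Real.exp (-t) * (min t 1) ^ (-(7 / 8) : ℝ)) *
        ENNReal.ofReal (‖z‖ ^ 2) := by
        refine setLIntegral_mono' measurableSet_Ioi fun t (ht : 0 < t) => ?_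
        dsimp only
        rw [lintegral_const_mul' _ _ ENNReal.ofReal_ne_top]
        exact mul_le_mul_right (lintegral_inner_heatVec_sq_le ht z) _
    _ = ENNReal.ofReal (∫ t in Ioi (0 : ℝ), Real.exp (-t) * (min t 1) ^ (-(7 / 8) : ℝ)) *
        ENNReal.ofReal (‖z‖ ^ 2) := by
        rw [lintegral_mul_const' _ _ ENNReal.ofReal_ne_top, ofReal_integral_eq_lintegral_ofReal
          (integrableOn_exp_mul_rpow (by norm_num))]
        refine (ae_restrict_iff' measurableSet_Ioi).2 (ae_of_all _ fun t (ht : 0 < t) => ?_)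
        have := min_one_pos ht
        simp only [Pi.zero_apply]
        positivity
    _ ≤ _ := by
        gcongr
        unfold energyConst
        linarith

/-- Young's inequality with weight Ks, obtained from (Ks|u| - |y|)² ≥ 0. -/
lemma abs_mul_le_add_sq {K s u y : ℝ} (hK : 0 < K) (hs : 0 < s) :
    |u * y| ≤ 1 / 2 * (K * (s * u ^ 2) + K⁻¹ * (s⁻¹ * y ^ 2)) := by
  have h1 : 0 < K * s := mul_pos hK hs
  have h2 : K * (s * u ^ 2) + K⁻¹ * (s⁻¹ * y ^ 2) =
      ((K * s * |u| - |y|) ^ 2 + 2 * (K * s) * (|u| * |y|)) / (K * s) := by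
    field_simp
    rw [← sq_abs u, ← sq_abs y]
    ring
  rw [h2, abs_mul, mul_div_assoc', le_div_iff₀ h1]
  nlinarith [sq_nonneg (K * s * |u| - |y|)]

/-- Finiteness of x permits absorbing it into the left side, which even gives y/3. -/
lemma ENNReal.le_of_le_quarter {x y : ENNReal} (hx : x ≠ ⊤)
    (h : x ≤ ENNReal.ofReal (1 / 4) * (y + x)) : x ≤ y := by
  rcases eq_or_ne y ⊤ with rfl | hy
  · exact le_top
  lift x to NNReal using hx
  lift y to NNReal using hy
  rw [ENNReal.ofReal, ← ENNReal.coe_add, ← ENNReal.coe_mul, ENNReal.coe_le_coe] at h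
  rw [ENNReal.coe_le_coe]
  rw [← NNReal.coe_le_coe] at h ⊢
  push_cast at h
  rw [Real.coe_toNNReal _ (by norm_num)] at h
  have := x.2
  have := y.2
  have : (0 : ℝ) ≤ y := y.2
  linarith

/-- The energy density of a potential. -/
def energyDensity (h : ℝ → ℝ) (f' : ℝ → ℝ → ℝ) (z : H) (p : ℝ × ℝ) : ENNReal :=
  energyWeight h p * ‖f' (varSeries p.1 p.2) ⟪heatVec p.1 p.2, z⟫_ℝ‖ₑ ^ 2

lemma aemeasurable_energyDensity (hh : Continuous h) (hf : Measurable (Function.uncurry f'))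
    [SFinite μ] (S : Set ℝ) :
    AEMeasurable (fun p : H × ℝ × ℝ => energyDensity h f' p.1 p.2)
      (μ.prod (volST.restrict (Prod.fst ⁻¹' S))) := by
  have h1 : AEStronglyMeasurable (fun p : H × ℝ × ℝ => heatVec p.2.1 p.2.2)
      (μ.prod (volST.restrict (Prod.fst ⁻¹' S))) :=
    (aestronglyMeasurable_heatVec.restrict (s := Prod.fst ⁻¹' S)).comp_snd
  have h2 : AEStronglyMeasurable (fun p : H × ℝ × ℝ => p.1)
      (μ.prod (volST.restrict (Prod.fst ⁻¹' S))) := continuous_fst.aestronglyMeasurable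
  have h3 : AEMeasurable (fun p : H × ℝ × ℝ => (varSeries p.2.1 p.2.2, ⟪heatVec p.2.1 p.2.2, p.1⟫_ℝ))
      (μ.prod (volST.restrict (Prod.fst ⁻¹' S))) :=
    ((continuous_varSeries.comp continuous_snd).measurable.aemeasurable).prodMk
      (h1.inner h2).aemeasurable
  exact ((measurable_energyWeight hh).comp measurable_snd).aemeasurable.mul
    ((hf.comp_aemeasurable h3).enorm.pow_const 2)

/-- Duality: the gradient X is paired with itself inside the integral. Young's inequality separates
the energy density from a multiple of ⟨g_t(r,·), X⟩², whose weighted integral is at most K ‖X‖² by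
the contraction estimate, where K is `energyConst`. That term is absorbed into the left side. -/
lemma enorm_potGrad_sq_le (hh : Continuous h) (hf : Measurable (Function.uncurry f')) (S : Set ℝ)
    (z : H) : ‖potGrad h f' S z‖ₑ ^ 2 ≤
      ENNReal.ofReal energyConst * ∫⁻ p in Prod.fst ⁻¹' S, energyDensity h f' z p ∂volST := by
  -- For sets S that reach down to time 0 integrability is not known; if it fails, the Bochner
  -- integral is 0 and the bound is trivial.
  by_cases hi : IntegrableOn (fun p => potIntegrand h f' z p • heatVec p.1 p.2)
      (Prod.fst ⁻¹' S) volST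
  swap
  · rw [potGrad, integral_undef hi]
    simp
  set X := potGrad h f' S z with hX
  have hK := energyConst_pos
  have hXe : ‖X‖ₑ ^ 2 = ENNReal.ofReal (‖X‖ ^ 2) := by
    rw [ENNReal.ofReal_pow (norm_nonneg _), ofReal_norm]
  refine ENNReal.le_of_le_quarter (by rw [hXe]; exact ENNReal.ofReal_ne_top) ?_
  have h1 : ‖X‖ ^ 2 =
      ∫ p in Prod.fst ⁻¹' S, ⟪X, potIntegrand h f' z p • heatVec p.1 p.2⟫_ℝ ∂volST := by
    rw [integral_inner hi X, ← real_inner_self_eq_norm_sq]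
    rfl
  -- The factor 1/4 is the product of the 1/2 in `potIntegrand` and the 1/2 in Young's inequality.
  have hpt : ∀ p : ℝ × ℝ, 0 < p.1 → ‖⟪X, potIntegrand h f' z p • heatVec p.1 p.2⟫_ℝ‖ₑ ≤
      ENNReal.ofReal (1 / 4) * (ENNReal.ofReal energyConst * energyDensity h f' z p +
        ENNReal.ofReal energyConst⁻¹ *
          (ENNReal.ofReal (Real.exp (-p.1) * (min p.1 1) ^ (-(7 / 8) : ℝ)) *
            ENNReal.ofReal (⟪heatVec p.1 p.2, X⟫_ℝ ^ 2))) := by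
    intro p hp
    have hs : 0 < (min p.1 1) ^ (7 / 8 : ℝ) := Real.rpow_pos_of_pos (min_one_pos hp) _
    rw [Real.rpow_neg (min_one_pos hp).le]
    set s := (min p.1 1) ^ (7 / 8 : ℝ) with hs_def
    set F := f' (varSeries p.1 p.2) ⟪heatVec p.1 p.2, z⟫_ℝ with hF
    set y := ⟪heatVec p.1 p.2, X⟫_ℝ with hy
    have he := Real.exp_pos (-p.1)
    rw [energyDensity, energyWeight, ← hF, ← hs_def, Real.enorm_eq_ofReal_abs F,
      ← ENNReal.ofReal_pow (abs_nonneg F), sq_abs, ← ENNReal.ofReal_mul (by positivity),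
      ← ENNReal.ofReal_mul hK.le, ← ENNReal.ofReal_mul (by positivity),
      ← ENNReal.ofReal_mul (inv_nonneg.2 hK.le), ← ENNReal.ofReal_add (by positivity) (by positivity),
      ← ENNReal.ofReal_mul (by norm_num), Real.enorm_eq_ofReal_abs]
    refine ENNReal.ofReal_le_ofReal ?_
    have h2 := abs_mul_le_add_sq (u := h p.2 * F) (y := y) hK hs
    rw [inner_smul_right, real_inner_comm, ← hy, potIntegrand, ← hF,
      show 1 / 2 * Real.exp (-p.1) * (h p.2 * F) * y =
        1 / 2 * Real.exp (-p.1) * (h p.2 * F * y) by ring, abs_mul, abs_of_nonneg (by positivity :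
          0 ≤ 1 / 2 * Real.exp (-p.1))]
    refine (mul_le_mul_of_nonneg_left h2 (by positivity)).trans (le_of_eq (by ring))
  have hm : AEMeasurable (energyDensity h f' z) volST := by
    have h3 : AEMeasurable (fun p : ℝ × ℝ => (varSeries p.1 p.2, ⟪heatVec p.1 p.2, z⟫_ℝ)) volST :=
      (continuous_varSeries.measurable.aemeasurable).prodMk
        (aestronglyMeasurable_heatVec.inner_const).aemeasurable
    exact (measurable_energyWeight hh).aemeasurable.mul
      ((hf.comp_aemeasurable h3).enorm.pow_const 2)
  calc ‖X‖ₑ ^ 2 ≤ ‖‖X‖ ^ 2‖ₑ := by rw [hXe]; exact Real.ofReal_le_enorm _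
    _ ≤ ∫⁻ p in Prod.fst ⁻¹' S, ‖⟪X, potIntegrand h f' z p • heatVec p.1 p.2⟫_ℝ‖ₑ ∂volST := by
        rw [h1]; exact enorm_integral_le_lintegral_enorm _
    _ ≤ ∫⁻ p in Prod.fst ⁻¹' S, ENNReal.ofReal (1 / 4) * (ENNReal.ofReal energyConst *
        energyDensity h f' z p + ENNReal.ofReal energyConst⁻¹ *
          (ENNReal.ofReal (Real.exp (-p.1) * (min p.1 1) ^ (-(7 / 8) : ℝ)) *
            ENNReal.ofReal (⟪heatVec p.1 p.2, X⟫_ℝ ^ 2))) ∂volST :=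
        lintegral_mono_ae (ae_restrict_of_ae (ae_volST fun p hp _ => hpt p hp))
    _ ≤ _ := by
        rw [lintegral_const_mul' _ _ ENNReal.ofReal_ne_top, lintegral_add_left'
          (hm.restrict.const_mul _), lintegral_const_mul' _ _ ENNReal.ofReal_ne_top,
          lintegral_const_mul' _ _ ENNReal.ofReal_ne_top]
        refine mul_le_mul_right (add_le_add_right ?_ _) _
        refine (mul_le_mul_right ((setLIntegral_le_lintegral _ _).trans
          (lintegral_exp_mul_inner_sq_le X)) _).trans ?_
        rw [← mul_assoc, ← ENNReal.ofReal_mul (inv_nonneg.2 hK.le), inv_mul_cancel₀ hK.ne',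
          ENNReal.ofReal_one, one_mul, hXe]

/-! ### Second moments -/

/-- The second moment of `f(q_t(r), z(t,r))` under `μ`. -/
def secondMoment (μ : Measure H) (f : ℝ → ℝ → ℝ) (p : ℝ × ℝ) : ENNReal :=
  ∫⁻ z, ‖f (varSeries p.1 p.2) ⟪heatVec p.1 p.2, z⟫_ℝ‖ₑ ^ 2 ∂μ

/-- The constant in the bound for the second moment. -/
def momentBound (A δ : ℝ) : ℝ :=
  1 / √(coordVar 0) * (Real.exp (-(eigval (0 + 1) / 2)) * (√2 * δ))⁻¹ *
    (A / varConst δ ^ 2 * (A / (varConst δ * √(varConst δ)))) + (A / varConst δ ^ 2) ^ 2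

/-- The first mode of g_t(r,·) does not degenerate for t ≤ 1 on the support of h. Coordinate 0
therefore gives z(t,r) a density under μ that is bounded uniformly in such t and r. -/
lemma heatCoeff_zero_ge (hc : IsCutoff h δ D) {t r : ℝ} (ht1 : t ≤ 1) (hr : h r ≠ 0) :
    Real.exp (-(eigval (0 + 1) / 2)) * (√2 * δ) ≤ heatCoeff t r 0 := by
  have h1 := eigval_pos 0
  have h2 := hc.sin_ge r hr
  have h3 := hc.pos
  rw [heatCoeff, e]
  rw [show (((0 + 1 : ℕ) : ℝ)) = 1 by norm_num, one_mul]
  gcongr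
  nlinarith

/-- For t ≤ 1 the bounded density reduces the moment to ∫|f'|² ≤ sup|f'| · ∫|f'|, of order t^(-1)
t^(-3/4). For t ≥ 1 the first mode decays, but the sup bound is already enough. -/
lemma IsAdmissible.secondMoment_le (hμ : IsBridgeLaw μ) (hf : IsAdmissible A f f')
    (hc : IsCutoff h δ D) {p : ℝ × ℝ} (hp : 0 < p.1) (hr : h p.2 ≠ 0) :
    secondMoment μ f' p ≤ ENNReal.ofReal (momentBound A δ * (min p.1 1) ^ (-(7 / 4) : ℝ)) := by
  have hP := hμ.isProbabilityMeasure
  have hq := hc.varSeries_pos hp hr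
  have hA := hf.nonneg
  have hv := varConst_pos hc.pos
  have hδ := hc.pos
  have hcv := coordVar_pos 0
  have hmeas : Measurable (f' (varSeries p.1 p.2)) :=
    hf.measurable_deriv.comp (by fun_prop : Measurable fun x : ℝ => (varSeries p.1 p.2, x))
  have hb : ∀ x, ‖f' (varSeries p.1 p.2) x‖ₑ ≤
      ENNReal.ofReal (A / varConst δ ^ 2 * (min p.1 1)⁻¹) := fun x => by
    rw [Real.enorm_eq_ofReal_abs]
    exact ENNReal.ofReal_le_ofReal ((hf.bound_deriv _ hq x).trans (hc.div_sq_le hA hp hr))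
  rcases le_total p.1 1 with h1 | h1
  · have h2 := heatCoeff_zero_ge hc h1 hr
    have h3 : 0 < Real.exp (-(eigval (0 + 1) / 2)) * (√2 * δ) := by positivity
    have h4 : ⟪eH 0, heatVec p.1 p.2⟫_ℝ = heatCoeff p.1 p.2 0 := inner_eH_heatVec hp p.2 0
    have h5 := hμ.lintegral_inner_le 0 (l := heatVec p.1 p.2)
      (by rw [h4]; exact (h3.trans_le h2).ne') (g := fun x => ‖f' (varSeries p.1 p.2) x‖ₑ ^ 2)
      (hmeas.enorm.pow_const 2)
    refine h5.trans ?_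
    have h6 : ∫⁻ x, ‖f' (varSeries p.1 p.2) x‖ₑ ^ 2 ≤
        ENNReal.ofReal (A / varConst δ ^ 2 * (min p.1 1)⁻¹) *
          ENNReal.ofReal (A / (varConst δ * √(varConst δ)) * (min p.1 1) ^ (-(3 / 4) : ℝ)) := by
      refine (lintegral_mono fun x => (sq ‖f' (varSeries p.1 p.2) x‖ₑ).trans_le
        (mul_le_mul_left (hb x) _)).trans ?_
      rw [lintegral_const_mul' _ _ ENNReal.ofReal_ne_top]
      refine mul_le_mul_right ((hf.lintegral_deriv _ hq).trans ?_) _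
      exact ENNReal.ofReal_le_ofReal (hc.div_mul_sqrt_le hA hp hr)
    have h7 : |(⟪eH 0, heatVec p.1 p.2⟫_ℝ)⁻¹| ≤
        (Real.exp (-(eigval (0 + 1) / 2)) * (√2 * δ))⁻¹ := by
      rw [h4, abs_of_nonneg (inv_nonneg.2 (h3.trans_le h2).le)]
      exact inv_anti₀ h3 h2
    refine (mul_le_mul' (mul_le_mul_right (ENNReal.ofReal_le_ofReal h7) _) h6).trans ?_
    have hm := min_one_pos hp
    rw [← ENNReal.ofReal_mul (by positivity), ← ENNReal.ofReal_mul (by positivity),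
      ← ENNReal.ofReal_mul (by positivity)]
    refine ENNReal.ofReal_le_ofReal ?_
    rw [momentBound, show (-(7 / 4) : ℝ) = -1 + -(3 / 4) by norm_num, Real.rpow_add hm,
      Real.rpow_neg_one, add_mul]
    refine le_add_of_le_of_nonneg (le_of_eq (by ring)) (by positivity)
  · refine (lintegral_mono fun z => pow_le_pow_left' (hb _) 2).trans ?_
    rw [lintegral_const, measure_univ, mul_one, min_eq_right h1, Real.one_rpow, inv_one, mul_one,
      mul_one, ← ENNReal.ofReal_pow (by positivity)]
    refine ENNReal.ofReal_le_ofReal ?_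
    rw [momentBound]
    refine le_add_of_nonneg_left (by positivity)

/-- The exponent 7/8 balances the two sides of Young's inequality: the weight times t^(-7/4) and the
inverse weight are both t^(-7/8). -/
lemma IsAdmissible.energyWeight_mul_secondMoment_le (hμ : IsBridgeLaw μ) (hf : IsAdmissible A f f')
    (hc : IsCutoff h δ D) {p : ℝ × ℝ} (hp : 0 < p.1) :
    energyWeight h p * secondMoment μ f' p ≤ ENNReal.ofReal
      (D ^ 2 * momentBound A δ * (Real.exp (-p.1) * (min p.1 1) ^ (-(7 / 8) : ℝ))) := by
  by_cases hr : h p.2 = 0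
  · rw [energyWeight, hr]
    simp
  have hm := min_one_pos hp
  refine (mul_le_mul_right (hf.secondMoment_le hμ hc hp hr) _).trans ?_
  rw [energyWeight, ← ENNReal.ofReal_mul (by positivity)]
  refine ENNReal.ofReal_le_ofReal ?_
  have hA := hf.nonneg
  have hv := varConst_pos hc.pos
  have hδ := hc.pos
  have hB : 0 ≤ momentBound A δ := by unfold momentBound; positivity
  have h1 : h p.2 ^ 2 ≤ D ^ 2 := sq_le_sq' (neg_le_of_abs_le (hc.bound _)) (le_of_abs_le (hc.bound _))
  rw [show (-(7 / 8) : ℝ) = 7 / 8 + -(7 / 4) by norm_num, Real.rpow_add hm]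
  calc _ ≤ Real.exp (-p.1) * min p.1 1 ^ (7 / 8 : ℝ) * D ^ 2 *
        (momentBound A δ * min p.1 1 ^ (-(7 / 4) : ℝ)) := by gcongr
    _ = _ := by ring

lemma integrable_energyMajorant (C : ℝ) : Integrable (fun p : ℝ × ℝ =>
    C * (Real.exp (-p.1) * (min p.1 1) ^ (-(7 / 8) : ℝ))) volST :=
  (integrable_volST_of_fst (integrableOn_exp_mul_rpow (a := 7 / 8) (by norm_num))).const_mul C

lemma IsAdmissible.lintegral_energy_ne_top (hμ : IsBridgeLaw μ) (hf : IsAdmissible A f f')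
    (hc : IsCutoff h δ D) : ∫⁻ p, energyWeight h p * secondMoment μ f' p ∂volST ≠ ⊤ :=
  ((lintegral_mono_ae (ae_volST fun _ hp _ => hf.energyWeight_mul_secondMoment_le hμ hc hp)).trans_lt
    (integrable_energyMajorant _).lintegral_lt_top).ne

lemma IsAdmissible.lintegral_potGrad_le (hμ : IsBridgeLaw μ) (hf : IsAdmissible A f f')
    (hc : IsCutoff h δ D) (S : Set ℝ) :
    ∫⁻ z, ‖potGrad h f' S z‖ₑ ^ 2 ∂μ ≤ ENNReal.ofReal energyConst *
      ∫⁻ p in Prod.fst ⁻¹' S, energyWeight h p * secondMoment μ f' p ∂volST := by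
  have hP := hμ.isProbabilityMeasure
  refine (lintegral_mono fun z => enorm_potGrad_sq_le hc.continuous hf.measurable_deriv S z).trans ?_
  rw [lintegral_const_mul' _ _ ENNReal.ofReal_ne_top, lintegral_lintegral_swap
    (aemeasurable_energyDensity hc.continuous hf.measurable_deriv S)]
  refine mul_le_mul_right (le_of_eq (lintegral_congr fun p => ?_)) _
  simp only [energyDensity, energyWeight]
  rw [lintegral_const_mul' _ _ ENNReal.ofReal_ne_top]
  rfl

end

section

variable {h : ℝ → ℝ} {δ D A : ℝ} {f f' : ℝ → ℝ → ℝ} {μ : Measure H}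

/-! ### The potentials are in `W^{1,2}(μ)` -/

/-- The bound for the energy of the part in the times `S` of a potential. -/
def energyBound (μ : Measure H) (h : ℝ → ℝ) (f' : ℝ → ℝ → ℝ) (S : Set ℝ) : ENNReal :=
  ENNReal.ofReal energyConst *
    ∫⁻ p in Prod.fst ⁻¹' S, energyWeight h p * secondMoment μ f' p ∂volST

lemma energyBound_mono {S T : Set ℝ} (hST : S ⊆ T) :
    energyBound μ h f' S ≤ energyBound μ h f' T :=
  mul_le_mul_right (lintegral_mono_set (preimage_mono hST)) _

lemma IsAdmissible.eLpNorm_potGrad_le (hμ : IsBridgeLaw μ) (hf : IsAdmissible A f f')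
    (hc : IsCutoff h δ D) (S : Set ℝ) :
    eLpNorm (potGrad h f' S) 2 μ ≤ energyBound μ h f' S ^ (2 : ℝ)⁻¹ := by
  rw [ENNReal.le_rpow_inv_iff two_pos, ENNReal.rpow_two, eLpNorm_two_sq]
  exact hf.lintegral_potGrad_le hμ hc S

lemma IsAdmissible.potGrad_sub (hf : IsAdmissible A f f') (hc : IsCutoff h δ D) {a b : ℝ}
    (ha : 0 < a) (hab : a ≤ b) (z : H) :
    potGrad h f' (Ioi a) z - potGrad h f' (Ioi b) z = potGrad h f' (Ioi a \ Ioi b) z :=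
  (setIntegral_sdiff (measurable_fst measurableSet_Ioi) (hf.integrableOn_smul_heatVec hc z ha)
    (preimage_mono (Ioi_subset_Ioi hab))).symm

lemma volST_fst_preimage_Iic_le (a : ℝ) :
    volST (Prod.fst ⁻¹' Iic a) ≤ ENNReal.ofReal a := by
  rw [volST_eq_prod, show (Prod.fst ⁻¹' Iic a : Set (ℝ × ℝ)) = Iic a ×ˢ univ by ext; simp,
    Measure.prod_prod, Measure.restrict_apply measurableSet_Iic, Iic_inter_Ioi]
  simp

lemma tendsto_one_div_add_one : Tendsto (fun n : ℕ => 1 / ((n : ℝ) + 1)) atTop (𝓝 0) :=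
  tendsto_one_div_add_atTop_nhds_zero_nat

/-- Absolute continuity of the finite energy integral, as the time strips shrink to measure zero. -/
lemma IsAdmissible.tendsto_energyBound (hμ : IsBridgeLaw μ) (hf : IsAdmissible A f f')
    (hc : IsCutoff h δ D) :
    Tendsto (fun n : ℕ => energyBound μ h f' (Iic (1 / ((n : ℝ) + 1)))) atTop (𝓝 0) := by
  have h1 : Tendsto (fun n : ℕ => volST (Prod.fst ⁻¹' Iic (1 / ((n : ℝ) + 1)))) atTop (𝓝 0) := by
    have h2 := ENNReal.tendsto_ofReal tendsto_one_div_add_one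
    rw [ENNReal.ofReal_zero] at h2
    exact tendsto_of_tendsto_of_tendsto_of_le_of_le tendsto_const_nhds h2 (fun n => zero_le)
      fun n => volST_fst_preimage_Iic_le _
  have h3 := ENNReal.Tendsto.const_mul (a := ENNReal.ofReal energyConst)
    (tendsto_setLIntegral_zero (hf.lintegral_energy_ne_top hμ hc) h1)
    (Or.inr ENNReal.ofReal_ne_top)
  rwa [mul_zero] at h3

lemma IsAdmissible.tendsto_pot (hf : IsAdmissible A f f') (hc : IsCutoff h δ D) (z : H) :
    Tendsto (fun n : ℕ => pot h f (Ioi (1 / ((n : ℝ) + 1))) z) atTop (𝓝 (pot h f (Ioi 0) z)) := by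
  have h1 : (⋃ n : ℕ, Prod.fst ⁻¹' Ioi (1 / ((n : ℝ) + 1)) : Set (ℝ × ℝ)) =
      Prod.fst ⁻¹' Ioi (0 : ℝ) := by
    rw [← preimage_iUnion]
    congr 1
    ext t
    simp only [mem_iUnion, mem_Ioi]
    exact ⟨fun ⟨n, hn⟩ => (by positivity : (0 : ℝ) < 1 / ((n : ℝ) + 1)).trans hn,
      fun ht => exists_nat_one_div_lt ht⟩
  have h2 := tendsto_setIntegral_of_monotone (μ := volST) (f := potIntegrand h f z)
    (s := fun n : ℕ => (Prod.fst ⁻¹' Ioi (1 / ((n : ℝ) + 1)) : Set (ℝ × ℝ)))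
    (fun n => measurable_fst measurableSet_Ioi)
    (fun m n hmn => preimage_mono (Ioi_subset_Ioi (by gcongr)))
    (hf.integrable_potIntegrand hc z).integrableOn
  rw [h1] at h2
  exact h2

lemma IsAdmissible.aestronglyMeasurable_pot (hμ : IsBridgeLaw μ) (hf : IsAdmissible A f f')
    (hc : IsCutoff h δ D) : AEStronglyMeasurable (pot h f (Ioi 0)) μ := by
  have hP := hμ.isProbabilityMeasure
  refine aestronglyMeasurable_of_tendsto_ae atTop
    (f := fun n : ℕ => pot h f (Ioi (1 / ((n : ℝ) + 1)))) (fun n => ?_)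
    (ae_of_all _ fun z => hf.tendsto_pot hc z)
  exact (hf.hasSobolevGradient_pot hc (by positivity)).memLp.1

/-- The potential of an admissible kernel is in `W^{1,2}(μ)`. -/
lemma IsAdmissible.exists_hasSobolevGradient (hμ : IsBridgeLaw μ) (hf : IsAdmissible A f f')
    (hc : IsCutoff h δ D) : ∃ g, HasSobolevGradient μ (pot h f (Ioi 0)) g ∧
      ∫⁻ z, ‖g z‖ₑ ^ 2 ∂μ ≤ energyBound μ h f' univ := by
  have hP := hμ.isProbabilityMeasure
  set a : ℕ → ℝ := fun n => 1 / ((n : ℝ) + 1) with ha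
  have ha0 : ∀ n, 0 < a n := fun n => by rw [ha]; positivity
  have hS : ∀ n, HasSobolevGradient μ (pot h f (Ioi (a n))) (potGrad h f' (Ioi (a n))) :=
    fun n => hf.hasSobolevGradient_pot hc (ha0 n)
  have hanti : ∀ {m n : ℕ}, m ≤ n → a n ≤ a m := fun hmn => by simp only [ha]; gcongr
  -- Two truncated gradients differ by the part with times in (a_n, a_m], whose energy is at most
  -- that of the strip t ≤ a_N. Hence the truncations are Cauchy in L²(μ;H).
  have key : ∀ N m n : ℕ, N ≤ m → m ≤ n →
      eLpNorm (potGrad h f' (Ioi (a n)) - potGrad h f' (Ioi (a m))) 2 μ ≤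
        energyBound μ h f' (Iic (a N)) ^ (2 : ℝ)⁻¹ := by
    intro N m n hNm hmn
    have h1 : potGrad h f' (Ioi (a n)) - potGrad h f' (Ioi (a m)) =
        potGrad h f' (Ioi (a n) \ Ioi (a m)) :=
      funext fun z => hf.potGrad_sub hc (ha0 n) (hanti hmn) z
    rw [h1]
    refine (hf.eLpNorm_potGrad_le hμ hc _).trans ?_
    refine ENNReal.rpow_le_rpow (energyBound_mono fun t ht => ?_) (by norm_num)
    exact (not_lt.1 ht.2).trans (hanti hNm)
  set u : ℕ → Lp H 2 μ := fun n => (hS n).memLp_grad.toLp with hu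
  have hcau : CauchySeq u := by
    rw [EMetric.cauchySeq_iff_le_tendsto_0]
    refine ⟨fun N => energyBound μ h f' (Iic (a N)) ^ (2 : ℝ)⁻¹, fun n m N hn hm => ?_, ?_⟩
    · rcases le_total m n with hmn | hmn
      · rw [hu, Lp.edist_toLp_toLp]
        exact key N m n hm hmn
      · rw [edist_comm, hu, Lp.edist_toLp_toLp]
        exact key N n m hn hmn
    · have := (ENNReal.continuous_rpow_const (y := (2 : ℝ)⁻¹)).tendsto 0 |>.comp
        (hf.tendsto_energyBound hμ hc)
      rwa [ENNReal.zero_rpow_of_pos (by norm_num)] at this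
  obtain ⟨g, hg⟩ := cauchySeq_tendsto_of_complete hcau
  have hgt : Tendsto (fun n => eLpNorm (fun z => potGrad h f' (Ioi (a n)) z - g z) 2 μ) atTop
      (𝓝 0) := by
    have h1 := (tendsto_iff_edist_tendsto_0).1 hg
    refine h1.congr fun n => ?_
    rw [Lp.edist_def]
    refine eLpNorm_congr_ae ?_
    filter_upwards [(hS n).memLp_grad.coeFn_toLp] with z hz
    rw [Pi.sub_apply, hu, hz]
  refine ⟨g, HasSobolevGradient.of_tendsto hS ?_ (Lp.memLp g) ?_ hgt, ?_⟩
  · exact MemLp.of_bound (hf.aestronglyMeasurable_pot hμ hc) _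
      (ae_of_all _ fun z => (Real.norm_eq_abs _).trans_le (hf.abs_pot_le hc _ z))
  · refine tendsto_eLpNorm_of_bounded (2 * ∫ p, potBound A δ D *
      (Real.exp (-p.1) * (min p.1 1) ^ (-(3 / 4) : ℝ)) ∂volST)
      (Eventually.of_forall fun n => (hS n).memLp.1) (hf.aestronglyMeasurable_pot hμ hc)
      (Eventually.of_forall fun n => ae_of_all _ fun z => ?_)
      (ae_of_all _ fun z => hf.tendsto_pot hc z)
    rw [two_mul]
    exact (norm_sub_le _ _).trans (add_le_add (hf.abs_pot_le hc _ z) (hf.abs_pot_le hc _ z))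
  · have h1 : Tendsto (fun n => ‖u n‖ₑ) atTop (𝓝 ‖g‖ₑ) := hg.enorm
    have h2 : ‖g‖ₑ ≤ energyBound μ h f' univ ^ (2 : ℝ)⁻¹ := by
      refine le_of_tendsto h1 (Eventually.of_forall fun n => ?_)
      rw [hu, Lp.enorm_toLp]
      exact (hf.eLpNorm_potGrad_le hμ hc _).trans
        (ENNReal.rpow_le_rpow (energyBound_mono (subset_univ _)) (by norm_num))
    rw [Lp.enorm_def, ENNReal.le_rpow_inv_iff two_pos, ENNReal.rpow_two, eLpNorm_two_sq] at h2
    exact h2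

end

section

variable {h : ℝ → ℝ} {δ D A : ℝ} {f f' : ℝ → ℝ → ℝ} {μ : Measure H}

/-! ### Convergence of potentials in `W^{1,2}(μ)` -/

/-- Uniqueness allows the gradient selected by choice in `sobolevGradient` to be replaced by any
known one. -/
lemma HasSobolevGradient.formΛ₁_eq (hμ : IsBridgeLaw μ) {F : H → ℝ} {g : H → H}
    (hF : HasSobolevGradient μ F g) :
    formΛ₁ μ F F = 1 / 2 * (∫⁻ z, ‖g z‖ₑ ^ 2 ∂μ).toReal + ∫ z, F z * F z ∂μ := by
  have hex : ∃ g, HasSobolevGradient μ F g := ⟨g, hF⟩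
  have h1 : sobolevGradient μ F =ᵐ[μ] g := by
    rw [sobolevGradient, dif_pos hex]
    exact hex.choose_spec.unique hμ hF
  rw [formΛ₁, formΛ]
  congr 2
  rw [integral_congr_ae (g := fun z => ‖g z‖ ^ 2), integral_eq_lintegral_of_nonneg_ae
    (f := fun z => ‖g z‖ ^ 2) (ae_of_all _ fun z => by positivity)
    (hF.memLp_grad.1.norm.pow 2)]
  · congr 2 with z
    rw [ENNReal.ofReal_pow (norm_nonneg _), ofReal_norm]
  · filter_upwards [h1] with z hz
    rw [hz, real_inner_self_eq_norm_sq]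

section Family

variable {ι : Type*} {l : Filter ι} [l.IsCountablyGenerated] {F F' : ι → ℝ → ℝ → ℝ}

lemma tendsto_pot_zero (hF : ∀ i, IsAdmissible A (F i) (F' i)) (hc : IsCutoff h δ D)
    (h0 : ∀ q, 0 < q → ∀ x, Tendsto (fun i => F i q x) l (𝓝 0)) (z : H) :
    Tendsto (fun i => pot h (F i) (Ioi 0) z) l (𝓝 0) := by
  have h1 : Tendsto (fun i => pot h (F i) (Ioi 0) z) l
      (𝓝 (∫ _ in Prod.fst ⁻¹' Ioi (0 : ℝ), (0 : ℝ) ∂volST)) := by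
    refine tendsto_integral_filter_of_dominated_convergence _
      (Eventually.of_forall fun i =>
        (aestronglyMeasurable_potIntegrand hc.continuous (hF i).measurable z).restrict)
      (Eventually.of_forall fun i => ae_strip fun p hp =>
        (Real.norm_eq_abs _).trans_le ((hF i).abs_potIntegrand_le hc z hp))
      (integrable_potMajorant _).integrableOn (ae_strip fun p hp => ?_)
    have h2 : Tendsto (fun i => h p.2 * F i (varSeries p.1 p.2) ⟪heatVec p.1 p.2, z⟫_ℝ) l (𝓝 0) := by
      by_cases hr : h p.2 = 0
      · simp only [hr, zero_mul]
        exact tendsto_const_nhds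
      · have := (h0 _ (hc.varSeries_pos hp hr) ⟪heatVec p.1 p.2, z⟫_ℝ).const_mul (h p.2)
        rwa [mul_zero] at this
    have h3 := h2.const_mul (1 / 2 * Real.exp (-p.1))
    rwa [mul_zero] at h3
  rwa [integral_zero] at h1

lemma tendsto_secondMoment_zero (hμ : IsBridgeLaw μ) (hF : ∀ i, IsAdmissible A (F i) (F' i))
    (h0 : ∀ q, 0 < q → ∀ x, Tendsto (fun i => F' i q x) l (𝓝 0)) {p : ℝ × ℝ}
    (hp : 0 < varSeries p.1 p.2) : Tendsto (fun i => secondMoment μ (F' i) p) l (𝓝 0) := by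
  have hP := hμ.isProbabilityMeasure
  have h1 : Tendsto (fun i => secondMoment μ (F' i) p) l (𝓝 (∫⁻ _, 0 ∂μ)) := by
    refine tendsto_lintegral_filter_of_dominated_convergence
      (fun _ => ENNReal.ofReal (A / varSeries p.1 p.2 ^ 2) ^ 2) (Eventually.of_forall fun i => ?_)
      (Eventually.of_forall fun i => ae_of_all _ fun z => ?_) ?_ (ae_of_all _ fun z => ?_)
    · exact (((hF i).continuous_deriv _ hp).measurable.comp (by fun_prop)).enorm.pow_const 2
    · rw [Real.enorm_eq_ofReal_abs]
      exact pow_le_pow_left' (ENNReal.ofReal_le_ofReal ((hF i).bound_deriv _ hp _)) 2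
    · rw [lintegral_const, measure_univ, mul_one]
      exact ENNReal.pow_ne_top ENNReal.ofReal_ne_top
    · have h2 := (h0 _ hp ⟪heatVec p.1 p.2, z⟫_ℝ).enorm
      have h3 := (ENNReal.continuous_pow 2).tendsto _ |>.comp h2
      simpa [Function.comp_def] using h3
  rwa [lintegral_zero] at h1

/-- The domination of the weighted second moments involves the kernels only through A, so it holds
for the whole family at once. -/
lemma tendsto_energyBound_zero (hμ : IsBridgeLaw μ) (hF : ∀ i, IsAdmissible A (F i) (F' i))
    (hc : IsCutoff h δ D) (h0 : ∀ q, 0 < q → ∀ x, Tendsto (fun i => F' i q x) l (𝓝 0)) :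
    Tendsto (fun i => energyBound μ h (F' i) univ) l (𝓝 0) := by
  have hP := hμ.isProbabilityMeasure
  simp only [energyBound, preimage_univ, Measure.restrict_univ]
  have h1 : Tendsto (fun i => ∫⁻ p, energyWeight h p * secondMoment μ (F' i) p ∂volST) l
      (𝓝 (∫⁻ _, 0 ∂volST)) := by
    refine tendsto_lintegral_filter_of_dominated_convergence' _ (Eventually.of_forall fun i => ?_)
      (Eventually.of_forall fun i => ae_volST fun _ hp _ =>
        (hF i).energyWeight_mul_secondMoment_le hμ hc hp)
      (integrable_energyMajorant _).lintegral_lt_top.ne (ae_volST fun p hp _ => ?_)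
    · have h2 := (aemeasurable_energyDensity (μ := μ) hc.continuous (hF i).measurable_deriv
        univ).lintegral_prod_left'
      rw [preimage_univ, Measure.restrict_univ] at h2
      refine h2.congr (ae_of_all _ fun p => ?_)
      simp only [energyDensity, energyWeight]
      rw [lintegral_const_mul' _ _ ENNReal.ofReal_ne_top]
      rfl
    · by_cases hr : h p.2 = 0
      · simp only [energyWeight, hr]
        simpa using tendsto_const_nhds
      · have h3 := ENNReal.Tendsto.const_mul (a := energyWeight h p)
          (tendsto_secondMoment_zero hμ hF h0 (hc.varSeries_pos hp hr))
          (Or.inr ENNReal.ofReal_ne_top)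
        rwa [mul_zero] at h3
  rw [lintegral_zero] at h1
  have h4 := ENNReal.Tendsto.const_mul (a := ENNReal.ofReal energyConst) h1
    (Or.inr ENNReal.ofReal_ne_top)
  rwa [mul_zero] at h4

/-- The gradient part is controlled by the energy bound, and the L² part by uniform boundedness with
pointwise convergence. No convergence of the gradients themselves has to be identified. -/
lemma tendsto_formΛ₁_pot_zero (hμ : IsBridgeLaw μ) (hF : ∀ i, IsAdmissible A (F i) (F' i))
    (hc : IsCutoff h δ D) (h0 : ∀ q, 0 < q → ∀ x, Tendsto (fun i => F i q x) l (𝓝 0))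
    (h0' : ∀ q, 0 < q → ∀ x, Tendsto (fun i => F' i q x) l (𝓝 0)) :
    Tendsto (fun i => formΛ₁ μ (pot h (F i) (Ioi 0)) (pot h (F i) (Ioi 0))) l (𝓝 0) := by
  have hP := hμ.isProbabilityMeasure
  choose g hg hgb using fun i => (hF i).exists_hasSobolevGradient hμ hc
  simp_rw [fun i => (hg i).formΛ₁_eq hμ]
  have h1 : Tendsto (fun i => (∫⁻ z, ‖g i z‖ₑ ^ 2 ∂μ).toReal) l (𝓝 0) := by
    have h2 := tendsto_of_tendsto_of_tendsto_of_le_of_le tendsto_const_nhds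
      (tendsto_energyBound_zero hμ hF hc h0') (fun i => zero_le) hgb
    have h3 := (ENNReal.tendsto_toReal ENNReal.zero_ne_top).comp h2
    rwa [ENNReal.toReal_zero] at h3
  obtain ⟨C, hC⟩ : ∃ C, ∀ i z, |pot h (F i) (Ioi 0) z| ≤ C :=
    ⟨_, fun i z => (hF i).abs_pot_le hc _ z⟩
  have h4 : Tendsto (fun i => ∫ z, pot h (F i) (Ioi 0) z * pot h (F i) (Ioi 0) z ∂μ) l
      (𝓝 (∫ _, (0 : ℝ) ∂μ)) := by
    refine tendsto_integral_filter_of_dominated_convergence (fun _ => C * C)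
      (Eventually.of_forall fun i => (hg i).memLp.1.mul (hg i).memLp.1)
      (Eventually.of_forall fun i => ae_of_all _ fun z => ?_) (integrable_const _)
      (ae_of_all _ fun z => ?_)
    · rw [norm_mul]
      exact mul_le_mul (hC i z) (hC i z) (norm_nonneg _) ((abs_nonneg _).trans (hC i z))
    · have h5 := tendsto_pot_zero hF hc h0 z
      simpa using h5.mul h5
  rw [integral_zero] at h4
  have h5 := (h1.const_mul (1 / 2 : ℝ)).add h4
  rwa [mul_zero, add_zero] at h5

end Family

/-! ### Potentials as iterated integrals -/

lemma pot_Ioi_zero (h : ℝ → ℝ) (f : ℝ → ℝ → ℝ) (z : H) :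
    pot h f (Ioi 0) z = ∫ p, potIntegrand h f z p ∂volST := by
  rw [pot, Measure.restrict_restrict (measurable_fst measurableSet_Ioi)]
  congr 2
  ext p
  simp +contextual

lemma integral_potIntegrand (h : ℝ → ℝ) (f : ℝ → ℝ → ℝ) (z : H) (t : ℝ) :
    ∫ r in Ioo (0 : ℝ) 1, potIntegrand h f z (t, r) = Real.exp (-t) *
      ((1 / 2) * ∫ r in Ioo (0 : ℝ) 1, h r * f (varSeries t r) ⟪heatVec t r, z⟫_ℝ) := by
  simp only [potIntegrand]
  rw [integral_const_mul]
  ring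

lemma IsAdmissible.integrableOn_iterated (hf : IsAdmissible A f f') (hc : IsCutoff h δ D) (z : H) :
    IntegrableOn (fun t => Real.exp (-t) *
      ((1 / 2) * ∫ r in Ioo (0 : ℝ) 1, h r * f (varSeries t r) ⟪heatVec t r, z⟫_ℝ)) (Ioi 0) := by
  have h1 := hf.integrable_potIntegrand hc z
  rw [volST_eq_prod] at h1
  have h2 := h1.integral_prod_left
  simp_rw [integral_potIntegrand] at h2
  exact h2

lemma IsAdmissible.pot_eq_iterated (hf : IsAdmissible A f f') (hc : IsCutoff h δ D) (z : H) :
    pot h f (Ioi 0) z = ∫ t in Ioi (0 : ℝ), Real.exp (-t) *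
      ((1 / 2) * ∫ r in Ioo (0 : ℝ) 1, h r * f (varSeries t r) ⟪heatVec t r, z⟫_ℝ) := by
  have h1 := hf.integrable_potIntegrand hc z
  rw [pot_Ioi_zero]
  rw [volST_eq_prod] at h1 ⊢
  rw [integral_prod _ h1]
  simp_rw [integral_potIntegrand]

lemma IsAdmissible.integrableOn_space (hf : IsAdmissible A f f') (hc : IsCutoff h δ D) {t : ℝ}
    (ht : 0 < t) (z : H) :
    IntegrableOn (fun r => h r * f (varSeries t r) ⟪heatVec t r, z⟫_ℝ) (Ioo 0 1) := by
  have h1 : Continuous fun r => heatVec t r :=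
    continuousOn_heatVec.comp_continuous (by fun_prop : Continuous fun r : ℝ => (t, r))
      fun r => ⟨ht, mem_univ _⟩
  have h2 : Continuous fun r => (varSeries t r, ⟪heatVec t r, z⟫_ℝ) :=
    (continuous_varSeries.comp (by fun_prop : Continuous fun r : ℝ => (t, r))).prodMk
      (h1.inner continuous_const)
  have hA := hf.nonneg
  have hv := varConst_pos hc.pos
  have hD := hc.bound_nonneg
  have hm := min_one_pos ht
  refine (integrable_const (D * (A / (varConst δ * √(varConst δ)) *
    (min t 1) ^ (-(3 / 4) : ℝ)))).mono' (hc.continuous.measurable.mul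
      (hf.measurable.comp h2.measurable)).aestronglyMeasurable (ae_of_all _ fun r => ?_)
  by_cases hr : h r = 0
  · rw [hr, zero_mul, norm_zero]
    positivity
  · rw [norm_mul]
    exact mul_le_mul (hc.bound r) ((hf.bound _ (hc.varSeries_pos ht hr) _).trans
      (hc.div_mul_sqrt_le hA ht hr)) (norm_nonneg _) hD

lemma IsAdmissible.pot_sub {B : ℝ} {g g' : ℝ → ℝ → ℝ} (hf : IsAdmissible A f f')
    (hg : IsAdmissible B g g') (hc : IsCutoff h δ D) (z : H) :
    pot h f (Ioi 0) z - pot h g (Ioi 0) z = pot h (fun q x => f q x - g q x) (Ioi 0) z := by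
  rw [pot, pot, pot, ← integral_sub (hf.integrable_potIntegrand hc z).integrableOn
    (hg.integrable_potIntegrand hc z).integrableOn]
  congr 1 with p
  simp only [potIntegrand]
  ring

/-- The lower bound δ is the minimum of sin(πr) over the compact support, positive because the
support lies inside (0,1); for an empty support any δ serves. -/
lemma exists_isCutoff (hh : Continuous h) (hh_compact : HasCompactSupport h)
    (hh_supp : tsupport h ⊆ Ioo 0 1) : ∃ δ D, IsCutoff h δ D := by
  obtain ⟨D, hD⟩ := hh_compact.exists_bound_of_continuous hh
  have hmem : ∀ r, h r ≠ 0 → r ∈ tsupport h := fun r hr => subset_tsupport h hr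
  rcases (tsupport h).eq_empty_or_nonempty with he | hne
  · exact ⟨1, D, hh, one_pos, hD, fun r hr => hh_supp (hmem r hr),
      fun r hr => absurd (hmem r hr) (by simp [he])⟩
  · obtain ⟨r₀, hr₀, hmin⟩ := hh_compact.isCompact.exists_isMinOn hne
      (f := fun r => Real.sin (Real.pi * r)) (by fun_prop)
    refine ⟨Real.sin (Real.pi * r₀), D, hh, ?_, hD, fun r hr => hh_supp (hmem r hr),
      fun r hr => hmin (hmem r hr)⟩
    have := hh_supp hr₀
    have hpi := Real.pi_pos
    exact Real.sin_pos_of_pos_of_lt_pi (mul_pos hpi this.1) (by nlinarith [this.2])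

end

end StochHeat

end

/-! ### The main theorem. -/

theorem proposition5
    -- a space-time white noise and the solutions of the stochastic heat equation driven by it
    {Ω : Type*} [MeasurableSpace Ω] (P : Measure Ω) [IsProbabilityMeasure P]
    (ξ : Lp ℝ 2 StochHeat.volST →ₗᵢ[ℝ] Lp ℝ 2 P) (hξ : StochHeat.IsWhiteNoise P ξ)
    (v : StochHeat.H → ℝ → ℝ → Ω → ℝ) (hv : ∀ z, StochHeat.IsSHESolution ξ z (v z))
    -- a Brownian bridge and its law on `H`
    {Ω' : Type*} [MeasurableSpace Ω'] (P' : Measure Ω') [IsProbabilityMeasure P']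
    (β : ℝ → Ω' → ℝ) (hβ : StochHeat.IsBrownianBridge P' β)
    (μ : Measure StochHeat.H) (hμ : μ = StochHeat.lawOnH P' β)
    -- the function `h` of class `C²` with compact support in `(0,1)`
    (h : ℝ → ℝ) (hh : ContDiff ℝ 2 h) (hh_compact : HasCompactSupport h)
    (hh_supp : tsupport h ⊆ Ioo 0 1)
    -- the mollifier `ρ`
    (ρ : ℝ → ℝ) (hρ : ContDiff ℝ (⊤ : ℕ∞) ρ) (hρ_supp : Function.support ρ ⊆ Icc (-1) 1)
    (hρ_nonneg : ∀ y, 0 ≤ ρ y) (hρ_int : ∫ y in Icc (-1 : ℝ) 1, ρ y = 1)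
    (hρ_even : ∀ y, ρ (-y) = ρ y) :
    -- the integrals that define `U` and `U_ε` converge absolutely at every point of `H`
    (∀ z, (∀ t, 0 < t → IntegrableOn (StochHeat.GtIntegrand h t z) (Ioo 0 1)) ∧
      IntegrableOn (fun t => Real.exp (-t) * StochHeat.Gt h t z) (Ioi 0)) ∧
    (∀ ε, 0 < ε → ∀ z, IntegrableOn
      (fun t => Real.exp (-t) * StochHeat.semigroup P v t (StochHeat.Geps h ρ ε) z) (Ioi 0)) ∧
    -- `U` is in `D(Λ)`
    StochHeat.Ulim h ∈ StochHeat.domainΛ μ ∧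
    -- `U_ε` converges to `U` in `D(Λ)`
    (∀ ε, 0 < ε → StochHeat.Ueps P v h ρ ε ∈ StochHeat.domainΛ μ) ∧
    Tendsto (fun ε => StochHeat.formΛ₁ μ
        (fun z => StochHeat.Ueps P v h ρ ε z - StochHeat.Ulim h z)
        (fun z => StochHeat.Ueps P v h ρ ε z - StochHeat.Ulim h z))
      (𝓝[>] 0) (𝓝 0) := by
  have hlaw : StochHeat.IsBridgeLaw μ := by
    subst hμ
    exact ⟨hβ.isProbabilityMeasure_lawOnH, hβ.charFun_lawOnH⟩
  have hν := StochHeat.isProbabilityMeasure_mollMeasure hρ.continuous hρ_nonneg hρ_int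
  obtain ⟨δ, D, hc⟩ := StochHeat.exists_isCutoff hh.continuous hh_compact hh_supp
  set ν := StochHeat.mollMeasure ρ
  have hadm := fun ε => StochHeat.isAdmissible_convKer ν ε
  have hGt : ∀ z t, 0 < t → StochHeat.Gt h t z = (1 / 2) * ∫ r in Ioo (0 : ℝ) 1, h r *
      StochHeat.convKer₂ ν 0 (StochHeat.varSeries t r) ⟪StochHeat.heatVec t r, z⟫_ℝ := by
    intro z t ht
    rw [StochHeat.Gt, ← integral_const_mul]
    refine setIntegral_congr_fun measurableSet_Ioo fun r hr => ?_
    simp only [StochHeat.convKer₂_zero]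
    exact StochHeat.GtIntegrand_eq h ht z hr
  have hsem : ∀ ε, 0 < ε → ∀ z t, 0 < t →
      StochHeat.semigroup P v t (StochHeat.Geps h ρ ε) z = (1 / 2) * ∫ r in Ioo (0 : ℝ) 1, h r *
        StochHeat.convKer₂ ν ε (StochHeat.varSeries t r) ⟪StochHeat.heatVec t r, z⟫_ℝ :=
    fun ε hε z t ht => (hv z).integral_Geps hξ hρ hρ_nonneg hρ_supp hh.continuous hh_compact hε ht
  have hU : StochHeat.Ulim h = StochHeat.pot h (StochHeat.convKer₂ ν 0) (Ioi 0) := by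
    funext z
    rw [(hadm 0).pot_eq_iterated hc]
    exact setIntegral_congr_fun measurableSet_Ioi fun t ht => by simp only [hGt z t ht]
  have hUeps : ∀ ε, 0 < ε →
      StochHeat.Ueps P v h ρ ε = StochHeat.pot h (StochHeat.convKer₂ ν ε) (Ioi 0) := by
    intro ε hε
    funext z
    rw [(hadm ε).pot_eq_iterated hc]
    exact setIntegral_congr_fun measurableSet_Ioi fun t ht => by simp only [hsem ε hε z t ht]
  have hdom : ∀ ε, StochHeat.pot h (StochHeat.convKer₂ ν ε) (Ioi 0) ∈ StochHeat.domainΛ μ :=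
    fun ε => (((hadm ε).exists_hasSobolevGradient hlaw hc).imp fun _ hg => hg.1)
  refine ⟨fun z => ⟨fun t ht => ?_, ?_⟩, fun ε hε z => ?_, hU ▸ hdom 0,
    fun ε hε => hUeps ε hε ▸ hdom ε, ?_⟩
  · refine IntegrableOn.congr_fun (((hadm 0).integrableOn_space hc ht z).const_mul (1 / 2))
      (fun r hr => ?_) measurableSet_Ioo
    simp only [StochHeat.convKer₂_zero]
    exact (StochHeat.GtIntegrand_eq h ht z hr).symm
  · exact ((hadm 0).integrableOn_iterated hc z).congr_fun
      (fun t ht => by simp only [hGt z t ht]) measurableSet_Ioi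
  · exact ((hadm ε).integrableOn_iterated hc z).congr_fun
      (fun t ht => by simp only [hsem ε hε z t ht]) measurableSet_Ioi
  · have hA : 0 ≤ StochHeat.gaussBound := by linarith [StochHeat.gaussBound_ge]
    have hle : 𝓝[>] (0 : ℝ) ≤ 𝓝 0 := nhdsWithin_le_nhds
    -- The potential is linear in the kernel, so U_ε - U is the potential of the kernel at ε minus
    -- the kernel at 0. These differences are admissible with twice the common constant and tend to
    -- 0 pointwise together with their derivatives.
    refine (StochHeat.tendsto_formΛ₁_pot_zero (l := 𝓝[>] (0 : ℝ)) hlaw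
      (fun ε => (hadm ε).sub (hadm 0) hA hA) hc (fun q hq x => ?_) fun q hq x => ?_).congr' ?_
    · have := ((StochHeat.tendsto_convKer₂ ν hq x).mono_left hle).sub_const
        (StochHeat.convKer₂ ν 0 q x)
      rwa [sub_self] at this
    · have := ((StochHeat.tendsto_convKer₃ ν hq x).mono_left hle).sub_const
        (StochHeat.convKer₃ ν 0 q x)
      rwa [sub_self] at this
    · filter_upwards [self_mem_nhdsWithin] with ε hε
      have h1 : (fun z => StochHeat.Ueps P v h ρ ε z - StochHeat.Ulim h z) =
          StochHeat.pot h (fun q x => StochHeat.convKer₂ ν ε q x - StochHeat.convKer₂ ν 0 q x)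
            (Ioi 0) := by
        funext z
        rw [hUeps ε hε, hU]
        exact (hadm ε).pot_sub (hadm 0) hc z
      rw [h1]
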